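/- Let $G$ be a second countable locally compact Hausdorff group (for instance a second countable unimodular Lie group) acting continuously from the right on a nonempty second countable locally compact Hausdorff space $X$, and let $\Gamma=X\times G$ be the transformation groupoid, in which $(x,g)$ is an arrow from $x$ to $xg$ and $(xg,h)(x,g)=(x,gh)$; its unit space is identified with $X$. A *unitary representation* of $\Gamma$ consists of a measurable bundle $\{H_x\}_{x\in X}$ of separable complex Hilbert spaces, a Borel probability measure $\mu$ on $X$ that is quasi-invariant under $G$, and unitary operators $L(x,g):H_x\to H_{xg}$ such that $L(x,e)=\mathrm{id}$ for all $x$, $L(xg,h)L(x,g)=L(x,gh)$ for almost all $(x,g,h)$, $L(xg,g^{-1})=L(x,g)^{-1}$ for almost all $(x,g)$ (with respect to $\mu$ and Haar measure), and $(x,g)\mapsto\langle L(x,g)\xi(x),\eta(xg)\rangle$ is measurable for all measurable sections $\xi,\eta$. It is *strict* if the two almost-everywhere identities hold everywhere. Two representations $(\mu,\{H_x\},L)$ and $(\mu',\{H'_x\},L')$ are *equivalent* if $\mu|_{\{H_x\neq0\}}$ and $\mu'|_{\{H'_x\ne0\}}$ have the same null sets and there are bounded operators $T_x:H_x\to H'_x$,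 unitary for almost every $x$ with respect to $\mu|_{\{H_x\neq 0\}}$, identifying the measurable sections of the two bundles up to null sets, with $T_{xg}L(x,g)=L'(x,g)T_x$ for almost every $(x,g)$. A *system of imprimitivity* $(G,U,X,\pi)$ with base $X$ consists of a strongly continuous unitary representation $U$ of $G$ and a nondegenerate $*$-representation $\pi$ of $C_0(X)$ on the same separable complex Hilbert space, with $U(g)\pi(f)U(g^{-1})=\pi(R_gf)$, where $(R_gf)(x)=f(xg)$. Two systems are equivalent if a unitary operator intertwines both $U$ and $\pi$. Then there is a one-to-one correspondence between equivalence classes of unitary representations of $\Gamma$ and equivalence classes of systems of imprimitivity of $G$ with base $X$. It sends the class of $(\mu,\{H_x\},L)$ to the class of the system on $L^2(X,\{H_x\},\mu)$ given by $$(\pi(f)\xi)(x)=f(x)\xi(x),\qquad (U(g)\xi)(x)=\rho_g(x)^{1/2}L(x,g)^{-1}\xi(xg)\quad\text{for almost every } g\in G,$$ where $\rho_g$ is the density determined by $\int_X F(xg)\rho_g(x)\,d\mu(x)=\int_X F\,d\mu$ (the formula for almost every $g$ determines $U$ by strong continuity). Moreover, every unitary representation of $\Gamma$ is equivalent to a strict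 one. -/

import Mathlib

open MeasureTheory
open scoped InnerProductSpace RightActions ZeroAtInfty

universe u v w w'

noncomputable section

/-! ### The transformation groupoid `Γ = X × G` of a right action

`x <• g` denotes the right action of `g : G` on `x : X`.  An element `(x, g)` of `Γ` is an arrow
from `x` to `x <• g`. The unit space is identified with `X`. -/

namespace TransformationGroupoid

/-- Arrows of the transformation groupoid from `x` to `y`: the pairs `(x, g)` with `x <• g = y`. -/
structure Hom (G : Type v) {X : Type u} [Group G] [MulAction Gᵐᵒᵖ X] (x y : X) where
  /-- the group component of the arrow -/
  elt : G
  /-- the arrow ends at `y` -/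
  target_eq : x <• elt = y

variable {G : Type v} {X : Type u} [Group G] [MulAction Gᵐᵒᵖ X]

/-- The element `(x, g)` of `Γ`, as an arrow from `x` to `x <• g`. -/
def arrow (x : X) (g : G) : Hom G x (x <• g) := ⟨g, rfl⟩

/-- The unit `(x, e)`. -/
def unit (x : X) : Hom G x x := ⟨1, by simp⟩

/-- The product `(x <• g, h) (x, g) = (x, g h)`. -/
def mul {x y z : X} (b : Hom G y z) (a : Hom G x y) : Hom G x z :=
  ⟨a.elt * b.elt, by rw [MulOpposite.op_mul, mul_smul, a.target_eq, b.target_eq]⟩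

/-- The inverse `(x, g)⁻¹ = (x <• g, g⁻¹)`. -/
def inv {x y : X} (a : Hom G x y) : Hom G y x :=
  ⟨a.elt⁻¹, by rw [MulOpposite.op_inv, inv_smul_eq_iff, a.target_eq]⟩

end TransformationGroupoid

/-! ### Measurable Hilbert bundles -/

/-- A (measurable) Hilbert bundle over `X`: a family of complex Hilbert spaces together with the
linear space of its measurable sections, which contains a sequence that is total in each fibre (in
particular the fibres are separable). -/
structure HilbertBundle (X : Type u) [MeasurableSpace X] where
  /-- the fibres -/
  Fiber : X → Type w
  [normed : ∀ x, NormedAddCommGroup (Fiber x)]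
  [innerProduct : ∀ x, InnerProductSpace ℂ (Fiber x)]
  [complete : ∀ x, CompleteSpace (Fiber x)]
  /-- the measurable sections -/
  sections : Submodule ℂ (∀ x, Fiber x)
  measurable_inner : ∀ ξ ∈ sections, ∀ η ∈ sections, Measurable fun x => ⟪ξ x, η x⟫_ℂ
  mem_sections : ∀ ξ : ∀ x, Fiber x,
    (∀ η ∈ sections, Measurable fun x => ⟪η x, ξ x⟫_ℂ) → ξ ∈ sections
  exists_total : ∃ e : ℕ → ∀ x, Fiber x, (∀ n, e n ∈ sections) ∧
    ∀ x, (Submodule.span ℂ (Set.range fun n => e n x)).topologicalClosure = ⊤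

namespace HilbertBundle

attribute [instance] HilbertBundle.normed HilbertBundle.innerProduct HilbertBundle.complete

variable {X : Type u} [MeasurableSpace X] (B : HilbertBundle.{u, w} X)

/-- The points with nonzero fibre. -/
def nonzeroSet : Set X := {x | Nontrivial (B.Fiber x)}

lemma measurable_norm {ξ : ∀ x, B.Fiber x} (hξ : ξ ∈ B.sections) :
    Measurable fun x => ‖ξ x‖ := by
  have h : (fun x => ‖ξ x‖) = fun x => √(RCLike.re ⟪ξ x, ξ x⟫_ℂ) := by
    funext x
    exact norm_eq_sqrt_re_inner (𝕜 := ℂ) (ξ x)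
  rw [h]
  exact (RCLike.measurable_re.comp (B.measurable_inner ξ hξ ξ hξ)).sqrt

lemma measurableSet_nonzeroSet : MeasurableSet B.nonzeroSet := by
  obtain ⟨e, he, ht⟩ := B.exists_total
  have h : B.nonzeroSet = ⋃ n, {x | ‖e n x‖ ≠ 0} := by
    ext x
    simp only [nonzeroSet, Set.mem_ofPred_eq, Set.mem_iUnion, ne_eq, norm_eq_zero]
    constructor
    · intro hx
      by_contra! hn
      have h1 : Submodule.span ℂ (Set.range fun n => e n x) = ⊥ := by
        rw [Submodule.span_eq_bot]
        rintro _ ⟨n, rfl⟩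
        exact hn n
      have h2 := ht x
      rw [h1, IsClosed.submodule_topologicalClosure_eq (by simp)] at h2
      exact bot_ne_top h2
    · rintro ⟨n, hn⟩
      exact ⟨e n x, 0, hn⟩
  rw [h]
  exact MeasurableSet.iUnion fun n =>
    (B.measurable_norm (he n)) (measurableSet_singleton (0 : ℝ)).compl

/-- The measurable square integrable sections. -/
def l2Sections (μ : Measure X) : Submodule ℂ (∀ x, B.Fiber x) where
  carrier := {ξ | ξ ∈ B.sections ∧ MemLp (fun x => ‖ξ x‖) 2 μ}
  zero_mem' := ⟨B.sections.zero_mem, by simp⟩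
  add_mem' {ξ η} hξ hη :=
    ⟨B.sections.add_mem hξ.1 hη.1,
      (hξ.2.add hη.2).mono
        (B.measurable_norm (B.sections.add_mem hξ.1 hη.1)).aestronglyMeasurable
        (Filter.Eventually.of_forall fun x => by
          simp only [Pi.add_apply, Real.norm_eq_abs]
          rw [abs_of_nonneg (norm_nonneg (ξ x + η x)),
            abs_of_nonneg (add_nonneg (norm_nonneg (ξ x)) (norm_nonneg (η x)))]
          exact norm_add_le (ξ x) (η x))⟩
  smul_mem' c ξ hξ :=
    ⟨B.sections.smul_mem c hξ.1, by
      simpa only [Pi.smul_apply, norm_smul] using hξ.2.const_mul ‖c‖⟩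

variable (μ : Measure X)

/-- The type of measurable square integrable sections, to be given the `L²` seminorm. -/
def L2Section : Type (max u w) := B.l2Sections μ

instance : AddCommGroup (B.L2Section μ) := inferInstanceAs (AddCommGroup (B.l2Sections μ))

instance : Module ℂ (B.L2Section μ) := inferInstanceAs (Module ℂ (B.l2Sections μ))

instance : CoeFun (B.L2Section μ) fun _ => ∀ x, B.Fiber x := ⟨fun ξ => Subtype.val ξ⟩

lemma integrable_inner (ξ η : B.L2Section μ) :
    Integrable (fun x => ⟪ξ x, η x⟫_ℂ) μ :=
  (ξ.2.2.integrable_mul η.2.2).mono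
    (B.measurable_inner _ ξ.2.1 _ η.2.1).aestronglyMeasurable
    (Filter.Eventually.of_forall fun x => by
      simpa using norm_inner_le_norm (𝕜 := ℂ) (ξ x) (η x))

/-- The semi-inner product `∫ ⟪ξ x, η x⟫ dμ(x)` on square integrable sections. -/
@[reducible]
def l2Core : PreInnerProductSpace.Core ℂ (B.L2Section μ) where
  inner ξ η := ∫ x, ⟪ξ x, η x⟫_ℂ ∂μ
  conj_inner_symm ξ η := by
    rw [← integral_conj]
    exact integral_congr_ae (Filter.Eventually.of_forall fun x => inner_conj_symm _ _)
  re_inner_nonneg ξ := by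
    rw [← integral_re (B.integrable_inner μ ξ ξ)]
    exact integral_nonneg fun x => inner_self_nonneg
  add_left ξ η ζ := by
    rw [← integral_add (B.integrable_inner μ ξ ζ) (B.integrable_inner μ η ζ)]
    exact integral_congr_ae (Filter.Eventually.of_forall fun x => inner_add_left _ _ _)
  smul_left ξ η c := by
    rw [← integral_const_mul]
    exact integral_congr_ae (Filter.Eventually.of_forall fun x => inner_smul_left _ _ _)

instance : SeminormedAddCommGroup (B.L2Section μ) :=
  @InnerProductSpace.Core.toSeminormedAddCommGroup ℂ _ _ _ _ (B.l2Core μ)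

instance : InnerProductSpace ℂ (B.L2Section μ) :=
  InnerProductSpace.ofCore (B.l2Core μ)

/-- The Hilbert space `L²(X, {H_x}, μ)`: square integrable sections modulo sections of norm `0`,
that is, modulo equality almost everywhere. -/
abbrev L2 : Type (max u w) := SeparationQuotient (B.L2Section μ)

/-- The class in `L²(X, {H_x}, μ)` of a square integrable section. -/
abbrev toL2 (ξ : B.L2Section μ) : B.L2 μ := SeparationQuotient.mk ξ

end HilbertBundle

/-! ### Unitary representations of the transformation groupoid -/

/-- The measure `μ` on `X` is quasi-invariant: right translations preserve its null sets. -/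
def QuasiInvariant (G : Type v) {X : Type u} [Group G] [MulAction Gᵐᵒᵖ X] [MeasurableSpace X]
    (μ : Measure X) : Prop :=
  ∀ g : G, μ.map (fun x => x <• g) ≪ μ

section Representations

variable (G : Type v) (X : Type u) [Group G] [TopologicalSpace G] [IsTopologicalGroup G]
  [LocallyCompactSpace G] [MeasurableSpace G] [BorelSpace G]
  [MeasurableSpace X] [MulAction Gᵐᵒᵖ X]

/-- A unitary representation of the transformation groupoid `X × G`: a Hilbert bundle over the unit
space `X`, a quasi-invariant probability measure `μ` on `X`, and unitary operators
`L γ` from the fibre at the source of `γ` to the fibre at its target.  The groupoid carries the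
measure class of `μ × Haar`; composable pairs `(x <• g, h), (x, g)` are parametrized by `(x, g, h)`
and carry the measure class of `μ × Haar × Haar`. -/
structure GroupoidRep where
  /-- the Hilbert bundle -/
  bundle : HilbertBundle.{u, w} X
  /-- the measure on the unit space -/
  μ : Measure X
  [isProbabilityMeasure : IsProbabilityMeasure μ]
  quasiInvariant : QuasiInvariant G μ
  /-- the operators of the representation -/
  L : ∀ {x y : X}, TransformationGroupoid.Hom G x y → (bundle.Fiber x ≃ₗᵢ[ℂ] bundle.Fiber y)
  map_unit : ∀ x, L (TransformationGroupoid.unit x) = LinearIsometryEquiv.refl ℂ (bundle.Fiber x)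
  map_mul : ∀ᵐ t ∂μ.prod ((Measure.haar : Measure G).prod (Measure.haar : Measure G)),
    L (TransformationGroupoid.mul
        (TransformationGroupoid.arrow (t.1 <• t.2.1) t.2.2)
        (TransformationGroupoid.arrow t.1 t.2.1)) =
      (L (TransformationGroupoid.arrow t.1 t.2.1)).trans
        (L (TransformationGroupoid.arrow (t.1 <• t.2.1) t.2.2))
  map_inv : ∀ᵐ t ∂μ.prod (Measure.haar : Measure G),
    L (TransformationGroupoid.inv (TransformationGroupoid.arrow t.1 t.2)) =
      (L (TransformationGroupoid.arrow t.1 t.2)).symm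
  measurable_coeff : ∀ ξ ∈ bundle.sections, ∀ η ∈ bundle.sections,
    Measurable fun t : X × G =>
      ⟪η (t.1 <• t.2), L (TransformationGroupoid.arrow t.1 t.2) (ξ t.1)⟫_ℂ

end Representations

namespace GroupoidRep

attribute [instance] GroupoidRep.isProbabilityMeasure

variable {G : Type v} {X : Type u} [Group G] [TopologicalSpace G] [IsTopologicalGroup G]
  [LocallyCompactSpace G] [MeasurableSpace G] [BorelSpace G]
  [MeasurableSpace X] [MulAction Gᵐᵒᵖ X]

/-- The multiplicativity and inversion laws hold everywhere, not only almost everywhere. -/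
def IsStrict (R : GroupoidRep.{u, v, w} G X) : Prop :=
  (∀ {x y z : X} (b : TransformationGroupoid.Hom G y z) (a : TransformationGroupoid.Hom G x y),
    R.L (TransformationGroupoid.mul b a) = (R.L a).trans (R.L b)) ∧
  ∀ {x y : X} (a : TransformationGroupoid.Hom G x y),
    R.L (TransformationGroupoid.inv a) = (R.L a).symm

/-- The measure restricted to the set where the fibres are nonzero.  Zero fibres contribute nothing
to the representation, so only the class of this measure matters. -/
def essMeasure (R : GroupoidRep.{u, v, w} G X) : Measure X := R.μ.restrict R.bundle.nonzeroSet

/-- Unitary equivalence of groupoid representations: the measures (restricted to the nonzero fibres)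
are equivalent, and there is, almost everywhere, a unitary between the fibres that identifies the
measurable sections of the two bundles up to null sets and intertwines the two representations
almost everywhere on the groupoid. -/
def Equivalent (R₁ R₂ : GroupoidRep.{u, v, w} G X) : Prop :=
  R₁.essMeasure ≪ R₂.essMeasure ∧ R₂.essMeasure ≪ R₁.essMeasure ∧
  ∃ T : ∀ x, R₁.bundle.Fiber x →L[ℂ] R₂.bundle.Fiber x,
    (∀ᵐ x ∂(R₁.essMeasure), (∀ v, ‖T x v‖ = ‖v‖) ∧ Function.Surjective (T x)) ∧
    (∀ ξ ∈ R₁.bundle.sections, ∃ η ∈ R₂.bundle.sections,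
      ∀ᵐ x ∂(R₁.essMeasure), T x (ξ x) = η x) ∧
    (∀ η ∈ R₂.bundle.sections, ∃ ξ ∈ R₁.bundle.sections,
      ∀ᵐ x ∂(R₁.essMeasure), T x (ξ x) = η x) ∧
    ∀ᵐ t ∂(R₁.essMeasure.prod (Measure.haar : Measure G)), ∀ v : R₁.bundle.Fiber t.1,
      T (t.1 <• t.2) (R₁.L (TransformationGroupoid.arrow t.1 t.2) v) =
        R₂.L (TransformationGroupoid.arrow t.1 t.2) (T t.1 v)

lemma Equivalent.refl (R : GroupoidRep.{u, v, w} G X) : R.Equivalent R :=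
  ⟨Measure.AbsolutelyContinuous.rfl, Measure.AbsolutelyContinuous.rfl,
    fun _ => ContinuousLinearMap.id ℂ _,
    Filter.Eventually.of_forall fun _ => ⟨fun _ => rfl, fun v => ⟨v, rfl⟩⟩,
    fun ξ hξ => ⟨ξ, hξ, Filter.Eventually.of_forall fun _ => rfl⟩,
    fun ξ hξ => ⟨ξ, hξ, Filter.Eventually.of_forall fun _ => rfl⟩,
    Filter.Eventually.of_forall fun _ _ => rfl⟩

lemma ae_prod_of_ae (R : GroupoidRep.{u, v, w} G X) {p : X → Prop}
    (hp : ∀ᵐ x ∂(R.essMeasure), p x) :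
    ∀ᵐ t ∂(R.essMeasure.prod (Measure.haar : Measure G)), p t.1 :=
  Measure.quasiMeasurePreserving_fst.ae hp

variable [TopologicalSpace X] [BorelSpace X] [SecondCountableTopology X]
  [SecondCountableTopology G] [ContinuousSMul Gᵐᵒᵖ X]

lemma essMeasure_quasiInvariant (R : GroupoidRep.{u, v, w} G X)
    (g : G) : R.essMeasure.map (fun x => x <• g) ≪ R.essMeasure := by
  have hm : Measurable (fun x : X => x <• g) := (continuous_const_smul (MulOpposite.op g)).measurable
  have hpre : (fun x : X => x <• g) ⁻¹' R.bundle.nonzeroSet = R.bundle.nonzeroSet := by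
    ext x
    exact ((R.L (TransformationGroupoid.arrow x g)).toEquiv.nontrivial_congr).symm
  unfold essMeasure
  have h := Measure.restrict_map (μ := R.μ) hm R.bundle.measurableSet_nonzeroSet
  rw [hpre] at h
  rw [← h]
  exact (R.quasiInvariant g).restrict _

/-- What holds at almost every point also holds at the target of almost every arrow. -/
lemma ae_target (R : GroupoidRep.{u, v, w} G X)
    {p : X → Prop} (hp : ∀ᵐ x ∂(R.essMeasure), p x) :
    ∀ᵐ t ∂(R.essMeasure.prod (Measure.haar : Measure G)), p (t.1 <• t.2) := by
  have : SFinite R.essMeasure := by unfold essMeasure; infer_instance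
  obtain ⟨N, hsub, hN, h0⟩ := exists_measurable_superset_of_null (ae_iff.1 hp)
  have hm : Measurable fun t : X × G => t.1 <• t.2 :=
    ((MulOpposite.continuous_op.comp continuous_snd).smul continuous_fst).measurable
  have hz : (R.essMeasure.prod (Measure.haar : Measure G))
      ((fun t : X × G => t.1 <• t.2) ⁻¹' N) = 0 := by
    rw [Measure.prod_apply_symm (hm hN)]
    refine (lintegral_congr fun g => ?_).trans lintegral_zero
    have hmg : Measurable (fun x : X => x <• g) := (continuous_const_smul (MulOpposite.op g)).measurable
    have := R.essMeasure_quasiInvariant g h0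
    rwa [Measure.map_apply hmg hN] at this
  rw [ae_iff]
  exact measure_mono_null (fun t ht => hsub ht) hz

lemma Equivalent.symm {R₁ R₂ : GroupoidRep.{u, v, w} G X} (h : R₁.Equivalent R₂) :
    R₂.Equivalent R₁ := by
  obtain ⟨h12, h21, T, hT, hs, hs', hI⟩ := h
  have : SFinite R₁.essMeasure := by unfold essMeasure; infer_instance
  have : SFinite R₂.essMeasure := by unfold essMeasure; infer_instance
  have key : ∀ x, (∀ v, ‖T x v‖ = ‖v‖) → ∀ v, (T x).adjoint (T x v) = v := by
    intro x hx v
    have := (ContinuousLinearMap.norm_map_iff_adjoint_comp_self (T x)).1 hx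
    exact DFunLike.congr_fun this v
  refine ⟨h21, h12, fun x => (T x).adjoint, ?_, ?_, ?_, ?_⟩
  · refine h21.ae_le (hT.mono fun x hx => ⟨fun v => ?_, fun v => ⟨T x v, key x hx.1 v⟩⟩)
    obtain ⟨v, rfl⟩ := hx.2 v
    rw [key x hx.1, hx.1]
  · intro η hη
    obtain ⟨ξ, hξ, he⟩ := hs' η hη
    refine ⟨ξ, hξ, h21.ae_le ?_⟩
    filter_upwards [he, hT] with x hx hx'
    rw [← hx, key x hx'.1]
  · intro ξ hξ
    obtain ⟨η, hη, he⟩ := hs ξ hξ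
    refine ⟨η, hη, h21.ae_le ?_⟩
    filter_upwards [he, hT] with x hx hx'
    rw [← hx, key x hx'.1]
  · refine (h21.prod Measure.AbsolutelyContinuous.rfl).ae_le ?_
    filter_upwards [hI, R₁.ae_prod_of_ae hT, R₁.ae_target hT] with t ht h1 h2 v
    obtain ⟨v, rfl⟩ := h1.2 v
    rw [← ht, key _ h2.1, key _ h1.1]

lemma Equivalent.trans {R₁ R₂ R₃ : GroupoidRep.{u, v, w} G X} (h : R₁.Equivalent R₂)
    (h' : R₂.Equivalent R₃) : R₁.Equivalent R₃ := by
  obtain ⟨h12, h21, T, hT, hs, hs', hI⟩ := h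
  obtain ⟨h23, h32, T', hT', ht, ht', hI'⟩ := h'
  have : SFinite R₁.essMeasure := by unfold essMeasure; infer_instance
  have : SFinite R₂.essMeasure := by unfold essMeasure; infer_instance
  refine ⟨h12.trans h23, h32.trans h21, fun x => (T' x).comp (T x), ?_, ?_, ?_, ?_⟩
  · filter_upwards [hT, h12.ae_le hT'] with x h1 h2
    exact ⟨fun v => (h2.1 _).trans (h1.1 v), h2.2.comp h1.2⟩
  · intro ξ hξ
    obtain ⟨η, hη, he⟩ := hs ξ hξ
    obtain ⟨ζ, hζ, he'⟩ := ht η hη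
    refine ⟨ζ, hζ, ?_⟩
    filter_upwards [he, h12.ae_le he'] with x h1 h2
    rw [ContinuousLinearMap.comp_apply, h1, h2]
  · intro ζ hζ
    obtain ⟨η, hη, he'⟩ := ht' ζ hζ
    obtain ⟨ξ, hξ, he⟩ := hs' η hη
    refine ⟨ξ, hξ, ?_⟩
    filter_upwards [he, h12.ae_le he'] with x h1 h2
    rw [ContinuousLinearMap.comp_apply, h1, h2]
  · filter_upwards [hI, (h12.prod Measure.AbsolutelyContinuous.rfl).ae_le hI'] with t h1 h2 v
    rw [ContinuousLinearMap.comp_apply, ContinuousLinearMap.comp_apply, h1, h2]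

variable (G X) in
/-- Unitary equivalence of groupoid representations, as an equivalence relation. -/
instance setoid : Setoid (GroupoidRep.{u, v, w} G X) where
  r := Equivalent
  iseqv := ⟨Equivalent.refl, Equivalent.symm, Equivalent.trans⟩

end GroupoidRep

/-! ### Systems of imprimitivity -/

section Imprimitivity

variable (G : Type v) (X : Type u) [Group G] [TopologicalSpace G]
  [TopologicalSpace X] [MulAction Gᵐᵒᵖ X] [ContinuousConstSMul Gᵐᵒᵖ X]

variable {G X} in
/-- The right translate `(R_g f)(x) = f(x g)` of `f ∈ C₀(X)`. -/
def rightTranslate (g : G) (f : C₀(X, ℂ)) : C₀(X, ℂ) :=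
  f.comp ⟨⟨fun x => x <• g, continuous_const_smul (MulOpposite.op g)⟩,
    (Homeomorph.smul (MulOpposite.op g)).isClosedEmbedding.tendsto_cocompact⟩

/-- A system of imprimitivity `(G, U, X, π)` of `G` with base `X`, on a separable Hilbert space `H`:
a strongly continuous unitary representation `U` of `G` and a nondegenerate `*`-representation `π`
of `C₀(X)` with `U(g) π(f) U(g⁻¹) = π(R_g f)`. -/
structure SystemOfImprimitivity where
  /-- the Hilbert space -/
  H : Type w
  [normed : NormedAddCommGroup H]
  [innerProduct : InnerProductSpace ℂ H]
  [complete : CompleteSpace H]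
  [separable : TopologicalSpace.SeparableSpace H]
  /-- the unitary representation of the group -/
  U : G →* unitary (H →L[ℂ] H)
  continuous_U : ∀ v : H, Continuous fun g => (U g : H →L[ℂ] H) v
  /-- the representation of the algebra of functions -/
  π : C₀(X, ℂ) →⋆ₙₐ[ℂ] (H →L[ℂ] H)
  nondegenerate :
    (Submodule.span ℂ {v : H | ∃ f : C₀(X, ℂ), ∃ w : H, π f w = v}).topologicalClosure = ⊤
  covariant : ∀ (g : G) (f : C₀(X, ℂ)),
    (U g : H →L[ℂ] H) * π f * (U g⁻¹ : H →L[ℂ] H) = π (rightTranslate g f)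

end Imprimitivity

namespace SystemOfImprimitivity

attribute [instance] SystemOfImprimitivity.normed SystemOfImprimitivity.innerProduct
  SystemOfImprimitivity.complete SystemOfImprimitivity.separable

variable {G : Type v} {X : Type u} [Group G] [TopologicalSpace G]
  [TopologicalSpace X] [MulAction Gᵐᵒᵖ X] [ContinuousConstSMul Gᵐᵒᵖ X]

/-- Unitary equivalence of systems of imprimitivity. -/
def Equivalent (S₁ S₂ : SystemOfImprimitivity.{u, v, w} G X) : Prop :=
  ∃ W : S₁.H ≃ₗᵢ[ℂ] S₂.H,
    (∀ (g : G) (v : S₁.H), W ((S₁.U g : S₁.H →L[ℂ] S₁.H) v) =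
      (S₂.U g : S₂.H →L[ℂ] S₂.H) (W v)) ∧
    ∀ (f : C₀(X, ℂ)) (v : S₁.H), W (S₁.π f v) = S₂.π f (W v)

variable (G X) in
/-- Unitary equivalence of systems of imprimitivity, as an equivalence relation. -/
instance setoid : Setoid (SystemOfImprimitivity.{u, v, w} G X) where
  r := Equivalent
  iseqv :=
    { refl := fun S => ⟨LinearIsometryEquiv.refl ℂ S.H, fun _ _ => rfl, fun _ _ => rfl⟩
      symm := by
        rintro S₁ S₂ ⟨W, hU, hπ⟩
        refine ⟨W.symm, fun g v => ?_, fun f v => ?_⟩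
        · rw [LinearIsometryEquiv.symm_apply_eq, hU, LinearIsometryEquiv.apply_symm_apply]
        · rw [LinearIsometryEquiv.symm_apply_eq, hπ, LinearIsometryEquiv.apply_symm_apply]
      trans := by
        rintro S₁ S₂ S₃ ⟨W, hU, hπ⟩ ⟨W', hU', hπ'⟩
        refine ⟨W.trans W', fun g v => ?_, fun f v => ?_⟩
        · simp only [LinearIsometryEquiv.trans_apply, hU, hU']
        · simp only [LinearIsometryEquiv.trans_apply, hπ, hπ'] }

end SystemOfImprimitivity

/-! ### The system of imprimitivity attached to a groupoid representation -/

namespace GroupoidRep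

variable {G : Type v} {X : Type u} [Group G] [TopologicalSpace G] [IsTopologicalGroup G]
  [LocallyCompactSpace G] [MeasurableSpace G] [BorelSpace G]
  [TopologicalSpace X] [MeasurableSpace X] [MulAction Gᵐᵒᵖ X] [ContinuousConstSMul Gᵐᵒᵖ X]

/-- The Radon–Nikodym density `ρ_g` of the translated measure, characterised by
`∫ F(x g) ρ_g(x) dμ(x) = ∫ F(x) dμ(x)`. -/
def density (R : GroupoidRep.{u, v, w} G X) (g : G) (x : X) : ℝ :=
  ((R.μ.map fun y => y <• g⁻¹).rnDeriv R.μ x).toReal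

/-- `S` is (up to a unitary `W`) the system of imprimitivity on `L²(X, {H_x}, μ)` given by the
representation `R` through
`(π(f) ξ)(x) = f(x) ξ(x)` and `(U(g) ξ)(x) = ρ_g(x)^{1/2} L(x, g)⁻¹ ξ(x g)`,
the latter for almost every `g` (which determines `U`, by strong continuity). -/
def IntegratesTo (R : GroupoidRep.{u, v, w} G X) (S : SystemOfImprimitivity.{u, v, w'} G X) :
    Prop :=
  ∃ W : R.bundle.L2 R.μ ≃ₗᵢ[ℂ] S.H,
    (∀ (f : C₀(X, ℂ)) (ξ ζ : R.bundle.L2Section R.μ),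
      S.π f (W (R.bundle.toL2 R.μ ξ)) = W (R.bundle.toL2 R.μ ζ) ↔
        ∀ᵐ x ∂(R.μ), ζ x = f x • ξ x) ∧
    ∀ᵐ g ∂(Measure.haar : Measure G), ∀ ξ ζ : R.bundle.L2Section R.μ,
      (S.U g : S.H →L[ℂ] S.H) (W (R.bundle.toL2 R.μ ξ)) = W (R.bundle.toL2 R.μ ζ) ↔
        ∀ᵐ x ∂(R.μ), ζ x = ((√(R.density g x) : ℝ) : ℂ) •
          (R.L (TransformationGroupoid.arrow x g)).symm (ξ (x <• g))

end GroupoidRep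

end

/-!
# Representations of a transformation groupoid and systems of imprimitivity

The correspondence is `R ↦ S` whenever `R.IntegratesTo S`. It is a well-defined bijection on
equivalence classes by four facts.

*Existence of `S`* (`GroupoidRep.exists_integratesTo`). For every `g` the operator
`(V(g) ξ)(x) = ρ_g(x)^{1/2} L(x, g)⁻¹ ξ(x g)` is unitary on `L²`, and `V` is multiplicative almost
everywhere. Every element of `G` is a product of two elements of a given conull set, so `V` agrees
almost everywhere with a homomorphism `U` (`exists_monoidHom_of_ae_mul`), which is strongly continuous
by Steinhaus' theorem (`continuous_of_ae_measurable`). Joint measurability rests on a jointly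
measurable version of the densities (`QuasiInvariant.exists_isSqrtDensity`).

*Invariance* (`IntegratesTo.equivalent`, `IntegratesTo.of_equivalent`,
`IntegratesTo.of_rep_equivalent`). The system is determined up to equivalence by the class of `R`: a
fibrewise unitary `T` induces the unitary `ξ ↦ (dμ₁ / dμ₂)^{1/2} T ξ` of the `L²` spaces.

*Injectivity* (`IntegratesTo.rep_equivalent`). A unitary operator between the `L²` spaces of two
bundles which commutes with `C₀(X)` preserves the measures `⟪ξ, η⟫ μ`. Hence it identifies the measure
classes and is given by unitary operators between the fibres (`exists_fiberwise`). Comparison of the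
two formulas for `U` shows that these operators intertwine the representations.

*Surjectivity, by a strict representation* (`SystemOfImprimitivity.exists_strict_integratesTo`). By the
spectral theorem, `S` embeds into some `L²(μ, ℓ²)` by an isometry `J` which turns `π` into
multiplication (`exists_spectral_embedding`); covariance makes `μ` quasi-invariant. For a dense
sequence `e n`, the vectors `z n (x, g) = ρ_g(x)^{-1/2} (J U(g) e n)(x)`, suitably normalized, play the
role of `L(x, g)⁻¹ (e n (x g))`. Their scalar products satisfy
`⟪z n (x, g), z m (x, h)⟫ = Q n m (x g, g⁻¹ h)` almost everywhere, for a kernel `Q`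
(`SystemOfImprimitivity.isCoefficientField`). The integrated vectors `∫ F(g) z n (x, g) dg` therefore
have a Gram matrix which is unchanged if `x` is replaced by `x a` and `F` by its left translate by `a`
(`gramKernel_shiftIndex`). So the fibres spanned by the integrated vectors carry unitary operators
permuting them, for *every* arrow, and these compose strictly (`IsCoefficientField.exists_strict`). The
points where the relation for `Q` fails are dealt with by moving along the orbit; the invariant null
set of orbits on which it fails too often gets the zero fibre. The projection of `J v` to the fibres is
the required unitary operator from `S` to the `L²` space of the bundle.

Every representation is equivalent to a strict one, since by surjectivity its system also comes from a
strict representation, and by injectivity the two are equivalent.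
-/


noncomputable section

set_option linter.unusedSectionVars false

/-! ### Hilbert space preliminaries -/

/-- A linear map which preserves the norms given by a linear map of dense range extends to a linear
isometry. -/
lemma exists_linearIsometry_of_norm_eq {A E F : Type*} [AddCommGroup A] [Module ℂ A]
    [NormedAddCommGroup E] [InnerProductSpace ℂ E] [NormedAddCommGroup F] [InnerProductSpace ℂ F]
    [CompleteSpace F] (a : A →ₗ[ℂ] E) (b : A →ₗ[ℂ] F) (ha : DenseRange a)
    (h : ∀ c, ‖b c‖ = ‖a c‖) : ∃ T : E →ₗᵢ[ℂ] F, ∀ c, T (a c) = b c := by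
  have hb : ∃ C, ∀ x, ‖b x‖ ≤ C * ‖a x‖ := ⟨1, fun x => by rw [h, one_mul]⟩
  have key : ∀ c, b.extendOfNorm a (a c) = b c := LinearMap.extendOfNorm_eq ha hb
  refine ⟨⟨(b.extendOfNorm a).toLinearMap, fun x => ?_⟩, key⟩
  refine isClosed_property ha (p := fun x => ‖b.extendOfNorm a x‖ = ‖x‖)
    (isClosed_eq (b.extendOfNorm a).continuous.norm continuous_norm) (fun c => ?_) x
  rw [key, h]

lemma denseRange_linearCombination {I E : Type*} [NormedAddCommGroup E] [InnerProductSpace ℂ E]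
    (a : I → E) (ha : (Submodule.span ℂ (Set.range a)).topologicalClosure = ⊤) :
    DenseRange (Finsupp.linearCombination ℂ a) := by
  rw [DenseRange, ← LinearMap.coe_range, Finsupp.range_linearCombination]
  exact Submodule.dense_iff_topologicalClosure_eq_top.2 ha

lemma inner_linearCombination_congr {I E F : Type*}
    [NormedAddCommGroup E] [InnerProductSpace ℂ E] [NormedAddCommGroup F] [InnerProductSpace ℂ F]
    (a : I → E) (b : I → F) (h : ∀ i j, ⟪b i, b j⟫_ℂ = ⟪a i, a j⟫_ℂ) (c : I →₀ ℂ) :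
    ‖Finsupp.linearCombination ℂ b c‖ = ‖Finsupp.linearCombination ℂ a c‖ := by
  rw [norm_eq_sqrt_re_inner (𝕜 := ℂ), norm_eq_sqrt_re_inner (𝕜 := ℂ)]
  simp only [Finsupp.linearCombination_apply, Finsupp.sum, sum_inner, inner_sum, inner_smul_left,
    inner_smul_right, h]

/-- A family of vectors is determined up to an isometry by its Gram matrix. -/
lemma exists_linearIsometry_of_inner_eq {I E F : Type*}
    [NormedAddCommGroup E] [InnerProductSpace ℂ E] [NormedAddCommGroup F] [InnerProductSpace ℂ F]
    [CompleteSpace F] (a : I → E) (b : I → F)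
    (ha : (Submodule.span ℂ (Set.range a)).topologicalClosure = ⊤)
    (h : ∀ i j, ⟪b i, b j⟫_ℂ = ⟪a i, a j⟫_ℂ) : ∃ T : E →ₗᵢ[ℂ] F, ∀ i, T (a i) = b i := by
  obtain ⟨T, hT⟩ := exists_linearIsometry_of_norm_eq (Finsupp.linearCombination ℂ a)
    (Finsupp.linearCombination ℂ b) (denseRange_linearCombination a ha)
    (inner_linearCombination_congr a b h)
  refine ⟨T, fun i => ?_⟩
  simpa using hT (Finsupp.single i 1)

/-- An isometry of a complete space whose range contains a total family is surjective. -/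
lemma LinearIsometry.surjective_of_total {I E F : Type*}
    [NormedAddCommGroup E] [InnerProductSpace ℂ E] [NormedAddCommGroup F] [InnerProductSpace ℂ F]
    [CompleteSpace E] (T : E →ₗᵢ[ℂ] F) (b : I → F)
    (hb : (Submodule.span ℂ (Set.range b)).topologicalClosure = ⊤)
    (h : ∀ i, ∃ v, T v = b i) : Function.Surjective T := by
  have hc : IsClosed (LinearMap.range T.toLinearMap : Set F) := by
    rw [LinearMap.coe_range]
    exact T.isometry.isClosedEmbedding.isClosed_range
  have h1 : Submodule.span ℂ (Set.range b) ≤ LinearMap.range T.toLinearMap := by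
    rw [Submodule.span_le]
    rintro _ ⟨i, rfl⟩
    obtain ⟨v, hv⟩ := h i
    exact ⟨v, hv⟩
  have h2 := Submodule.topologicalClosure_minimal _ h1 hc
  rw [hb, top_le_iff] at h2
  exact LinearMap.range_eq_top.1 h2

/-- Total families with the same Gram matrix are unitarily equivalent. -/
lemma exists_linearIsometryEquiv_of_inner_eq {I E F : Type*}
    [NormedAddCommGroup E] [InnerProductSpace ℂ E] [NormedAddCommGroup F] [InnerProductSpace ℂ F]
    [CompleteSpace E] [CompleteSpace F] (a : I → E) (b : I → F)
    (ha : (Submodule.span ℂ (Set.range a)).topologicalClosure = ⊤)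
    (hb : (Submodule.span ℂ (Set.range b)).topologicalClosure = ⊤)
    (h : ∀ i j, ⟪b i, b j⟫_ℂ = ⟪a i, a j⟫_ℂ) : ∃ T : E ≃ₗᵢ[ℂ] F, ∀ i, T (a i) = b i := by
  obtain ⟨T, hT⟩ := exists_linearIsometry_of_inner_eq a b ha h
  exact ⟨LinearIsometryEquiv.ofSurjective T (T.surjective_of_total b hb fun i => ⟨a i, hT i⟩), hT⟩

/-- A vector orthogonal to a total family vanishes. -/
lemma eq_zero_of_inner_total {I E : Type*} [NormedAddCommGroup E] [InnerProductSpace ℂ E]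
    (a : I → E) (ha : (Submodule.span ℂ (Set.range a)).topologicalClosure = ⊤) {v : E}
    (h : ∀ i, ⟪a i, v⟫_ℂ = 0) : v = 0 := by
  have h1 : v ∈ (Submodule.span ℂ (Set.range a))ᗮ := by
    rw [Submodule.mem_orthogonal]
    intro u hu
    induction hu using Submodule.span_induction with
    | mem x hx => obtain ⟨i, rfl⟩ := hx; exact h i
    | zero => simp
    | add x y _ _ hx hy => rw [inner_add_left, hx, hy, add_zero]
    | smul c x _ hx => rw [inner_smul_left, hx, mul_zero]
  rw [← Submodule.orthogonal_closure, ha, Submodule.top_orthogonal_eq_bot] at h1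
  exact h1

/-- Conversely, a family is total as soon as its orthogonal complement vanishes. -/
lemma total_of_forall_eq_zero {I E : Type*} [NormedAddCommGroup E] [InnerProductSpace ℂ E]
    [CompleteSpace E] (a : I → E) (h : ∀ v, (∀ i, ⟪a i, v⟫_ℂ = 0) → v = 0) :
    (Submodule.span ℂ (Set.range a)).topologicalClosure = ⊤ := by
  rw [Submodule.topologicalClosure_eq_top_iff, Submodule.eq_bot_iff]
  intro v hv
  exact h v fun i => Submodule.inner_right_of_mem_orthogonal
    (Submodule.subset_span (Set.mem_range_self i)) hv

/-- The equality case of the Cauchy–Schwarz inequality `re ⟪T w, u⟫ ≤ ‖w‖ ‖u‖`, for an isometry `T`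
and vectors with `‖u‖ = ‖w‖`. -/
lemma LinearIsometry.eq_apply_of_inner {E F : Type*}
    [NormedAddCommGroup E] [InnerProductSpace ℂ E] [NormedAddCommGroup F] [InnerProductSpace ℂ F]
    (T : E →ₗᵢ[ℂ] F) {u : F} {w : E} (h : ⟪T w, u⟫_ℂ = ⟪w, w⟫_ℂ) (hn : ‖u‖ = ‖w‖) : u = T w := by
  rw [← sub_eq_zero, ← norm_eq_zero, ← sq_eq_zero_iff, @norm_sub_sq ℂ, T.norm_map, hn,
    ← inner_conj_symm, h, RCLike.conj_re, inner_self_eq_norm_sq]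
  ring

/-- The space `ℓ²` of square summable sequences, in an arbitrary universe. -/
abbrev Ell2 : Type w := lp (fun _ : ULift.{w} ℕ => ℂ) 2

instance : SecondCountableTopology Ell2.{w} := by
  have b : HilbertBasis (ULift.{w} ℕ) ℂ Ell2.{w} :=
    HilbertBasis.ofRepr (LinearIsometryEquiv.refl ℂ Ell2.{w})
  have h1 : TopologicalSpace.IsSeparable (Submodule.span ℂ (Set.range b) : Set Ell2.{w}) :=
    (Set.countable_range b).isSeparable.span
  have h2 := h1.closure
  rw [← Submodule.topologicalClosure_coe, b.dense_span] at h2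
  have : TopologicalSpace.SeparableSpace Ell2.{w} :=
    TopologicalSpace.isSeparable_univ_iff.1 (by simpa using h2)
  exact UniformSpace.secondCountable_of_separable _

instance : MeasurableSpace Ell2.{w} := borel _

instance : BorelSpace Ell2.{w} := ⟨rfl⟩

/-- Measurability into `ℓ²` can be checked on coordinates. -/
lemma measurable_ell2 {X : Type*} [MeasurableSpace X] {f : X → Ell2.{w}}
    (h : ∀ n, Measurable fun x => f x n) : Measurable f := by
  classical
  refine measurable_of_tendsto_metrizable' (Filter.atTop : Filter (Finset (ULift.{w} ℕ)))
    (f := fun s x => ∑ n ∈ s, (f x n) • (lp.single 2 n (1 : ℂ) : Ell2.{w})) (fun s => ?_) ?_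
  · exact Finset.measurable_sum _ fun n _ => (h n).smul_const _
  · rw [tendsto_pi_nhds]
    intro x
    have := lp.hasSum_single (p := 2) (by simp) (f x)
    refine this.congr fun s => Finset.sum_congr rfl fun n _ => ?_
    rw [← lp.single_smul, smul_eq_mul, mul_one]

/-- **Measurable Gram–Schmidt process.** A family of Hilbert spaces with a total sequence whose Gram
matrix is measurable embeds isometrically into the constant family `ℓ²`, so that the sections which
are measurable with respect to the sequence become the measurable functions. -/
lemma exists_measurable_embedding {X : Type*} [MeasurableSpace X] {E : X → Type*}
    [∀ x, NormedAddCommGroup (E x)] [∀ x, InnerProductSpace ℂ (E x)] (e : ℕ → ∀ x, E x)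
    (ht : ∀ x, (Submodule.span ℂ (Set.range fun n => e n x)).topologicalClosure = ⊤)
    (hm : ∀ n m, Measurable fun x => ⟪e n x, e m x⟫_ℂ) :
    ∃ ι : ∀ x, E x →ₗᵢ[ℂ] Ell2.{w}, ∀ ξ : ∀ x, E x,
      (∀ n, Measurable fun x => ⟪e n x, ξ x⟫_ℂ) ↔ Measurable fun x => ι x (ξ x) := by
  classical
  -- `S` is the set of measurable sections, `P` the property that a section is measurable and tests
  -- measurability. It passes from `e` to the orthonormalization of `e`.
  let S : Set (∀ x, E x) := {ξ | ∀ n, Measurable fun x => ⟪e n x, ξ x⟫_ℂ}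
  let P : (∀ x, E x) → Prop := fun g => g ∈ S ∧ ∀ ξ ∈ S, Measurable fun x => ⟪g x, ξ x⟫_ℂ
  have hPe : ∀ n, P (e n) := fun n => ⟨fun m => hm m n, fun ξ hξ => hξ n⟩
  have hPsmul : ∀ (c : X → ℂ) g, Measurable c → P g → P fun x => c x • g x := by
    intro c g hc hg
    refine ⟨fun n => ?_, fun ξ hξ => ?_⟩
    · simp only [inner_smul_right]
      exact hc.mul (hg.1 n)
    · simp only [inner_smul_left]
      exact (RCLike.continuous_conj.measurable.comp hc).mul (hg.2 ξ hξ)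
  have hPsum : ∀ (s : Finset ℕ) (g : ℕ → ∀ x, E x), (∀ i ∈ s, P (g i)) →
      P fun x => ∑ i ∈ s, g i x := by
    intro s g hg
    refine ⟨fun n => ?_, fun ξ hξ => ?_⟩
    · simp only [inner_sum]
      exact Finset.measurable_sum _ fun i hi => (hg i hi).1 n
    · simp only [sum_inner]
      exact Finset.measurable_sum _ fun i hi => (hg i hi).2 ξ hξ
  have hPsub : ∀ g h, P g → P h → P fun x => g x - h x := by
    intro g h hg hh
    refine ⟨fun n => ?_, fun ξ hξ => ?_⟩
    · simp only [inner_sub_right]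
      exact (hg.1 n).sub (hh.1 n)
    · simp only [inner_sub_left]
      exact (hg.2 ξ hξ).sub (hh.2 ξ hξ)
  have hPnorm : ∀ g, P g → Measurable fun x => ‖g x‖ := by
    intro g hg
    have h : (fun x => ‖g x‖) = fun x => √(RCLike.re ⟪g x, g x⟫_ℂ) := by
      funext x
      exact norm_eq_sqrt_re_inner (𝕜 := ℂ) (g x)
    rw [h]
    exact (RCLike.measurable_re.comp (hg.2 g hg.1)).sqrt
  have hGS : ∀ n, P fun x => InnerProductSpace.gramSchmidt ℂ (fun n => e n x) n := by
    intro n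
    induction n using Nat.strong_induction_on with
    | _ n ih =>
      have h0 : (fun x => InnerProductSpace.gramSchmidt ℂ (fun n => e n x) n) = fun x =>
          e n x - ∑ i ∈ Finset.Iio n,
            (⟪InnerProductSpace.gramSchmidt ℂ (fun n => e n x) i, e n x⟫_ℂ /
              ((‖InnerProductSpace.gramSchmidt ℂ (fun n => e n x) i‖ ^ 2 : ℝ) : ℂ)) •
                InnerProductSpace.gramSchmidt ℂ (fun n => e n x) i := by
        funext x
        rw [InnerProductSpace.gramSchmidt_def]
        simp only [Submodule.starProjection_singleton]
        rfl
      rw [h0]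
      refine hPsub _ _ (hPe n) (hPsum _ _ fun i hi => hPsmul _ _ ?_ (ih i (Finset.mem_Iio.1 hi)))
      refine ((ih i (Finset.mem_Iio.1 hi)).2 _ (hPe n).1).div ?_
      exact RCLike.measurable_ofReal.comp ((hPnorm _ (ih i (Finset.mem_Iio.1 hi))).pow_const 2)
  have hGSN : ∀ n, P fun x => InnerProductSpace.gramSchmidtNormed ℂ (fun n => e n x) n := by
    intro n
    refine hPsmul _ _ ?_ (hGS n)
    exact (RCLike.measurable_ofReal.comp (hPnorm _ (hGS n))).inv
  let b : ∀ x, ℕ → E x := fun x n => InnerProductSpace.gramSchmidtNormed ℂ (fun n => e n x) n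
  have hb : ∀ x, (Submodule.span ℂ (Set.range fun n : {n // b x n ≠ 0} =>
      b x n)).topologicalClosure = ⊤ := by
    intro x
    rw [← ht x, ← InnerProductSpace.span_gramSchmidt ℂ (fun n => e n x),
      ← InnerProductSpace.span_gramSchmidtNormed_range (𝕜 := ℂ) (fun n => e n x)]
    congr 1
    apply le_antisymm
    · refine Submodule.span_mono ?_
      rintro _ ⟨n, rfl⟩
      exact ⟨n, rfl⟩
    · rw [Submodule.span_le]
      rintro _ ⟨n, rfl⟩
      by_cases hn : b x n = 0
      · change b x n ∈ _
        rw [hn]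
        exact Submodule.zero_mem _
      · exact Submodule.subset_span ⟨⟨n, hn⟩, rfl⟩
  have hex : ∀ x, ∃ T : E x →ₗᵢ[ℂ] Ell2.{w}, ∀ v n, T v n = ⟪b x n.down, v⟫_ℂ := by
    intro x
    have hO : Orthonormal ℂ fun n : {n // b x n ≠ 0} => b x n :=
      InnerProductSpace.gramSchmidtNormed_orthonormal' (𝕜 := ℂ) (fun n => e n x)
    obtain ⟨T, hT⟩ := exists_linearIsometry_of_inner_eq (fun n : {n // b x n ≠ 0} => b x n)
      (fun n => (lp.single 2 (ULift.up n.1) (1 : ℂ) : Ell2.{w})) (hb x) (fun i j => by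
        rw [orthonormal_iff_ite.1 hO, lp.inner_single_left, lp.single_apply]
        by_cases hij : i = j
        · subst hij; simp
        · have : j.1 ≠ i.1 := fun h => hij (Subtype.ext h.symm)
          simp [hij, Ne.symm this])
    refine ⟨T, fun v n => ?_⟩
    have h1 : T v n = ⟪(lp.single 2 n (1 : ℂ) : Ell2.{w}), T v⟫_ℂ := by
      rw [lp.inner_single_left]; simp
    rw [h1]
    -- The normalized Gram–Schmidt vectors vanish where `e` is linearly dependent; the corresponding
    -- coordinates are orthogonal to the range of `T`.
    by_cases hn : b x n.down = 0
    · rw [hn, inner_zero_left]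
      have : ∀ w, w ∈ (Submodule.span ℂ (Set.range fun n : {n // b x n ≠ 0} =>
          b x n)).topologicalClosure → ⟪(lp.single 2 n (1 : ℂ) : Ell2.{w}), T w⟫_ℂ = 0 := by
        intro w hw
        refine closure_minimal (s := (Submodule.span ℂ (Set.range fun n : {n // b x n ≠ 0} =>
          b x n) : Set (E x))) (t := {w | ⟪(lp.single 2 n (1 : ℂ) : Ell2.{w}), T w⟫_ℂ = 0})
          ?_ ?_ hw
        · intro w hw
          simp only [SetLike.mem_coe, Set.mem_ofPred_eq] at hw ⊢
          induction hw using Submodule.span_induction with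
          | mem w hw =>
            obtain ⟨m, rfl⟩ := hw
            rw [hT, lp.inner_single_left, lp.single_apply]
            have : n ≠ ULift.up m.1 := by
              rintro rfl
              exact m.2 hn
            simp [this]
          | zero => simp
          | add v w _ _ hv hw => rw [map_add, inner_add_right, hv, hw, add_zero]
          | smul c v _ hv => rw [map_smul, inner_smul_right, hv, mul_zero]
        · exact isClosed_eq (continuous_const.inner T.continuous) continuous_const
      exact this v (by rw [hb x]; trivial)
    · rw [← T.inner_map_map, hT ⟨n.down, hn⟩]
  choose ι hι using hex
  have hmeas : ∀ ξ ∈ S, Measurable fun x => ι x (ξ x) := by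
    intro ξ hξ
    refine measurable_ell2 fun n => ?_
    simp only [hι]
    exact (hGSN n.down).2 ξ hξ
  refine ⟨ι, fun ξ => ⟨hmeas ξ, fun h n => ?_⟩⟩
  have h1 := (hmeas _ (hPe n).1).inner (𝕜 := ℂ) h
  simpa only [LinearIsometry.inner_map_map] using h1

/-- Every separable Hilbert space has an isometric copy in a prescribed universe. -/
lemma exists_linearIsometryEquiv_universe (E : Type u) [NormedAddCommGroup E]
    [InnerProductSpace ℂ E] [CompleteSpace E] [TopologicalSpace.SeparableSpace E] :
    ∃ (K : Submodule ℂ Ell2.{w}), CompleteSpace K ∧ Nonempty (E ≃ₗᵢ[ℂ] K) := by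
  obtain ⟨ι, -⟩ := exists_measurable_embedding.{w} (X := Unit) (E := fun _ => E)
    (fun n _ => TopologicalSpace.denseSeq E n) (fun _ => by
      rw [← Submodule.dense_iff_topologicalClosure_eq_top]
      exact (TopologicalSpace.denseRange_denseSeq E).mono Submodule.subset_span)
    (fun n m => measurable_const)
  refine ⟨LinearMap.range (ι ()).toLinearMap, ?_, ⟨(ι ()).equivRange⟩⟩
  exact (ι ()).equivRange.toIsometryEquiv.completeSpace_iff.1 inferInstance

/-! ### Measure-theoretic preliminaries -/

open scoped CompactlySupported ENNReal

section Test

variable {X : Type u} [TopologicalSpace X] [LocallyCompactSpace X] [T2Space X]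
  [SecondCountableTopology X] [MeasurableSpace X] [BorelSpace X]

/-- A compactly supported real function, as a complex function vanishing at infinity. -/
def CompactlySupportedContinuousMap.toC0 (f : C_c(X, ℝ)) : C₀(X, ℂ) :=
  ⟨⟨fun x => (f x : ℂ), by fun_prop⟩,
    (f.hasCompactSupport.comp_left (g := fun t : ℝ => (t : ℂ)) (by simp)).is_zero_at_infty⟩

@[simp]
lemma CompactlySupportedContinuousMap.toC0_apply (f : C_c(X, ℝ)) (x : X) :
    f.toC0 x = (f x : ℂ) := rfl

lemma integrable_C0_mul {μ : Measure X} (f : C₀(X, ℂ)) {h : X → ℂ} (hh : Integrable h μ) :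
    Integrable (fun x => f x * h x) μ :=
  hh.bdd_mul (c := ‖f‖) (map_continuous f).aestronglyMeasurable
    (Filter.Eventually.of_forall fun x => f.toBCF.norm_coe_le_norm x)

/-- The real case: the positive and the negative part of `h` are densities of the same measure, by
uniqueness in the Riesz–Markov–Kakutani theorem. -/
lemma ae_eq_zero_of_forall_integral_cc {μ : Measure X} [IsFiniteMeasure μ] {h : X → ℝ}
    (hh : Integrable h μ) (H : ∀ f : C_c(X, ℝ), ∫ x, f x * h x ∂μ = 0) : h =ᵐ[μ] 0 := by
  have : IsFiniteMeasure (μ.withDensity fun x => ENNReal.ofReal (h x)) :=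
    isFiniteMeasure_withDensity_ofReal hh.2
  have : IsFiniteMeasure (μ.withDensity fun x => ENNReal.ofReal (-h x)) :=
    isFiniteMeasure_withDensity_ofReal hh.neg.2
  have hb : ∀ (f : C_c(X, ℝ)) (k : X → ℝ), Integrable k μ → Integrable (fun x => f x * k x) μ := by
    intro f k hk
    obtain ⟨C, hC⟩ := f.hasCompactSupport.exists_bound_of_continuous (map_continuous f)
    exact hk.bdd_mul (c := C) (map_continuous f).aestronglyMeasurable
      (Filter.Eventually.of_forall hC)
  have hn : Integrable (fun x => -h x) μ := hh.neg
  have key : (μ.withDensity fun x => ENNReal.ofReal (h x)) =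
      μ.withDensity fun x => ENNReal.ofReal (-h x) := by
    refine Measure.ext_of_integral_eq_on_compactlySupported fun f => ?_
    rw [integral_withDensity_eq_integral_toReal_smul₀ hh.1.aemeasurable.ennreal_ofReal
        (Filter.Eventually.of_forall fun _ => ENNReal.ofReal_lt_top),
      integral_withDensity_eq_integral_toReal_smul₀ hn.1.aemeasurable.ennreal_ofReal
        (Filter.Eventually.of_forall fun _ => ENNReal.ofReal_lt_top), ← sub_eq_zero,
      ← integral_sub]
    · rw [← H f]
      refine integral_congr_ae (Filter.Eventually.of_forall fun x => ?_)
      simp only [ENNReal.toReal_ofReal', smul_eq_mul]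
      rw [← sub_mul, mul_comm]
      congr 1
      exact max_zero_sub_eq_self (h x)
    · simp only [ENNReal.toReal_ofReal', smul_eq_mul, mul_comm _ (f _)]
      exact hb f _ hh.pos_part
    · simp only [ENNReal.toReal_ofReal', smul_eq_mul, mul_comm _ (f _)]
      exact hb f _ hh.neg_part
  have h2 := (withDensity_eq_iff_of_sigmaFinite hh.1.aemeasurable.ennreal_ofReal
    hn.1.aemeasurable.ennreal_ofReal).1 key
  filter_upwards [h2] with x hx
  have h3 := congrArg ENNReal.toReal hx
  simp only [ENNReal.toReal_ofReal'] at h3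
  rw [Pi.zero_apply, ← max_zero_sub_eq_self (h x), h3, sub_self]

/-- An integrable function whose integrals against `C₀(X)` vanish is zero almost everywhere. -/
lemma ae_eq_zero_of_forall_integral_C0 {μ : Measure X} [IsFiniteMeasure μ] {h : X → ℂ}
    (hh : Integrable h μ) (H : ∀ f : C₀(X, ℂ), ∫ x, f x * h x ∂μ = 0) : h =ᵐ[μ] 0 := by
  have h1 := ae_eq_zero_of_forall_integral_cc hh.re fun f => by
    have := congrArg RCLike.re (H f.toC0)
    rw [← integral_re (integrable_C0_mul _ hh)] at this
    simpa using this
  have h2 := ae_eq_zero_of_forall_integral_cc hh.im fun f => by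
    have := congrArg RCLike.im (H f.toC0)
    rw [← integral_im (integrable_C0_mul _ hh)] at this
    simpa using this
  filter_upwards [h1, h2] with x hx hx'
  exact Complex.ext hx hx'

end Test

lemma lintegral_withDensity_mul {X : Type*} [MeasurableSpace X] {μ : Measure X} {f F : X → ℝ≥0∞}
    (hf : Measurable f) (hF : Measurable F) :
    ∫⁻ x, F x ∂(μ.withDensity f) = ∫⁻ x, f x * F x ∂μ :=
  lintegral_withDensity_eq_lintegral_mul μ hf hF

section Density

variable {G : Type v} {X : Type u} [Group G] [TopologicalSpace G] [IsTopologicalGroup G]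
  [SecondCountableTopology G] [MeasurableSpace G] [BorelSpace G]
  [TopologicalSpace X] [SecondCountableTopology X] [MeasurableSpace X] [BorelSpace X]
  [MulAction Gᵐᵒᵖ X] [ContinuousSMul Gᵐᵒᵖ X]

omit [IsTopologicalGroup G] in
variable (G X) in
lemma measurable_rsmul : Measurable fun p : X × G => p.1 <• p.2 :=
  ((MulOpposite.continuous_op.comp continuous_snd).smul continuous_fst).measurable

omit [IsTopologicalGroup G] in
lemma measurable_rsmul_const (g : G) : Measurable fun x : X => x <• g :=
  (continuous_const_smul (MulOpposite.op g)).measurable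

lemma rsmul_rsmul (x : X) (g h : G) : (x <• g) <• h = x <• (g * h) := by
  rw [MulOpposite.op_mul, mul_smul]

@[simp]
lemma rsmul_rsmul_inv (x : X) (g : G) : (x <• g) <• g⁻¹ = x := by
  rw [rsmul_rsmul, mul_inv_cancel]; simp

/-- A jointly measurable, strictly positive version `r (x, g)` of the square root of the density
`ρ_g(x)` of the translated measure. -/
structure IsSqrtDensity (μ : Measure X) (r : X × G → ℝ) : Prop where
  measurable : Measurable r
  pos : ∀ p, 0 < r p
  map_eq : ∀ g, μ.map (fun x => x <• g⁻¹) =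
    μ.withDensity fun x => ENNReal.ofReal (r (x, g) ^ 2)

/-- Joint measurability comes from the Radon–Nikodym derivative of the kernel `g ↦ μ g⁻¹` with respect
to the constant kernel `μ`. -/
lemma QuasiInvariant.exists_isSqrtDensity {μ : Measure X} [IsFiniteMeasure μ]
    (hμ : QuasiInvariant G μ) : ∃ r : X × G → ℝ, IsSqrtDensity μ r := by
  have hm : ∀ s, MeasurableSet s → Measurable fun g : G => μ.map (fun x => x <• g⁻¹) s := by
    intro s hs
    have h1 : (fun g : G => μ.map (fun x => x <• g⁻¹) s) = fun g =>
        μ (Prod.mk g ⁻¹' ((fun p : G × X => p.2 <• p.1⁻¹) ⁻¹' s)) := by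
      funext g
      rw [Measure.map_apply (measurable_rsmul_const _) hs]
      rfl
    rw [h1]
    refine measurable_measure_prodMk_left (MeasurableSet.preimage hs ?_)
    exact (measurable_rsmul G X).comp (measurable_snd.prodMk (measurable_inv.comp measurable_fst))
  let κ : ProbabilityTheory.Kernel G X :=
    ⟨fun g => μ.map fun x => x <• g⁻¹, Measure.measurable_of_measurable_coe _ hm⟩
  have : ProbabilityTheory.IsFiniteKernel κ := ⟨μ Set.univ, measure_lt_top _ _, fun g => by
    change μ.map (fun x => x <• g⁻¹) Set.univ ≤ _
    rw [Measure.map_apply (measurable_rsmul_const _) MeasurableSet.univ, Set.preimage_univ]⟩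
  let D : X × G → ℝ := fun p => √(κ.rnDeriv (ProbabilityTheory.Kernel.const G μ) p.2 p.1).toReal
  have hD : Measurable D := ((ProbabilityTheory.Kernel.measurable_rnDeriv κ
    (ProbabilityTheory.Kernel.const G μ)).comp measurable_swap).ennreal_toReal.sqrt
  -- For each `g`, the derivative is positive only almost everywhere.
  refine ⟨fun p => if 0 < D p then D p else 1, ?_, ?_, ?_⟩
  · exact Measurable.ite (measurableSet_lt measurable_const hD) hD measurable_const
  · intro p
    by_cases h : 0 < D p <;> simp [h]
  · intro g
    have hac : μ.map (fun x => x <• g⁻¹) ≪ μ := hμ g⁻¹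
    have hac' : μ ≪ μ.map (fun x => x <• g⁻¹) := by
      refine Measure.AbsolutelyContinuous.mk fun s hs h => ?_
      rw [Measure.map_apply (measurable_rsmul_const _) hs] at h
      have h2 := hμ g h
      rw [Measure.map_apply (measurable_rsmul_const _)
        (measurable_rsmul_const _ hs)] at h2
      simpa [Set.preimage_preimage] using h2
    have h1 : ∀ᵐ x ∂μ, κ.rnDeriv (ProbabilityTheory.Kernel.const G μ) g x =
        (μ.map fun x => x <• g⁻¹).rnDeriv μ x :=
      ProbabilityTheory.Kernel.rnDeriv_eq_rnDeriv_measure (κ := κ)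
        (η := ProbabilityTheory.Kernel.const G μ) (a := g)
    rw [← Measure.withDensity_rnDeriv_eq _ _ hac]
    refine withDensity_congr_ae ?_
    filter_upwards [h1, Measure.rnDeriv_lt_top (μ.map fun x => x <• g⁻¹) μ,
      Measure.rnDeriv_pos' hac'] with x hx hlt hpos
    have hp : 0 < D (x, g) := by
      simp only [D, hx]
      exact Real.sqrt_pos.2 (ENNReal.toReal_pos hpos.ne' hlt.ne)
    rw [if_pos hp]
    simp only [D, hx]
    rw [Real.sq_sqrt ENNReal.toReal_nonneg, ENNReal.ofReal_toReal hlt.ne]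

namespace IsSqrtDensity

variable {μ : Measure X} {r : X × G → ℝ}

lemma sqrt_rnDeriv [SigmaFinite μ] (hr : IsSqrtDensity μ r) (g : G) :
    ∀ᵐ x ∂μ, √((μ.map fun x => x <• g⁻¹).rnDeriv μ x).toReal = r (x, g) := by
  rw [hr.map_eq]
  have h1 : Measurable fun x => ENNReal.ofReal (r (x, g) ^ 2) :=
    ((hr.measurable.comp measurable_prodMk_right).pow_const 2).ennreal_ofReal
  filter_upwards [Measure.rnDeriv_withDensity μ h1] with x hx
  rw [hx]
  simp [ENNReal.toReal_ofReal, sq_nonneg, Real.sqrt_sq (hr.pos _).le]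

lemma measurable_right (hr : IsSqrtDensity μ r) (g : G) : Measurable fun x => r (x, g) :=
  hr.measurable.comp measurable_prodMk_right

lemma measurable_ofReal_sq (hr : IsSqrtDensity μ r) (g : G) :
    Measurable fun x => ENNReal.ofReal (r (x, g) ^ 2) :=
  ((hr.measurable_right g).pow_const 2).ennreal_ofReal

lemma map_withDensity (hr : IsSqrtDensity μ r) (g : G) :
    (μ.withDensity fun x => ENNReal.ofReal (r (x, g) ^ 2)).map (fun x => x <• g) = μ := by
  rw [← hr.map_eq, Measure.map_map (measurable_rsmul_const _) (measurable_rsmul_const _)]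
  simp [Function.comp_def]

/-- The change of variables `∫ F(x g) ρ_g(x) dμ(x) = ∫ F dμ`. -/
lemma lintegral_eq (hr : IsSqrtDensity μ r) (g : G) {F : X → ℝ≥0∞} (hF : Measurable F) :
    ∫⁻ x, ENNReal.ofReal (r (x, g) ^ 2) * F (x <• g) ∂μ = ∫⁻ x, F x ∂μ := by
  conv_rhs => rw [← hr.map_withDensity g]
  rw [lintegral_map hF (measurable_rsmul_const _), lintegral_withDensity_mul (F := fun x => F (x <• g))
    (hr.measurable_ofReal_sq g) (hF.comp (measurable_rsmul_const _))]

lemma integral_eq (hr : IsSqrtDensity μ r) (g : G) {F : X → ℂ} (hF : Measurable F) :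
    ∫ x, (r (x, g) ^ 2 : ℝ) * F (x <• g) ∂μ = ∫ x, F x ∂μ := by
  conv_rhs => rw [← hr.map_withDensity g]
  rw [integral_map (measurable_rsmul_const _).aemeasurable hF.aestronglyMeasurable,
    integral_withDensity_eq_integral_toReal_smul (hr.measurable_ofReal_sq g)
    (Filter.Eventually.of_forall fun _ => ENNReal.ofReal_lt_top)]
  refine integral_congr_ae (Filter.Eventually.of_forall fun x => ?_)
  simp [ENNReal.toReal_ofReal, sq_nonneg]

lemma integrable (hr : IsSqrtDensity μ r) (g : G) {F : X → ℂ} (hF : Measurable F)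
    (hi : Integrable F μ) : Integrable (fun x => (r (x, g) ^ 2 : ℝ) * F (x <• g)) μ := by
  rw [← hr.map_withDensity g, integrable_map_measure hF.aestronglyMeasurable
    (measurable_rsmul_const _).aemeasurable, integrable_withDensity_iff_integrable_smul'
    (hr.measurable_ofReal_sq g) (Filter.Eventually.of_forall fun _ => ENNReal.ofReal_lt_top)] at hi
  refine hi.congr (Filter.Eventually.of_forall fun x => ?_)
  simp [ENNReal.toReal_ofReal, sq_nonneg]

lemma quasiMeasurePreserving (hr : IsSqrtDensity μ r) (g : G) :
    Measure.QuasiMeasurePreserving (fun x : X => x <• g) μ μ := by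
  refine ⟨measurable_rsmul_const _, ?_⟩
  have := hr.map_eq g⁻¹
  rw [inv_inv] at this
  rw [this]
  exact withDensity_absolutelyContinuous _ _

lemma ae_rsmul (hr : IsSqrtDensity μ r) (g : G) {p : X → Prop} (hp : ∀ᵐ x ∂μ, p x) :
    ∀ᵐ x ∂μ, p (x <• g) :=
  (hr.quasiMeasurePreserving g).ae hp

/-- A density for the translate by `g` is determined by the integrals of translated functions. -/
lemma ae_eq_of_lintegral [IsFiniteMeasure μ] (g : G) {p q : X → ℝ} (hp : Measurable p)
    (hq : Measurable q) (hp0 : ∀ x, 0 ≤ p x) (hq0 : ∀ x, 0 ≤ q x)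
    (h : ∀ F : X → ℝ≥0∞, Measurable F → ∫⁻ x, ENNReal.ofReal (p x ^ 2) * F (x <• g) ∂μ =
      ∫⁻ x, ENNReal.ofReal (q x ^ 2) * F (x <• g) ∂μ) : ∀ᵐ x ∂μ, p x = q x := by
  have h1 : (μ.withDensity fun x => ENNReal.ofReal (p x ^ 2)) =
      μ.withDensity fun x => ENNReal.ofReal (q x ^ 2) := by
    ext s hs
    rw [withDensity_apply _ hs, withDensity_apply _ hs]
    have h2 := h (fun y => s.indicator 1 (y <• g⁻¹))
      ((measurable_one.indicator hs).comp (measurable_rsmul_const _))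
    simp only [rsmul_rsmul_inv] at h2
    rw [← lintegral_indicator hs, ← lintegral_indicator hs]
    convert h2 using 3 with x x <;> by_cases hx : x ∈ s <;> simp [hx]
  have h2 := (withDensity_eq_iff_of_sigmaFinite (hp.pow_const 2).ennreal_ofReal.aemeasurable
    (hq.pow_const 2).ennreal_ofReal.aemeasurable).1 h1
  filter_upwards [h2] with x hx
  rw [ENNReal.ofReal_eq_ofReal_iff (sq_nonneg _) (sq_nonneg _)] at hx
  exact (pow_left_inj₀ (hp0 x) (hq0 x) two_ne_zero).1 hx

/-- The densities of equivalent measures differ by a coboundary. -/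
lemma ae_mul_eq_of_withDensity [IsFiniteMeasure μ] {μ' : Measure X} {r' : X × G → ℝ} {d : X → ℝ}
    (hd : Measurable d) (hd0 : ∀ x, 0 ≤ d x)
    (h : μ' = μ.withDensity fun x => ENNReal.ofReal (d x ^ 2)) (hr : IsSqrtDensity μ r)
    (hr' : IsSqrtDensity μ' r') (g : G) :
    ∀ᵐ x ∂μ, d x * r' (x, g) = r (x, g) * d (x <• g) := by
  have hd2 : Measurable fun x => ENNReal.ofReal (d x ^ 2) := (hd.pow_const 2).ennreal_ofReal
  refine ae_eq_of_lintegral g (hd.mul (hr'.measurable_right g))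
    ((hr.measurable_right g).mul (hd.comp (measurable_rsmul_const _)))
    (fun x => mul_nonneg (hd0 _) (hr'.pos _).le) (fun x => mul_nonneg (hr.pos _).le (hd0 _))
    fun F hF => ?_
  have h1 := hr'.lintegral_eq g hF
  have h2 := hr.lintegral_eq g (hd2.mul hF)
  rw [h, lintegral_withDensity_mul (F := fun x => ENNReal.ofReal (r' (x, g) ^ 2) * F (x <• g)) hd2
    ((hr'.measurable_ofReal_sq g).mul (hF.comp (measurable_rsmul_const _))),
    lintegral_withDensity_mul hd2 hF] at h1
  replace h1 := h1.trans h2.symm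
  simp only [mul_pow, ENNReal.ofReal_mul (sq_nonneg _), mul_assoc]
  exact h1

/-- The cocycle identity of the densities. -/
lemma ae_mul_eq [IsFiniteMeasure μ] (hr : IsSqrtDensity μ r) (g h : G) :
    ∀ᵐ x ∂μ, r (x, g * h) = r (x, g) * r (x <• g, h) := by
  refine ae_eq_of_lintegral (g * h) (hr.measurable_right _)
    ((hr.measurable_right g).mul ((hr.measurable_right h).comp (measurable_rsmul_const _)))
    (fun x => (hr.pos _).le) (fun x => mul_nonneg (hr.pos _).le (hr.pos _).le)
    fun F hF => ?_
  have h2 := hr.lintegral_eq g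
    ((hr.measurable_ofReal_sq h).mul (hF.comp (measurable_rsmul_const h)))
  rw [hr.lintegral_eq _ hF, ← hr.lintegral_eq h hF]
  simp only [mul_pow, ENNReal.ofReal_mul (sq_nonneg _), mul_assoc, ← rsmul_rsmul]
  exact h2.symm

/-- Restriction to an invariant set does not change the densities. -/
lemma restrict (hr : IsSqrtDensity μ r) {s : Set X} (hs : MeasurableSet s)
    (hinv : ∀ (g : G) x, x <• g ∈ s ↔ x ∈ s) : IsSqrtDensity (μ.restrict s) r := by
  refine ⟨hr.measurable, hr.pos, fun g => ?_⟩
  rw [← restrict_withDensity hs, ← hr.map_eq, Measure.restrict_map (measurable_rsmul_const _) hs]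
  congr 2
  ext x
  exact (hinv g⁻¹ x).symm

end IsSqrtDensity

end Density

section Representative

variable {G : Type v} {X : Type u} [TopologicalSpace G]
  [SecondCountableTopology G] [MeasurableSpace G] [BorelSpace G] [MeasurableSpace X]

/-- A continuous family in `L²` has a jointly measurable representative. -/
lemma exists_measurable_representative {μ : Measure X} {c : G → Lp Ell2.{w} 2 μ}
    (hc : Continuous c) :
    ∃ ζ : X × G → Ell2.{w}, Measurable ζ ∧ ∀ g, ∀ᵐ x ∂μ, ζ (x, g) = c g x := by
  rcases isEmpty_or_nonempty G with hG | hG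
  · exact ⟨fun p => isEmptyElim p.2, measurable_from_prod_countable_left isEmptyElim, isEmptyElim⟩
  classical
  let d : ℕ → Lp Ell2.{w} 2 μ := fun i => c (TopologicalSpace.denseSeq G i)
  have hex : ∀ (N : ℕ) (g : G), ∃ i, ‖c g - d i‖ < (1 / 2) ^ N := by
    intro N g
    have ho : IsOpen {g' | ‖c g - c g'‖ < (1 / 2 : ℝ) ^ N} :=
      isOpen_lt (continuous_const.sub hc).norm continuous_const
    obtain ⟨i, hi⟩ := (TopologicalSpace.denseRange_denseSeq G).exists_mem_open ho
      ⟨g, by simp⟩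
    exact ⟨i, hi⟩
  have hmeas : ∀ N i, MeasurableSet {g | ‖c g - d i‖ < (1 / 2 : ℝ) ^ N} := fun N i =>
    (isOpen_lt (hc.sub continuous_const).norm continuous_const).measurableSet
  -- `s N` is a countably valued approximation of `c` to within `2⁻ᴺ`, uniformly on `G`. This is fast
  -- enough for convergence almost everywhere, for each `g`.
  let k : ℕ → G → ℕ := fun N g => Nat.find (hex N g)
  have hk : ∀ N, Measurable (k N) := fun N => measurable_find _ (hmeas N)
  have hd : ∀ i, Measurable (d i : X → Ell2.{w}) := fun i => (Lp.stronglyMeasurable _).measurable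
  have hD : Measurable fun p : X × ℕ => d p.2 p.1 :=
    measurable_from_prod_countable_left hd
  let s : ℕ → X × G → Ell2.{w} := fun N p => d (k N p.2) p.1
  have hs : ∀ N, Measurable (s N) := fun N =>
    hD.comp (measurable_fst.prodMk ((hk N).comp measurable_snd))
  refine ⟨fun p => Filter.limUnder Filter.atTop (fun N => s N p),
    (StronglyMeasurable.limUnder fun N => (hs N).stronglyMeasurable).measurable, fun g => ?_⟩
  have hN : ∀ N, ∫⁻ x, ‖s N (x, g) - c g x‖ₑ ^ (2 : ℝ) ∂μ ≤ ENNReal.ofReal ((1 / 4) ^ N) := by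
    intro N
    have h1 : ‖d (k N g) - c g‖ < (1 / 2) ^ N := by
      rw [norm_sub_rev]; exact Nat.find_spec (hex N g)
    have h2 : ∫⁻ x, ‖s N (x, g) - c g x‖ₑ ^ (2 : ℝ) ∂μ = ‖d (k N g) - c g‖ₑ ^ (2 : ℝ) := by
      rw [Lp.enorm_def, eLpNorm_eq_lintegral_rpow_enorm_toReal (by simp) (by simp)]
      simp only [ENNReal.toReal_ofNat, one_div]
      rw [← ENNReal.rpow_mul, inv_mul_cancel₀ two_ne_zero, ENNReal.rpow_one]
      refine lintegral_congr_ae ?_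
      filter_upwards [Lp.coeFn_sub (d (k N g)) (c g)] with x hx
      rw [hx]
      rfl
    rw [h2, ← ofReal_norm, ENNReal.ofReal_rpow_of_nonneg (norm_nonneg _) zero_le_two]
    refine ENNReal.ofReal_le_ofReal ?_
    calc _ = ‖d (k N g) - c g‖ ^ 2 := by norm_cast
      _ ≤ ((1 / 2) ^ N) ^ 2 := by gcongr
      _ = (1 / 4) ^ N := by rw [← pow_mul, mul_comm, pow_mul]; norm_num
  have hsum : ∫⁻ x, ∑' N, ‖s N (x, g) - c g x‖ₑ ^ (2 : ℝ) ∂μ ≠ ∞ := by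
    rw [lintegral_tsum fun N => ?_]
    · refine ((ENNReal.tsum_le_tsum hN).trans_lt ?_).ne
      rw [← ENNReal.ofReal_tsum_of_nonneg (fun n => by positivity)
        (summable_geometric_of_lt_one (by norm_num) (by norm_num))]
      exact ENNReal.ofReal_lt_top
    · exact ((((hs N).comp measurable_prodMk_right).sub
        (Lp.stronglyMeasurable _).measurable).enorm.pow_const _).aemeasurable
  have hae := ae_lt_top' (AEMeasurable.tsum fun N =>
    ((((hs N).comp measurable_prodMk_right).sub
        (Lp.stronglyMeasurable _).measurable).enorm.pow_const _).aemeasurable) hsum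
  filter_upwards [hae] with x hx
  refine Filter.Tendsto.limUnder_eq ?_
  have h1 := ENNReal.tendsto_atTop_zero_of_tsum_ne_top hx.ne
  have h2 := (ENNReal.continuous_rpow_const (y := 1 / 2)).tendsto 0 |>.comp h1
  simp only [Function.comp_def, ← ENNReal.rpow_mul] at h2
  norm_num at h2
  rw [tendsto_iff_norm_sub_tendsto_zero]
  have h3 := (ENNReal.tendsto_toReal ENNReal.zero_ne_top).comp h2
  simpa [Function.comp_def] using h3

end Representative

/-! ### Square integrable sections of a Hilbert bundle -/

namespace HilbertBundle

open scoped ENNReal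

variable {X : Type u} [MeasurableSpace X] (B : HilbertBundle.{u, w} X)

/-- A Hilbert bundle embeds isometrically and measurably into the constant bundle `ℓ²`. -/
lemma exists_embedding : ∃ ι : ∀ x, B.Fiber x →ₗᵢ[ℂ] Ell2.{w'}, ∀ ξ : ∀ x, B.Fiber x,
    ξ ∈ B.sections ↔ Measurable fun x => ι x (ξ x) := by
  obtain ⟨e, he, ht⟩ := B.exists_total
  obtain ⟨ι, hι⟩ := exists_measurable_embedding.{w'} e ht fun n m =>
    B.measurable_inner _ (he n) _ (he m)
  have h1 : ∀ ξ ∈ B.sections, Measurable fun x => ι x (ξ x) := fun ξ hξ =>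
    (hι ξ).1 fun n => B.measurable_inner _ (he n) _ hξ
  refine ⟨ι, fun ξ => ⟨h1 ξ, fun h => B.mem_sections ξ fun η hη => ?_⟩⟩
  have h2 := (h1 η hη).inner (𝕜 := ℂ) h
  simpa only [LinearIsometry.inner_map_map] using h2

/-- The Hilbert bundle generated by a total sequence with measurable Gram matrix. -/
def ofTotal (E : X → Type w) [∀ x, NormedAddCommGroup (E x)] [∀ x, InnerProductSpace ℂ (E x)]
    [∀ x, CompleteSpace (E x)] (e : ℕ → ∀ x, E x)
    (ht : ∀ x, (Submodule.span ℂ (Set.range fun n => e n x)).topologicalClosure = ⊤)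
    (hm : ∀ n m, Measurable fun x => ⟪e n x, e m x⟫_ℂ) : HilbertBundle.{u, w} X where
  Fiber := E
  sections :=
    { carrier := {ξ | ∀ n, Measurable fun x => ⟪e n x, ξ x⟫_ℂ}
      add_mem' := fun {ξ η} hξ hη n => by
        simp only [Pi.add_apply, inner_add_right]
        exact (hξ n).add (hη n)
      zero_mem' := fun n => by simp
      smul_mem' := fun c ξ hξ n => by
        simp only [Pi.smul_apply, inner_smul_right]
        exact (hξ n).const_mul c }
  measurable_inner := fun ξ hξ η hη => by
    obtain ⟨ι, hι⟩ := exists_measurable_embedding.{0} e ht hm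
    have h2 := ((hι ξ).1 hξ).inner (𝕜 := ℂ) ((hι η).1 hη)
    simpa only [LinearIsometry.inner_map_map] using h2
  mem_sections := fun ξ hξ n => hξ (e n) fun m => hm m n
  exists_total := ⟨e, fun n m => hm m n, ht⟩

variable {B}

lemma smul_mem_sections {c : X → ℂ} (hc : Measurable c) {ξ : ∀ x, B.Fiber x}
    (hξ : ξ ∈ B.sections) : (fun x => c x • ξ x) ∈ B.sections :=
  B.mem_sections _ fun η hη => by
    simp only [inner_smul_right]
    exact hc.mul (B.measurable_inner η hη ξ hξ)

variable {μ : Measure X}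

/-- A measurable section whose squared norm has finite integral, as a square integrable section. -/
def mkL2 (ξ : ∀ x, B.Fiber x) (hξ : ξ ∈ B.sections) (h : ∫⁻ x, ‖ξ x‖ₑ ^ 2 ∂μ < ∞) :
    B.L2Section μ :=
  ⟨ξ, hξ, (B.measurable_norm hξ).aestronglyMeasurable, by
    rw [eLpNorm_lt_top_iff_lintegral_rpow_enorm_lt_top (by simp) (by simp)]
    simpa using h⟩

@[simp]
lemma mkL2_apply (ξ : ∀ x, B.Fiber x) (hξ : ξ ∈ B.sections) (h : ∫⁻ x, ‖ξ x‖ₑ ^ 2 ∂μ < ∞)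
    (x : X) : mkL2 ξ hξ h x = ξ x := rfl

lemma lintegral_enorm_sq (ξ : B.L2Section μ) : ∫⁻ x, ‖ξ x‖ₑ ^ 2 ∂μ < ∞ := by
  have := ξ.2.2.2
  rw [eLpNorm_lt_top_iff_lintegral_rpow_enorm_lt_top (by simp) (by simp)] at this
  simpa using this

@[simp]
lemma L2Section.add_apply (ξ η : B.L2Section μ) (x : X) : (ξ + η) x = ξ x + η x := rfl

@[simp]
lemma L2Section.zero_apply (x : X) : (0 : B.L2Section μ) x = 0 := rfl

@[simp]
lemma L2Section.smul_apply (c : ℂ) (ξ : B.L2Section μ) (x : X) : (c • ξ) x = c • ξ x := rfl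

@[simp]
lemma L2Section.sub_apply (ξ η : B.L2Section μ) (x : X) : (ξ - η) x = ξ x - η x := rfl

lemma inner_toL2 (ξ η : B.L2Section μ) :
    ⟪B.toL2 μ ξ, B.toL2 μ η⟫_ℂ = ∫ x, ⟪ξ x, η x⟫_ℂ ∂μ := rfl

lemma toL2_surjective (v : B.L2 μ) : ∃ ξ, B.toL2 μ ξ = v := SeparationQuotient.surjective_mk v

lemma measurable_enorm {ξ : ∀ x, B.Fiber x} (hξ : ξ ∈ B.sections) :
    Measurable fun x => ‖ξ x‖ₑ := by
  simp only [← ofReal_norm]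
  exact (B.measurable_norm hξ).ennreal_ofReal

lemma norm_toL2_sq (ξ : B.L2Section μ) :
    ‖B.toL2 μ ξ‖ ^ 2 = (∫⁻ x, ‖ξ x‖ₑ ^ 2 ∂μ).toReal := by
  rw [← inner_self_eq_norm_sq (𝕜 := ℂ), inner_toL2, ← integral_re (B.integrable_inner μ ξ ξ)]
  simp only [inner_self_eq_norm_sq]
  rw [integral_eq_lintegral_of_nonneg_ae (Filter.Eventually.of_forall fun x => sq_nonneg _)
    ((B.measurable_norm ξ.2.1).pow_const 2).aestronglyMeasurable]
  congr 1
  refine lintegral_congr fun x => ?_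
  rw [ENNReal.ofReal_pow (norm_nonneg _), ofReal_norm]

lemma toL2_eq_iff {ξ η : B.L2Section μ} :
    B.toL2 μ ξ = B.toL2 μ η ↔ ∀ᵐ x ∂μ, ξ x = η x := by
  rw [← sub_eq_zero, ← norm_eq_zero, ← sq_eq_zero_iff]
  have : B.toL2 μ ξ - B.toL2 μ η = B.toL2 μ (ξ - η) := rfl
  rw [this, norm_toL2_sq, ENNReal.toReal_eq_zero_iff, or_iff_left (lintegral_enorm_sq _).ne,
    lintegral_eq_zero_iff ((measurable_enorm (ξ - η).2.1).pow_const 2)]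
  refine Filter.eventually_congr (Filter.Eventually.of_forall fun x => ?_)
  simp [sub_eq_zero]

variable (B μ) in
/-- The quotient map from square integrable sections to `L²`. -/
def toL2ₗ : B.L2Section μ →ₗ[ℂ] B.L2 μ where
  toFun := B.toL2 μ
  map_add' _ _ := rfl
  map_smul' _ _ := rfl

/-- A linear map on square integrable sections which preserves the `L²` norm factors through an
isometry of `L²`. -/
lemma exists_linearIsometry {F : Type*} [NormedAddCommGroup F] [InnerProductSpace ℂ F]
    [CompleteSpace F] (T : B.L2Section μ →ₗ[ℂ] F) (hT : ∀ ξ, ‖T ξ‖ = ‖B.toL2 μ ξ‖) :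
    ∃ T' : B.L2 μ →ₗᵢ[ℂ] F, ∀ ξ, T' (B.toL2 μ ξ) = T ξ :=
  exists_linearIsometry_of_norm_eq (B.toL2ₗ μ) T
    (Function.Surjective.denseRange toL2_surjective) hT

/-- Fibrewise embedding into `ℓ²` identifies the square integrable sections isometrically with functions
in `L²(μ, ℓ²)`. -/
lemma exists_l2Embedding : ∃ (ι : ∀ x, B.Fiber x →ₗᵢ[ℂ] Ell2.{0})
    (J : B.L2 μ →ₗᵢ[ℂ] Lp Ell2.{0} 2 μ),
    (∀ ξ : ∀ x, B.Fiber x, ξ ∈ B.sections ↔ Measurable fun x => ι x (ξ x)) ∧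
    ∀ ξ, ∀ᵐ x ∂μ, J (B.toL2 μ ξ) x = ι x (ξ x) := by
  obtain ⟨ι, hι⟩ := B.exists_embedding.{u, w, 0}
  have hm : ∀ ξ : B.L2Section μ, MemLp (fun x => ι x (ξ x)) 2 μ := fun ξ =>
    ξ.2.2.congr_norm ((hι _).1 ξ.2.1).aestronglyMeasurable
      (Filter.Eventually.of_forall fun x => by simp)
  let T : B.L2Section μ →ₗ[ℂ] Lp Ell2.{0} 2 μ :=
    { toFun := fun ξ => (hm ξ).toLp _
      map_add' := fun ξ η => by
        rw [← MemLp.toLp_add]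
        exact MemLp.toLp_congr _ _ (Filter.Eventually.of_forall fun x => map_add (ι x) _ _)
      map_smul' := fun c ξ => by
        rw [RingHom.id_apply, ← MemLp.toLp_const_smul]
        exact MemLp.toLp_congr _ _ (Filter.Eventually.of_forall fun x => map_smul (ι x) _ _) }
  obtain ⟨J, hJ⟩ := exists_linearIsometry T fun ξ => by
    rw [← sq_eq_sq₀ (norm_nonneg _) (norm_nonneg _), norm_toL2_sq]
    simp only [T, LinearMap.coe_mk, AddHom.coe_mk, Lp.norm_toLp]
    rw [eLpNorm_eq_lintegral_rpow_enorm_toReal (by simp) (by simp), ← ENNReal.toReal_pow]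
    congr 1
    simp only [ENNReal.toReal_ofNat, one_div]
    rw [← ENNReal.rpow_natCast, ← ENNReal.rpow_mul]
    simp only [Nat.cast_ofNat, inv_mul_cancel₀ (two_ne_zero' ℝ), ENNReal.rpow_one]
    refine lintegral_congr fun x => ?_
    rw [LinearIsometry.enorm_map]
    norm_cast
  refine ⟨ι, J, hι, fun ξ => ?_⟩
  rw [hJ]
  exact (hm ξ).coeFn_toLp

instance : CompleteSpace (B.L2 μ) := by
  obtain ⟨ι, J, hι, hJ⟩ := exists_l2Embedding (B := B) (μ := μ)
  refine Metric.complete_of_cauchySeq_tendsto fun v hv => ?_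
  obtain ⟨φ, hφ⟩ := cauchySeq_tendsto_of_complete (J.isometry.uniformContinuous.comp_cauchySeq hv)
  -- The limit is recovered by applying the adjoints of the fibrewise embeddings.
  let ξ : ∀ x, B.Fiber x := fun x => (ι x).toContinuousLinearMap.adjoint (φ x)
  have hφm : Measurable φ := (Lp.stronglyMeasurable φ).measurable
  have hle : ∀ x, ‖ξ x‖ ≤ ‖φ x‖ := fun x => by
    refine ((ι x).toContinuousLinearMap.adjoint.le_opNorm _).trans ?_
    rw [LinearIsometryEquiv.norm_map]
    exact mul_le_of_le_one_left (norm_nonneg _) (ι x).norm_toContinuousLinearMap_le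
  have hξ : ξ ∈ B.sections := B.mem_sections _ fun η hη => by
    simp only [ξ, ContinuousLinearMap.adjoint_inner_right]
    exact ((hι η).1 hη).inner hφm
  have hξ2 : MemLp (fun x => ‖ξ x‖) 2 μ := (Lp.memLp φ).norm.mono
    (B.measurable_norm hξ).aestronglyMeasurable
    (Filter.Eventually.of_forall fun x => by simpa using hle x)
  refine ⟨B.toL2 μ ⟨ξ, hξ, hξ2⟩, ?_⟩
  rw [tendsto_iff_norm_sub_tendsto_zero] at hφ ⊢
  refine squeeze_zero (fun _ => norm_nonneg _) (fun n => ?_) hφ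
  obtain ⟨η, hη⟩ := toL2_surjective (v n)
  rw [← hη, ← J.norm_map, map_sub]
  refine Lp.norm_le_norm_of_ae_le ?_
  filter_upwards [Lp.coeFn_sub (J (B.toL2 μ η)) (J (B.toL2 μ ⟨ξ, hξ, hξ2⟩)),
    Lp.coeFn_sub (J (B.toL2 μ η)) φ, hJ η, hJ ⟨ξ, hξ, hξ2⟩] with x h1 h2 h3 h4
  rw [h1, Function.comp_apply, ← hη, h2, Pi.sub_apply, Pi.sub_apply, h3, h4, ← map_sub,
    (ι x).norm_map]
  have h5 : η x - ξ x = (ι x).toContinuousLinearMap.adjoint (ι x (η x) - φ x) := by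
    rw [map_sub]
    congr 1
    exact (DFunLike.congr_fun ((ContinuousLinearMap.norm_map_iff_adjoint_comp_self
      (ι x).toContinuousLinearMap).1 (ι x).norm_map) (η x)).symm
  change ‖η x - ξ x‖ ≤ _
  rw [h5]
  refine ((ι x).toContinuousLinearMap.adjoint.le_opNorm _).trans ?_
  rw [LinearIsometryEquiv.norm_map]
  exact mul_le_of_le_one_left (norm_nonneg _) (ι x).norm_toContinuousLinearMap_le

instance [MeasurableSpace.CountablyGenerated X] [SigmaFinite μ] :
    SecondCountableTopology (B.L2 μ) := by
  obtain ⟨ι, J, -⟩ := exists_l2Embedding (B := B) (μ := μ)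
  have : Fact ((2 : ℝ≥0∞) ≠ ∞) := ⟨by simp⟩
  exact J.isometry.isEmbedding.secondCountableTopology

/-- A sequence of square integrable sections, bounded by one, which is total in every fibre. -/
lemma exists_total_l2 (B : HilbertBundle.{u, w} X) (μ : Measure X) [IsFiniteMeasure μ] :
    ∃ e : ℕ → B.L2Section μ, (∀ n x, ‖e n x‖ ≤ 1) ∧
      ∀ x, (Submodule.span ℂ (Set.range fun n => e n x)).topologicalClosure = ⊤ := by
  obtain ⟨e, he, ht⟩ := B.exists_total
  have hc : ∀ n, Measurable fun x => (((1 + ‖e n x‖)⁻¹ : ℝ) : ℂ) := fun n =>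
    RCLike.measurable_ofReal.comp ((B.measurable_norm (he n)).const_add 1).inv
  have hb : ∀ n x, ‖(((1 + ‖e n x‖)⁻¹ : ℝ) : ℂ) • e n x‖ ≤ 1 := fun n x => by
    rw [norm_smul, Complex.norm_real, Real.norm_eq_abs, abs_of_nonneg (by positivity),
      inv_mul_le_iff₀ (by positivity)]
    linarith
  refine ⟨fun n => mkL2 _ (smul_mem_sections (hc n) (he n)) ?_, hb, fun x => ?_⟩
  · refine (lintegral_mono (g := fun _ => 1) fun x => ?_).trans_lt (by simp)
    refine pow_le_one₀ zero_le ?_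
    rw [← ofReal_norm]
    exact ENNReal.ofReal_le_one.2 (hb n x)
  · refine total_of_forall_eq_zero _ fun v hv => eq_zero_of_inner_total _ (ht x) fun n => ?_
    have := hv n
    simp only [mkL2_apply, inner_smul_left, mul_eq_zero, map_eq_zero] at this
    refine this.resolve_left ?_
    have : (0 : ℝ) < (1 + ‖e n x‖)⁻¹ := by positivity
    exact_mod_cast this.ne'

end HilbertBundle

/-! ### Almost everywhere multiplicative maps on a locally compact group -/

section AEHom

variable {G : Type v} [Group G] [TopologicalSpace G] [IsTopologicalGroup G] [LocallyCompactSpace G]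
  [T2Space G] [SecondCountableTopology G] [MeasurableSpace G] [BorelSpace G]

/-- A conull subset of a locally compact group generates it: every element is a product of two
elements of the subset. -/
lemma exists_mul_eq_of_ae {p : G → Prop} (hp : ∀ᵐ g ∂(Measure.haar : Measure G), p g) (g : G) :
    ∃ a b, p a ∧ p b ∧ a * b = g := by
  have h1 : ∀ᵐ a ∂(Measure.haar : Measure G), p (a⁻¹ * g) :=
    (((quasiMeasurePreserving_mul_right Measure.haar g).comp
      (quasiMeasurePreserving_inv Measure.haar)).ae hp :)
  obtain ⟨a, ha, hb⟩ := (hp.and h1).exists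
  exact ⟨a, a⁻¹ * g, ha, hb, by group⟩

lemma ae_mul_left {p : G → Prop} (hp : ∀ᵐ g ∂(Measure.haar : Measure G), p g) (g : G) :
    ∀ᵐ h ∂(Measure.haar : Measure G), p (g * h) :=
  (measurePreserving_mul_left Measure.haar g).quasiMeasurePreserving.ae hp

lemma ae_inv {p : G → Prop} (hp : ∀ᵐ g ∂(Measure.haar : Measure G), p g) :
    ∀ᵐ h ∂(Measure.haar : Measure G), p h⁻¹ :=
  (quasiMeasurePreserving_inv Measure.haar).ae hp

/-- A map from a locally compact group which is multiplicative almost everywhere agrees almost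
everywhere with a homomorphism. -/
lemma exists_monoidHom_of_ae_mul {K : Type*} [Group K] (V : G → K)
    (h : ∀ᵐ p ∂((Measure.haar : Measure G).prod (Measure.haar : Measure G)),
      V (p.1 * p.2) = V p.1 * V p.2) :
    ∃ U : G →* K, ∀ᵐ g ∂(Measure.haar : Measure G), U g = V g := by
  have hA := Measure.ae_ae_of_ae_prod h
  -- `U g` is the element `u` with `V (g h) = u V h` for almost every `h`.
  have hex : ∀ g, ∃ u, ∀ᵐ h ∂(Measure.haar : Measure G), V (g * h) = u * V h := by
    intro g
    obtain ⟨a, b, ha, hb, rfl⟩ := exists_mul_eq_of_ae hA g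
    refine ⟨V a * V b, ?_⟩
    filter_upwards [hb, ae_mul_left ha b] with h h1 h2
    rw [mul_assoc, h2, h1, mul_assoc]
  choose U hU using hex
  have huniq : ∀ g u, (∀ᵐ h ∂(Measure.haar : Measure G), V (g * h) = u * V h) → U g = u := by
    intro g u hu
    obtain ⟨h, h1, h2⟩ := ((hU g).and hu).exists
    exact mul_right_cancel (h1.symm.trans h2)
  refine ⟨MonoidHom.mk' U fun a b => huniq _ _ ?_, ?_⟩
  · filter_upwards [hU b, ae_mul_left (hU a) b] with h h1 h2
    rw [mul_assoc, h2, h1, mul_assoc]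
  · filter_upwards [hA] with g hg
    exact huniq _ _ hg

/-- **Automatic continuity.** A unitary representation which agrees almost everywhere with a
measurable family of operators is strongly continuous, by Steinhaus' theorem. -/
lemma continuous_of_ae_measurable {H : Type*} [NormedAddCommGroup H] [InnerProductSpace ℂ H]
    [TopologicalSpace.SeparableSpace H] (U : G →* (H ≃ₗᵢ[ℂ] H)) (V : G → H → H)
    (hV : ∀ v w, Measurable fun g => ‖V g v - w‖)
    (h : ∀ᵐ g ∂(Measure.haar : Measure G), ∀ v, U g v = V g v) (v : H) :
    Continuous fun g => U g v := by
  have hmul : ∀ (g h : G) (w : H), U g (U h w) = U (g * h) w := fun g h w => by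
    rw [map_mul]
    rfl
  have hinv : ∀ (g : G) (w : H), U g⁻¹ (U g w) = w := by
    intro g w
    rw [hmul, inv_mul_cancel, map_one]
    rfl
  have h1 : ∀ ε > 0, ∀ᶠ g in nhds (1 : G), ‖U g v - v‖ < ε := by
    intro ε hε
    obtain ⟨N, hsub, hN, h0⟩ := exists_measurable_superset_of_null (ae_iff.1 (ae_inv h))
    let A : ℕ → Set G := fun n =>
      {g | ‖V g⁻¹ v - TopologicalSpace.denseSeq H n‖ < ε / 2} ∩ Nᶜ
    have hAm : ∀ n, MeasurableSet (A n) := fun n =>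
      (measurableSet_lt ((hV _ _).comp measurable_inv) measurable_const).inter hN.compl
    have hcover : Nᶜ ⊆ ⋃ n, A n := by
      intro g hg
      obtain ⟨n, hn⟩ := (TopologicalSpace.denseRange_denseSeq H).exists_dist_lt (V g⁻¹ v)
        (half_pos hε)
      exact Set.mem_iUnion.2 ⟨n, by simpa [dist_eq_norm] using hn, hg⟩
    have hpos : ∃ n, 0 < (Measure.haar : Measure G) (A n) := by
      by_contra! hcon
      have h2 : (Measure.haar : Measure G) (⋃ n, A n) = 0 :=
        measure_iUnion_null fun n => le_antisymm (hcon n) zero_le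
      have h3 : (Measure.haar : Measure G) Set.univ = 0 := by
        rw [← Set.union_compl_self N]
        exact measure_union_null h0 (measure_mono_null hcover h2)
      exact IsOpen.measure_ne_zero Measure.haar isOpen_univ Set.univ_nonempty h3
    -- By Steinhaus' theorem, the quotients of elements of `A n` form a neighbourhood of `1`.
    obtain ⟨n, hn⟩ := hpos
    filter_upwards [Measure.div_mem_nhds_one_of_haar_pos Measure.haar (A n) (hAm n) hn]
    rintro _ ⟨a, ha, b, hb, rfl⟩
    have hU : ∀ g ∈ A n, ‖U g⁻¹ v - TopologicalSpace.denseSeq H n‖ < ε / 2 := by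
      intro g hg
      have : ∀ v, U g⁻¹ v = V g⁻¹ v := by
        by_contra hcon
        exact hg.2 (hsub hcon)
      rw [this]
      exact hg.1
    have h4 : ‖U (a / b) v - v‖ = ‖U b⁻¹ v - U a⁻¹ v‖ := by
      rw [← (U a⁻¹).norm_map (U (a / b) v - v), map_sub]
      rw [hmul, show a⁻¹ * (a / b) = b⁻¹ by rw [div_eq_mul_inv, inv_mul_cancel_left]]
    dsimp only
    rw [h4]
    calc ‖U b⁻¹ v - U a⁻¹ v‖
        = ‖(U b⁻¹ v - TopologicalSpace.denseSeq H n) -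
            (U a⁻¹ v - TopologicalSpace.denseSeq H n)‖ := by congr 1; abel
      _ ≤ _ := norm_sub_le _ _
      _ < ε / 2 + ε / 2 := add_lt_add (hU b hb) (hU a ha)
      _ = ε := add_halves ε
  rw [continuous_iff_continuousAt]
  intro g₀
  rw [ContinuousAt, Metric.tendsto_nhds]
  intro ε hε
  have h2 : Filter.Tendsto (fun g => g₀⁻¹ * g) (nhds g₀) (nhds 1) := by
    have : Continuous fun g => g₀⁻¹ * g := by fun_prop
    simpa using this.tendsto g₀
  filter_upwards [h2.eventually (h1 ε hε)] with g hg
  rw [dist_eq_norm, ← (U g₀⁻¹).norm_map, map_sub, hinv, hmul]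
  exact hg

end AEHom

/-! ### The system of imprimitivity of a groupoid representation -/

namespace HilbertBundle

section C0

variable {X : Type u} [TopologicalSpace X] [MeasurableSpace X] [BorelSpace X]
  {B : HilbertBundle.{u, w} X} {μ : Measure X}

/-- The product of a function vanishing at infinity and a square integrable section. -/
def c0Smul (f : C₀(X, ℂ)) (ξ : B.L2Section μ) : B.L2Section μ :=
  ⟨fun x => f x • ξ x, smul_mem_sections (map_continuous f).measurable ξ.2.1, by
    refine (ξ.2.2.const_mul ‖f‖).mono (B.measurable_norm (smul_mem_sections
      (map_continuous f).measurable ξ.2.1)).aestronglyMeasurable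
      (Filter.Eventually.of_forall fun x => ?_)
    simp only [norm_smul, norm_mul, norm_norm]
    gcongr
    exact f.toBCF.norm_coe_le_norm x⟩

@[simp]
lemma c0Smul_apply (f : C₀(X, ℂ)) (ξ : B.L2Section μ) (x : X) : c0Smul f ξ x = f x • ξ x := rfl

lemma norm_toL2_le {C : ℝ} (hC : 0 ≤ C) {ξ η : B.L2Section μ} (h : ∀ x, ‖ξ x‖ ≤ C * ‖η x‖) :
    ‖B.toL2 μ ξ‖ ≤ C * ‖B.toL2 μ η‖ := by
  rw [← sq_le_sq₀ (norm_nonneg _) (by positivity), mul_pow, norm_toL2_sq, norm_toL2_sq,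
    ← ENNReal.toReal_ofReal (sq_nonneg C), ← ENNReal.toReal_mul]
  refine ENNReal.toReal_mono (ENNReal.mul_lt_top ENNReal.ofReal_lt_top
    (lintegral_enorm_sq η)).ne ?_
  rw [← lintegral_const_mul _ ((measurable_enorm η.2.1).pow_const 2)]
  refine lintegral_mono fun x => ?_
  rw [← ofReal_norm, ← ofReal_norm, ENNReal.ofReal_pow hC, ← mul_pow, ← ENNReal.ofReal_mul hC]
  gcongr
  exact h x

lemma exists_continuousLinearMap {F : Type*} [NormedAddCommGroup F] [InnerProductSpace ℂ F]
    [CompleteSpace F] (T : B.L2Section μ →ₗ[ℂ] F) (C : ℝ) (hT : ∀ ξ, ‖T ξ‖ ≤ C * ‖B.toL2 μ ξ‖) :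
    ∃ T' : B.L2 μ →L[ℂ] F, ∀ ξ, T' (B.toL2 μ ξ) = T ξ :=
  ⟨T.extendOfNorm (B.toL2ₗ μ), LinearMap.extendOfNorm_eq
    (Function.Surjective.denseRange toL2_surjective) ⟨C, hT⟩⟩

/-- The representation of `C₀(X)` by multiplication operators on `L²`. -/
lemma exists_c0Mul (B : HilbertBundle.{u, w} X) (μ : Measure X) :
    ∃ π : C₀(X, ℂ) →⋆ₙₐ[ℂ] (B.L2 μ →L[ℂ] B.L2 μ),
      ∀ f ξ, π f (B.toL2 μ ξ) = B.toL2 μ (c0Smul f ξ) := by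
  have hex : ∀ f : C₀(X, ℂ), ∃ T : B.L2 μ →L[ℂ] B.L2 μ,
      ∀ ξ, T (B.toL2 μ ξ) = B.toL2 μ (c0Smul f ξ) := by
    intro f
    refine exists_continuousLinearMap
      { toFun := fun ξ => B.toL2 μ (c0Smul f ξ)
        map_add' := fun ξ η => ?_
        map_smul' := fun c ξ => ?_ } ‖f‖ fun ξ => ?_
    · exact toL2_eq_iff.2 (Filter.Eventually.of_forall fun x => smul_add _ _ _)
    · exact toL2_eq_iff.2 (Filter.Eventually.of_forall fun x => smul_comm _ _ _)
    · refine norm_toL2_le (norm_nonneg f) fun x => ?_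
      rw [c0Smul_apply, norm_smul]
      gcongr
      exact f.toBCF.norm_coe_le_norm x
  choose T hT using hex
  have hext : ∀ A A' : B.L2 μ →L[ℂ] B.L2 μ,
      (∀ ξ, A (B.toL2 μ ξ) = A' (B.toL2 μ ξ)) → A = A' := by
    intro A A' h
    ext v
    obtain ⟨ξ, rfl⟩ := toL2_surjective v
    exact h ξ
  refine ⟨{ toFun := T
            map_smul' := fun c f => hext _ _ fun ξ => ?_
            map_zero' := hext _ _ fun ξ => ?_
            map_add' := fun f g => hext _ _ fun ξ => ?_
            map_mul' := fun f g => hext _ _ fun ξ => ?_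
            map_star' := fun f => ?_ }, hT⟩
  · simp only [hT, MonoidHom.id_apply, _root_.smul_apply]
    exact toL2_eq_iff.2 (Filter.Eventually.of_forall fun x => by simp [mul_smul])
  · simp only [hT, zero_apply]
    exact (toL2_eq_iff (η := 0)).2 (Filter.Eventually.of_forall fun x => by
      simp)
  · simp only [hT, add_apply]
    exact toL2_eq_iff.2 (Filter.Eventually.of_forall fun x => by simp [add_smul])
  · rw [ContinuousLinearMap.mul_def, ContinuousLinearMap.comp_apply, hT, hT, hT]
    exact toL2_eq_iff.2 (Filter.Eventually.of_forall fun x => by simp [mul_smul])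
  · rw [ContinuousLinearMap.star_eq_adjoint, ContinuousLinearMap.eq_adjoint_iff]
    intro v w
    obtain ⟨ξ, rfl⟩ := toL2_surjective v
    obtain ⟨η, rfl⟩ := toL2_surjective w
    simp only [hT, inner_toL2]
    refine integral_congr_ae (Filter.Eventually.of_forall fun x => ?_)
    simp [mul_comm]

variable [LocallyCompactSpace X] [T2Space X] [SecondCountableTopology X] [IsFiniteMeasure μ]

/-- A section which is orthogonal to all `C₀(X)`-multiples of a fixed section is pointwise
orthogonal to it. -/
lemma ae_inner_eq_zero {ξ η : B.L2Section μ}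
    (h : ∀ f : C₀(X, ℂ), ⟪B.toL2 μ (c0Smul f ξ), B.toL2 μ η⟫_ℂ = 0) :
    ∀ᵐ x ∂μ, ⟪ξ x, η x⟫_ℂ = 0 := by
  refine ae_eq_zero_of_forall_integral_C0 (B.integrable_inner μ ξ η) fun f => ?_
  rw [← h (star f), inner_toL2]
  refine integral_congr_ae (Filter.Eventually.of_forall fun x => ?_)
  simp [mul_comm]

/-- The `C₀(X)`-multiples of a sequence of sections which is total in almost every fibre span a dense
subspace of `L²`. -/
lemma eq_zero_of_forall_inner_c0Smul {ξ : ℕ → B.L2Section μ}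
    (ht : ∀ᵐ x ∂μ, (Submodule.span ℂ (Set.range fun n => ξ n x)).topologicalClosure = ⊤)
    {v : B.L2 μ} (h : ∀ n (f : C₀(X, ℂ)), ⟪B.toL2 μ (c0Smul f (ξ n)), v⟫_ℂ = 0) : v = 0 := by
  obtain ⟨η, rfl⟩ := toL2_surjective v
  refine (toL2_eq_iff (η := 0)).2 ?_
  filter_upwards [ht, ae_all_iff.2 fun n => ae_inner_eq_zero (h n)] with x h1 h2
  exact eq_zero_of_inner_total _ h1 h2

end C0

end HilbertBundle

namespace GroupoidRep

open TransformationGroupoid HilbertBundle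

section Integrate

variable {X : Type u} {G : Type v}
    [Group G] [TopologicalSpace G] [IsTopologicalGroup G] [LocallyCompactSpace G] [T2Space G]
    [SecondCountableTopology G] [MeasurableSpace G] [BorelSpace G]
    [TopologicalSpace X] [LocallyCompactSpace X] [T2Space X] [SecondCountableTopology X]
    [MeasurableSpace X] [BorelSpace X]
    [MulAction Gᵐᵒᵖ X] [ContinuousSMul Gᵐᵒᵖ X]
    (R : GroupoidRep.{u, v, w} G X) {r : X × G → ℝ}

lemma measurable_coeff_symm {ξ η : ∀ x, R.bundle.Fiber x} (hξ : ξ ∈ R.bundle.sections)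
    (hη : η ∈ R.bundle.sections) :
    Measurable fun t : X × G => ⟪η t.1, (R.L (arrow t.1 t.2)).symm (ξ (t.1 <• t.2))⟫_ℂ := by
  have h : (fun t : X × G => ⟪η t.1, (R.L (arrow t.1 t.2)).symm (ξ (t.1 <• t.2))⟫_ℂ) =
      fun t => (starRingEnd ℂ) ⟪ξ (t.1 <• t.2), R.L (arrow t.1 t.2) (η t.1)⟫_ℂ := by
    funext t
    rw [inner_conj_symm, ← (R.L (arrow t.1 t.2)).inner_map_map, LinearIsometryEquiv.apply_symm_apply]
  rw [h]
  exact RCLike.continuous_conj.measurable.comp (R.measurable_coeff η hη ξ hξ)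

lemma enorm_translate (hr : IsSqrtDensity R.μ r) (g : G) (ξ : R.bundle.L2Section R.μ) :
    ∫⁻ x, ‖((r (x, g) : ℝ) : ℂ) • (R.L (arrow x g)).symm (ξ (x <• g))‖ₑ ^ 2 ∂(R.μ) =
      ∫⁻ x, ‖ξ x‖ₑ ^ 2 ∂(R.μ) := by
  rw [← hr.lintegral_eq g ((measurable_enorm ξ.2.1).pow_const 2)]
  refine lintegral_congr fun x => ?_
  rw [enorm_smul, mul_pow, LinearIsometryEquiv.enorm_map, ← ofReal_norm, Complex.norm_real,
    Real.norm_of_nonneg (hr.pos _).le, ENNReal.ofReal_pow (hr.pos _).le]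

/-- The section `x ↦ ρ_g(x)^{1/2} L(x, g)⁻¹ ξ(x g)`. -/
def translate (hr : IsSqrtDensity R.μ r) (g : G) (ξ : R.bundle.L2Section R.μ) :
    R.bundle.L2Section R.μ :=
  mkL2 (fun x => ((r (x, g) : ℝ) : ℂ) • (R.L (arrow x g)).symm (ξ (x <• g)))
    (smul_mem_sections (RCLike.measurable_ofReal.comp (hr.measurable_right g))
      (R.bundle.mem_sections _ fun _ hη =>
        (R.measurable_coeff_symm ξ.2.1 hη).comp measurable_prodMk_right))
    (by rw [R.enorm_translate hr]; exact lintegral_enorm_sq ξ)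

@[simp]
lemma translate_apply (hr : IsSqrtDensity R.μ r) (g : G) (ξ : R.bundle.L2Section R.μ) (x : X) :
    R.translate hr g ξ x = ((r (x, g) : ℝ) : ℂ) • (R.L (arrow x g)).symm (ξ (x <• g)) := rfl

lemma translate_c0Smul (hr : IsSqrtDensity R.μ r) (g : G) (f : C₀(X, ℂ))
    (ξ : R.bundle.L2Section R.μ) (x : X) :
    R.translate hr g (c0Smul f ξ) x = c0Smul (rightTranslate g f) (R.translate hr g ξ) x := by
  rw [translate_apply, c0Smul_apply, c0Smul_apply, translate_apply, map_smul, smul_comm]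
  rfl

/-- The operator of translation by `g` is unitary. Its range is dense because it is invariant under
`C₀(X)` and contains sections which are total in each fibre. -/
lemma exists_translate (hr : IsSqrtDensity R.μ r) (g : G) :
    ∃ V : R.bundle.L2 R.μ ≃ₗᵢ[ℂ] R.bundle.L2 R.μ,
      ∀ ξ, V (R.bundle.toL2 R.μ ξ) = R.bundle.toL2 R.μ (R.translate hr g ξ) := by
  let T : R.bundle.L2Section R.μ →ₗ[ℂ] R.bundle.L2 R.μ :=
    { toFun := fun ξ => R.bundle.toL2 R.μ (R.translate hr g ξ)
      map_add' := fun ξ η => toL2_eq_iff.2 (Filter.Eventually.of_forall fun x => by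
        simp only [translate_apply, L2Section.add_apply, map_add, smul_add])
      map_smul' := fun c ξ => (toL2_eq_iff (η := c • R.translate hr g ξ)).2
        (Filter.Eventually.of_forall fun x => by
        simp only [translate_apply, L2Section.smul_apply, map_smul]
        exact smul_comm _ _ _) }
  obtain ⟨V, hV⟩ := exists_linearIsometry T fun ξ => by
    rw [← sq_eq_sq₀ (norm_nonneg _) (norm_nonneg _)]
    change ‖R.bundle.toL2 R.μ (R.translate hr g ξ)‖ ^ 2 = _
    rw [norm_toL2_sq, norm_toL2_sq]
    exact congrArg _ (R.enorm_translate hr g ξ)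
  obtain ⟨e, -, he⟩ := R.bundle.exists_total_l2 R.μ
  have hsurj : Function.Surjective V := by
    refine V.surjective_of_total
      (fun p : ℕ × C₀(X, ℂ) => R.bundle.toL2 R.μ (c0Smul p.2 (R.translate hr g (e p.1)))) ?_ ?_
    · refine total_of_forall_eq_zero _ fun v hv => eq_zero_of_forall_inner_c0Smul
        (ξ := fun n => R.translate hr g (e n)) ?_ fun n f => hv (n, f)
      refine Filter.Eventually.of_forall fun x => total_of_forall_eq_zero _ fun v hv => ?_
      have : R.L (arrow x g) v = 0 := eq_zero_of_inner_total _ (he (x <• g)) fun n => by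
        have h1 := hv n
        rw [translate_apply, inner_smul_left, mul_eq_zero, map_eq_zero] at h1
        rw [← h1.resolve_left (by exact_mod_cast (hr.pos (x, g)).ne'),
          ← (R.L (arrow x g)).inner_map_map, LinearIsometryEquiv.apply_symm_apply]
      simpa using this
    · rintro ⟨n, f⟩
      refine ⟨R.bundle.toL2 R.μ (c0Smul (rightTranslate g⁻¹ f) (e n)), ?_⟩
      rw [hV]
      refine toL2_eq_iff.2 (Filter.Eventually.of_forall fun x => ?_)
      rw [translate_c0Smul, c0Smul_apply, c0Smul_apply]
      congr 1
      change f ((x <• g) <• g⁻¹) = f x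
      rw [rsmul_rsmul_inv]
  exact ⟨LinearIsometryEquiv.ofSurjective V hsurj, hV⟩

/-- Arrows with the same source and the same group element agree, although their targets need not be
the same expression. -/
lemma symm_section_congr (R : GroupoidRep.{u, v, w} G X) {x y z : X} (a : Hom G x y)
    (b : Hom G x z) (h : a.elt = b.elt) (ξ : ∀ x, R.bundle.Fiber x) :
    (R.L a).symm (ξ y) = (R.L b).symm (ξ z) := by
  obtain ⟨g, rfl⟩ := a
  obtain ⟨g', rfl⟩ := b
  obtain rfl : g = g' := h
  rfl

lemma ae_ae_swap {α β : Type*} [MeasurableSpace α] [MeasurableSpace β] {μ : Measure α}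
    {ν : Measure β} [SFinite μ] [SFinite ν] {p : α → β → Prop}
    (h : ∀ᵐ t ∂μ.prod ν, p t.1 t.2) : ∀ᵐ b ∂ν, ∀ᵐ a ∂μ, p a b := by
  have h1 : ∀ᵐ t ∂ν.prod μ, p t.2 t.1 :=
    Measure.measurePreserving_swap.quasiMeasurePreserving.ae h
  exact Measure.ae_ae_of_ae_prod h1

lemma translate_translate (hr : IsSqrtDensity R.μ r) :
    ∀ᵐ p ∂((Measure.haar : Measure G).prod (Measure.haar : Measure G)),
      ∀ ξ : R.bundle.L2Section R.μ, ∀ᵐ x ∂(R.μ),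
        R.translate hr p.1 (R.translate hr p.2 ξ) x = R.translate hr (p.1 * p.2) ξ x := by
  filter_upwards [ae_ae_swap (p := fun x (p : G × G) => R.L (mul (arrow (x <• p.1) p.2)
    (arrow x p.1)) = (R.L (arrow x p.1)).trans (R.L (arrow (x <• p.1) p.2))) R.map_mul] with p hp ξ
  filter_upwards [hp, hr.ae_mul_eq p.1 p.2] with x h1 h2
  rw [translate_apply, translate_apply, translate_apply, map_smul, smul_smul, h2,
    Complex.ofReal_mul]
  congr 1
  rw [← R.symm_section_congr (mul (arrow (x <• p.1) p.2) (arrow x p.1)) (arrow x (p.1 * p.2)) rfl,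
    h1]
  rfl

/-- The measurability needed for the automatic continuity of the translation operators. -/
lemma measurable_norm_translate_sub (hr : IsSqrtDensity R.μ r) (ξ η : R.bundle.L2Section R.μ) :
    Measurable fun g : G =>
      ‖R.bundle.toL2 R.μ (R.translate hr g ξ) - R.bundle.toL2 R.μ η‖ := by
  choose V hV using R.exists_translate hr
  have h1 : (fun g : G => ‖R.bundle.toL2 R.μ (R.translate hr g ξ) - R.bundle.toL2 R.μ η‖) =
      fun g => √(‖R.bundle.toL2 R.μ ξ‖ ^ 2 - 2 * RCLike.re (starRingEnd ℂ
        ⟪R.bundle.toL2 R.μ η, R.bundle.toL2 R.μ (R.translate hr g ξ)⟫_ℂ) +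
          ‖R.bundle.toL2 R.μ η‖ ^ 2) := by
    funext g
    rw [inner_conj_symm, ← (V g).norm_map (R.bundle.toL2 R.μ ξ), hV, ← @norm_sub_sq ℂ,
      Real.sqrt_sq (norm_nonneg _)]
  have h2 : Measurable fun g : G =>
      ⟪R.bundle.toL2 R.μ η, R.bundle.toL2 R.μ (R.translate hr g ξ)⟫_ℂ := by
    simp only [inner_toL2, translate_apply, inner_smul_right]
    refine (StronglyMeasurable.integral_prod_left' (f := fun t : X × G => ((r t : ℝ) : ℂ) *
      ⟪η t.1, (R.L (arrow t.1 t.2)).symm (ξ (t.1 <• t.2))⟫_ℂ) ?_).measurable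
    exact ((RCLike.measurable_ofReal.comp hr.measurable).mul
      (R.measurable_coeff_symm ξ.2.1 η.2.1)).stronglyMeasurable
  rw [h1]
  exact ((((RCLike.measurable_re.comp
    (RCLike.continuous_conj.measurable.comp h2)).const_mul 2).const_sub _).add_const _).sqrt

/-- Every unitary representation of the groupoid integrates to a system of imprimitivity. -/
theorem exists_integratesTo : ∃ S : SystemOfImprimitivity.{u, v, w'} G X, R.IntegratesTo S := by
  obtain ⟨r, hr⟩ := R.quasiInvariant.exists_isSqrtDensity
  choose V hV using R.exists_translate hr
  have hVmul : ∀ᵐ p ∂((Measure.haar : Measure G).prod (Measure.haar : Measure G)),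
      V (p.1 * p.2) = V p.1 * V p.2 := by
    filter_upwards [R.translate_translate hr] with p hp
    ext v
    obtain ⟨ξ, rfl⟩ := toL2_surjective v
    change _ = V p.1 (V p.2 _)
    rw [hV, hV, hV, toL2_eq_iff]
    filter_upwards [hp ξ] with x hx
    exact hx.symm
  obtain ⟨U, hU⟩ := exists_monoidHom_of_ae_mul V hVmul
  have hmul : ∀ (g h : G) (v : R.bundle.L2 R.μ), U (g * h) v = U g (U h v) := fun g h v => by
    rw [_root_.map_mul]
    rfl
  have hcont : ∀ v, Continuous fun g => U g v := by
    refine continuous_of_ae_measurable U (fun g v => V g v) (fun v w => ?_) ?_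
    · obtain ⟨ξ, rfl⟩ := toL2_surjective v
      obtain ⟨η, rfl⟩ := toL2_surjective w
      simp only [hV]
      exact R.measurable_norm_translate_sub hr ξ η
    · filter_upwards [hU] with g hg v
      rw [hg]
  obtain ⟨π, hπ⟩ := exists_c0Mul R.bundle R.μ
  have hcov : ∀ (g : G) (f : C₀(X, ℂ)) (v : R.bundle.L2 R.μ),
      U g (π f v) = π (rightTranslate g f) (U g v) := by
    have hae : ∀ᵐ g ∂(Measure.haar : Measure G), ∀ (f : C₀(X, ℂ)) (v : R.bundle.L2 R.μ),
        U g (π f v) = π (rightTranslate g f) (U g v) := by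
      filter_upwards [hU] with g hg f v
      obtain ⟨ξ, rfl⟩ := toL2_surjective v
      rw [hg, hπ, hV, hV, hπ, toL2_eq_iff]
      exact Filter.Eventually.of_forall (R.translate_c0Smul hr g f ξ)
    intro g f v
    obtain ⟨a, b, ha, hb, rfl⟩ := exists_mul_eq_of_ae hae g
    rw [hmul, hmul, hb, ha]
    congr 2
    ext x
    change f ((x <• a) <• b) = f (x <• (a * b))
    rw [rsmul_rsmul]
  obtain ⟨e, -, he⟩ := R.bundle.exists_total_l2 R.μ
  -- The system of imprimitivity has to live in a prescribed universe.
  obtain ⟨K, hK, ⟨W⟩⟩ := exists_linearIsometryEquiv_universe.{max u w, w'} (R.bundle.L2 R.μ)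
  let S : SystemOfImprimitivity.{u, v, w'} G X :=
    { H := K
      separable := inferInstance
      U := ((Unitary.linearIsometryEquiv (𝕜 := ℂ) (H := K)).symm.toMonoidHom.comp
        { toFun := fun g => (W.symm.trans (U g)).trans W
          map_one' := LinearIsometryEquiv.ext fun v => by simp
          map_mul' := fun g h => LinearIsometryEquiv.ext fun v => by
            change W (U (g * h) (W.symm v)) = W (U g (W.symm (W (U h (W.symm v)))))
            rw [hmul, W.symm_apply_apply] })
      continuous_U := fun v => W.continuous.comp (hcont (W.symm v))
      π := (W.conjStarAlgEquiv : _ →⋆ₙₐ[ℂ] _).comp π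
      nondegenerate := by
        rw [Submodule.topologicalClosure_eq_top_iff, Submodule.eq_bot_iff]
        intro v hv
        rw [Submodule.mem_orthogonal] at hv
        have : W.symm v = 0 := by
          refine eq_zero_of_forall_inner_c0Smul (ξ := e) (Filter.Eventually.of_forall he)
            fun n f => ?_
          rw [← hπ, ← W.inner_map_map, W.apply_symm_apply]
          refine hv _ (Submodule.subset_span ⟨f, W (R.bundle.toL2 R.μ (e n)), ?_⟩)
          change W (π f (W.symm (W _))) = _
          rw [W.symm_apply_apply]
        simpa using this
      covariant := fun g f => by
        refine ContinuousLinearMap.ext fun v => ?_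
        change W (U g (W.symm (W (π f (W.symm (W (U g⁻¹ (W.symm v)))))))) =
          W (π (rightTranslate g f) (W.symm v))
        rw [W.symm_apply_apply, W.symm_apply_apply, hcov, ← hmul, mul_inv_cancel, map_one]
        rfl }
  refine ⟨S, W, fun f ξ ζ => ?_, ?_⟩
  · change W (π f (W.symm (W _))) = _ ↔ _
    rw [W.symm_apply_apply, W.injective.eq_iff, hπ, toL2_eq_iff]
    exact Filter.eventually_congr (Filter.Eventually.of_forall fun x => eq_comm)
  · filter_upwards [hU] with g hg ξ ζ
    change W (U g (W.symm (W _))) = _ ↔ _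
    rw [W.symm_apply_apply, W.injective.eq_iff, hg, hV, toL2_eq_iff]
    refine Filter.eventually_congr ?_
    filter_upwards [hr.sqrt_rnDeriv g] with x hx
    rw [translate_apply, eq_comm, ← hx]
    rfl

end Integrate

end GroupoidRep

/-! ### Equivalent representations have equivalent systems of imprimitivity -/

/-- The square root of the density of one measure with respect to another. -/
lemma exists_sqrt_density {X : Type*} [MeasurableSpace X] {μ ν : Measure X} [SigmaFinite μ]
    [SigmaFinite ν] (h12 : μ ≪ ν) :
    ∃ d : X → ℝ, Measurable d ∧ (∀ x, 0 ≤ d x) ∧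
      μ = ν.withDensity (fun x => ENNReal.ofReal (d x ^ 2)) ∧ (ν ≪ μ → ∀ᵐ x ∂ν, 0 < d x) := by
  refine ⟨fun x => √(μ.rnDeriv ν x).toReal, (Measure.measurable_rnDeriv _ _).ennreal_toReal.sqrt,
    fun x => Real.sqrt_nonneg _, ?_, fun h21 => ?_⟩
  · conv_lhs => rw [← Measure.withDensity_rnDeriv_eq _ _ h12]
    refine withDensity_congr_ae ?_
    filter_upwards [Measure.rnDeriv_lt_top μ ν] with x hx
    rw [Real.sq_sqrt ENNReal.toReal_nonneg, ENNReal.ofReal_toReal hx.ne]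
  · filter_upwards [Measure.rnDeriv_lt_top μ ν, Measure.rnDeriv_pos' h21] with x h1 h2
    exact Real.sqrt_pos.2 (ENNReal.toReal_pos h2.ne' h1.ne)

namespace GroupoidRep

open TransformationGroupoid HilbertBundle

section Uniqueness

variable {X : Type u} {G : Type v}
    [Group G] [TopologicalSpace G] [IsTopologicalGroup G] [LocallyCompactSpace G] [T2Space G]
    [SecondCountableTopology G] [MeasurableSpace G] [BorelSpace G]
    [TopologicalSpace X] [LocallyCompactSpace X] [T2Space X] [SecondCountableTopology X]
    [MeasurableSpace X] [BorelSpace X]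
    [MulAction Gᵐᵒᵖ X] [ContinuousSMul Gᵐᵒᵖ X]

/-- The formulas for `π` and `U`, with a jointly measurable version of the density. -/
lemma integratesTo_iff {R : GroupoidRep.{u, v, w} G X} {r : X × G → ℝ}
    (hr : IsSqrtDensity R.μ r) {S : SystemOfImprimitivity.{u, v, w'} G X} :
    R.IntegratesTo S ↔ ∃ W : R.bundle.L2 R.μ ≃ₗᵢ[ℂ] S.H,
      (∀ f ξ, S.π f (W (R.bundle.toL2 R.μ ξ)) = W (R.bundle.toL2 R.μ (c0Smul f ξ))) ∧
      ∀ᵐ g ∂(Measure.haar : Measure G), ∀ ξ : R.bundle.L2Section R.μ,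
        (S.U g : S.H →L[ℂ] S.H) (W (R.bundle.toL2 R.μ ξ)) =
          W (R.bundle.toL2 R.μ (R.translate hr g ξ)) := by
  have key : ∀ (g : G) (ξ ζ : R.bundle.L2Section R.μ),
      (∀ᵐ x ∂(R.μ), ζ x = ((√(R.density g x) : ℝ) : ℂ) •
        (R.L (arrow x g)).symm (ξ (x <• g))) ↔ ∀ᵐ x ∂(R.μ), ζ x = R.translate hr g ξ x := by
    intro g ξ ζ
    refine Filter.eventually_congr ?_
    filter_upwards [hr.sqrt_rnDeriv g] with x hx
    rw [translate_apply, ← hx]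
    rfl
  refine exists_congr fun W => and_congr ⟨fun h f ξ => ?_, fun h f ξ ζ => ?_⟩
    ⟨fun h => ?_, fun h => ?_⟩
  · exact (h f ξ (c0Smul f ξ)).2 (Filter.Eventually.of_forall fun x => rfl)
  · rw [h, W.injective.eq_iff, eq_comm, toL2_eq_iff]
    rfl
  · filter_upwards [h] with g hg ξ
    exact (hg ξ _).2 ((key g ξ _).2 (Filter.Eventually.of_forall fun x => rfl))
  · filter_upwards [h] with g hg ξ ζ
    rw [key, hg, W.injective.eq_iff, eq_comm, toL2_eq_iff]

lemma _root_.SystemOfImprimitivity.U_mul_apply (S : SystemOfImprimitivity.{u, v, w'} G X) (g h : G)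
    (x : S.H) : (S.U (g * h) : S.H →L[ℂ] S.H) x =
      (S.U g : S.H →L[ℂ] S.H) ((S.U h : S.H →L[ℂ] S.H) x) := by
  rw [_root_.map_mul]
  rfl

/-- The system of imprimitivity of a representation is unique up to equivalence: the formula for almost
every `g` determines `U`, since every `g` is a product of two elements of a conull set. -/
lemma IntegratesTo.equivalent {R : GroupoidRep.{u, v, w} G X}
    {S S' : SystemOfImprimitivity.{u, v, w'} G X} (h : R.IntegratesTo S) (h' : R.IntegratesTo S') :
    S.Equivalent S' := by
  obtain ⟨r, hr⟩ := R.quasiInvariant.exists_isSqrtDensity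
  obtain ⟨W, hπ, hU⟩ := (integratesTo_iff hr).1 h
  obtain ⟨W', hπ', hU'⟩ := (integratesTo_iff hr).1 h'
  have hsurj : ∀ v : S.H, ∃ ξ, W (R.bundle.toL2 R.μ ξ) = v := fun v => by
    obtain ⟨ξ, hξ⟩ := toL2_surjective (W.symm v)
    exact ⟨ξ, by rw [hξ, W.apply_symm_apply]⟩
  refine ⟨W.symm.trans W', ?_, fun f v => ?_⟩
  · have hae : ∀ᵐ g ∂(Measure.haar : Measure G), ∀ v : S.H,
        (W.symm.trans W') ((S.U g : S.H →L[ℂ] S.H) v) =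
          (S'.U g : S'.H →L[ℂ] S'.H) ((W.symm.trans W') v) := by
      filter_upwards [hU, hU'] with g hg hg' v
      obtain ⟨ξ, rfl⟩ := hsurj v
      rw [hg]
      simp only [LinearIsometryEquiv.trans_apply, LinearIsometryEquiv.symm_apply_apply, hg']
    intro g v
    obtain ⟨a, b, ha, hb, rfl⟩ := exists_mul_eq_of_ae hae g
    rw [S.U_mul_apply, S'.U_mul_apply, ha, hb]
  · obtain ⟨ξ, rfl⟩ := hsurj v
    rw [hπ]
    simp only [LinearIsometryEquiv.trans_apply, LinearIsometryEquiv.symm_apply_apply, hπ']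

lemma IntegratesTo.of_equivalent {R : GroupoidRep.{u, v, w} G X}
    {S S' : SystemOfImprimitivity.{u, v, w'} G X} (h : R.IntegratesTo S) (h' : S.Equivalent S') :
    R.IntegratesTo S' := by
  obtain ⟨r, hr⟩ := R.quasiInvariant.exists_isSqrtDensity
  obtain ⟨W, hπ, hU⟩ := (integratesTo_iff hr).1 h
  obtain ⟨e, heU, heπ⟩ := h'
  refine (integratesTo_iff hr).2 ⟨W.trans e, fun f ξ => ?_, ?_⟩
  · simp only [LinearIsometryEquiv.trans_apply, ← heπ, hπ]
  · filter_upwards [hU] with g hg ξ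
    simp only [LinearIsometryEquiv.trans_apply, ← heU, hg]

variable (R : GroupoidRep.{u, v, w} G X)

lemma rsmul_mem_nonzeroSet (g : G) (x : X) :
    x <• g ∈ R.bundle.nonzeroSet ↔ x ∈ R.bundle.nonzeroSet :=
  ((R.L (arrow x g)).toEquiv.nontrivial_congr).symm

lemma isSqrtDensity_essMeasure {r : X × G → ℝ} (hr : IsSqrtDensity R.μ r) :
    IsSqrtDensity R.essMeasure r :=
  hr.restrict R.bundle.measurableSet_nonzeroSet R.rsmul_mem_nonzeroSet

instance : IsFiniteMeasure R.essMeasure := by unfold essMeasure; infer_instance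

lemma ae_essMeasure_iff {p : X → Prop} :
    (∀ᵐ x ∂(R.essMeasure), p x) ↔ ∀ᵐ x ∂(R.μ), x ∈ R.bundle.nonzeroSet → p x :=
  ae_restrict_iff' R.bundle.measurableSet_nonzeroSet

lemma eq_of_notMem_nonzeroSet {x : X} (hx : x ∉ R.bundle.nonzeroSet) (v w : R.bundle.Fiber x) :
    v = w := by
  have : Subsingleton (R.bundle.Fiber x) := not_nontrivial_iff_subsingleton.1 hx
  exact Subsingleton.elim v w

lemma ae_essMeasure_eq_iff {ξ η : ∀ x, R.bundle.Fiber x} :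
    (∀ᵐ x ∂(R.essMeasure), ξ x = η x) ↔ ∀ᵐ x ∂(R.μ), ξ x = η x := by
  rw [ae_essMeasure_iff]
  refine Filter.eventually_congr (Filter.Eventually.of_forall fun x =>
    ⟨fun h => ?_, fun h _ => h⟩)
  by_cases hx : x ∈ R.bundle.nonzeroSet
  exacts [h hx, R.eq_of_notMem_nonzeroSet hx _ _]

lemma lintegral_essMeasure (ξ : ∀ x, R.bundle.Fiber x) :
    ∫⁻ x, ‖ξ x‖ₑ ^ 2 ∂(R.essMeasure) = ∫⁻ x, ‖ξ x‖ₑ ^ 2 ∂(R.μ) := by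
  rw [essMeasure, ← lintegral_indicator R.bundle.measurableSet_nonzeroSet]
  refine lintegral_congr fun x => ?_
  by_cases hx : x ∈ R.bundle.nonzeroSet
  · rw [Set.indicator_of_mem hx]
  · rw [Set.indicator_of_notMem hx, R.eq_of_notMem_nonzeroSet hx (ξ x) 0]
    simp

/-- Equivalent representations have unitarily equivalent `L²` spaces; the unitary is
`ξ ↦ (dμ₁ / dμ₂)^{1/2} T ξ`. -/
lemma Equivalent.exists_unitary {R₁ R₂ : GroupoidRep.{u, v, w} G X} (h : R₁.Equivalent R₂)
    {r₁ r₂ : X × G → ℝ} (hr₁ : IsSqrtDensity R₁.μ r₁) (hr₂ : IsSqrtDensity R₂.μ r₂) :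
    ∃ Y : R₁.bundle.L2 R₁.μ ≃ₗᵢ[ℂ] R₂.bundle.L2 R₂.μ,
      (∀ f ξ η, Y (R₁.bundle.toL2 R₁.μ ξ) = R₂.bundle.toL2 R₂.μ η →
        Y (R₁.bundle.toL2 R₁.μ (c0Smul f ξ)) = R₂.bundle.toL2 R₂.μ (c0Smul f η)) ∧
      ∀ᵐ g ∂(Measure.haar : Measure G), ∀ ξ η,
        Y (R₁.bundle.toL2 R₁.μ ξ) = R₂.bundle.toL2 R₂.μ η →
          Y (R₁.bundle.toL2 R₁.μ (R₁.translate hr₁ g ξ)) =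
            R₂.bundle.toL2 R₂.μ (R₂.translate hr₂ g η) := by
  obtain ⟨h12, h21, T, hT, hs, hs', hI⟩ := h
  obtain ⟨d, hd, hd0, hden, hdpos⟩ := exists_sqrt_density h12
  replace hdpos := hdpos h21
  have hd2 : Measurable fun x => ENNReal.ofReal (d x ^ 2) := (hd.pow_const 2).ennreal_ofReal
  have hdc : Measurable fun x => ((d x : ℝ) : ℂ) := RCLike.measurable_ofReal.comp hd
  -- Norms of sections related by `d` and `T`.
  have hnorm : ∀ (ξ : ∀ x, R₁.bundle.Fiber x) (η : ∀ x, R₂.bundle.Fiber x),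
      η ∈ R₂.bundle.sections → (∀ᵐ x ∂(R₁.essMeasure), T x (ξ x) = η x) →
      ∫⁻ x, ‖((d x : ℝ) : ℂ) • η x‖ₑ ^ 2 ∂(R₂.μ) = ∫⁻ x, ‖ξ x‖ₑ ^ 2 ∂(R₁.μ) := by
    intro ξ η hη h
    rw [← R₂.lintegral_essMeasure fun x => ((d x : ℝ) : ℂ) • η x, ← R₁.lintegral_essMeasure]
    have h1 : ∫⁻ x, ‖ξ x‖ₑ ^ 2 ∂(R₁.essMeasure) = ∫⁻ x, ‖η x‖ₑ ^ 2 ∂(R₁.essMeasure) := by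
      refine lintegral_congr_ae ?_
      filter_upwards [h, hT] with x h1 h2
      rw [← h1, ← ofReal_norm, ← ofReal_norm, h2.1]
    rw [h1, hden, lintegral_withDensity_mul hd2 ((measurable_enorm hη).pow_const 2)]
    refine lintegral_congr fun x => ?_
    rw [enorm_smul, mul_pow, ← ofReal_norm, Complex.norm_real, Real.norm_of_nonneg (hd0 _),
      ENNReal.ofReal_pow (hd0 _)]
  choose N hN hTN using fun ξ : R₁.bundle.L2Section R₁.μ => hs ξ ξ.2.1
  let Y₀ : R₁.bundle.L2Section R₁.μ → R₂.bundle.L2Section R₂.μ := fun ξ =>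
    mkL2 (fun x => ((d x : ℝ) : ℂ) • N ξ x) (smul_mem_sections hdc (hN ξ)) (by
      rw [hnorm ξ (N ξ) (hN ξ) (hTN ξ)]; exact lintegral_enorm_sq ξ)
  have hY₀ : ∀ ξ, ∀ᵐ x ∂(R₂.essMeasure), Y₀ ξ x = ((d x : ℝ) : ℂ) • T x (ξ x) := by
    intro ξ
    filter_upwards [h21.ae_le (hTN ξ)] with x hx
    rw [hx]
    rfl
  let Y₁ : R₁.bundle.L2Section R₁.μ →ₗ[ℂ] R₂.bundle.L2 R₂.μ :=
    { toFun := fun ξ => R₂.bundle.toL2 R₂.μ (Y₀ ξ)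
      map_add' := fun ξ η => by
        refine (toL2_eq_iff (η := Y₀ ξ + Y₀ η)).2 (R₂.ae_essMeasure_eq_iff.1 ?_)
        filter_upwards [hY₀ ξ, hY₀ η, hY₀ (ξ + η)] with x h1 h2 h3
        rw [h3, L2Section.add_apply, L2Section.add_apply, _root_.map_add, smul_add, h1, h2]
      map_smul' := fun c ξ => by
        refine (toL2_eq_iff (η := c • Y₀ ξ)).2 (R₂.ae_essMeasure_eq_iff.1 ?_)
        filter_upwards [hY₀ ξ, hY₀ (c • ξ)] with x h1 h2
        rw [h2, L2Section.smul_apply, L2Section.smul_apply, _root_.map_smul, h1]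
        exact smul_comm _ _ _ }
  obtain ⟨Y, hY⟩ := exists_linearIsometry Y₁ fun ξ => by
    rw [← sq_eq_sq₀ (norm_nonneg _) (norm_nonneg _)]
    change ‖R₂.bundle.toL2 R₂.μ (Y₀ ξ)‖ ^ 2 = _
    rw [norm_toL2_sq, norm_toL2_sq]
    exact congrArg _ (hnorm ξ (N ξ) (hN ξ) (hTN ξ))
  have hYiff : ∀ ξ η, Y (R₁.bundle.toL2 R₁.μ ξ) = R₂.bundle.toL2 R₂.μ η ↔
      ∀ᵐ x ∂(R₂.essMeasure), η x = ((d x : ℝ) : ℂ) • T x (ξ x) := by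
    intro ξ η
    rw [hY]
    change R₂.bundle.toL2 R₂.μ (Y₀ ξ) = _ ↔ _
    rw [toL2_eq_iff, ← R₂.ae_essMeasure_eq_iff]
    refine Filter.eventually_congr ?_
    filter_upwards [hY₀ ξ] with x hx
    rw [hx, eq_comm]
  have hsurj : Function.Surjective Y := by
    intro v
    obtain ⟨ζ, rfl⟩ := toL2_surjective v
    have hdi : Measurable fun x => (((d x)⁻¹ : ℝ) : ℂ) := RCLike.measurable_ofReal.comp hd.inv
    have hmem := smul_mem_sections hdi ζ.2.1
    obtain ⟨ξ, hξ, hξT⟩ := hs' _ hmem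
    have hlt : ∫⁻ x, ‖ξ x‖ₑ ^ 2 ∂(R₁.μ) < ⊤ := by
      rw [← hnorm ξ _ hmem hξT]
      refine lt_of_le_of_lt (lintegral_mono fun x => ?_) (lintegral_enorm_sq ζ)
      gcongr
      rw [smul_smul, ← Complex.ofReal_mul, enorm_smul]
      refine mul_le_of_le_one_left zero_le ?_
      rw [← ofReal_norm, Complex.norm_real, ENNReal.ofReal_le_one,
        Real.norm_of_nonneg (mul_nonneg (hd0 _) (inv_nonneg.2 (hd0 _)))]
      exact mul_inv_le_one
    refine ⟨R₁.bundle.toL2 R₁.μ (mkL2 ξ hξ hlt), (hYiff _ _).2 ?_⟩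
    filter_upwards [h21.ae_le hξT, hdpos] with x h1 h2
    rw [mkL2_apply, h1, smul_smul, ← Complex.ofReal_mul, mul_inv_cancel₀ h2.ne', Complex.ofReal_one,
      one_smul]
  refine ⟨LinearIsometryEquiv.ofSurjective Y hsurj, fun f ξ η hη => ?_, ?_⟩
  · refine (hYiff _ _).2 ?_
    filter_upwards [(hYiff _ _).1 hη] with x hx
    rw [c0Smul_apply, hx, c0Smul_apply, _root_.map_smul, smul_comm]
  · have hTt := R₁.ae_target hT
    filter_upwards [ae_ae_swap (p := fun x (g : G) => ∀ v : R₁.bundle.Fiber x,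
      T (x <• g) (R₁.L (arrow x g) v) = R₂.L (arrow x g) (T x v)) hI] with g hg ξ η hξη
    refine (hYiff _ _).2 ?_
    have hr₂' := R₂.isSqrtDensity_essMeasure hr₂
    filter_upwards [h21.ae_le hg, hr₂'.ae_rsmul g ((hYiff _ _).1 hξη),
      IsSqrtDensity.ae_mul_eq_of_withDensity hd hd0 hden hr₂'
        (R₁.isSqrtDensity_essMeasure hr₁) g] with x h1 h2 h3
    rw [translate_apply, translate_apply, h2, _root_.map_smul, _root_.map_smul, smul_smul, smul_smul,
      ← Complex.ofReal_mul, ← Complex.ofReal_mul, h3]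
    congr 1
    rw [LinearIsometryEquiv.symm_apply_eq, ← h1, LinearIsometryEquiv.apply_symm_apply]

lemma IntegratesTo.of_rep_equivalent {R₁ R₂ : GroupoidRep.{u, v, w} G X} (h : R₁.Equivalent R₂)
    {S : SystemOfImprimitivity.{u, v, w'} G X} (h₂ : R₂.IntegratesTo S) : R₁.IntegratesTo S := by
  obtain ⟨r₁, hr₁⟩ := R₁.quasiInvariant.exists_isSqrtDensity
  obtain ⟨r₂, hr₂⟩ := R₂.quasiInvariant.exists_isSqrtDensity
  obtain ⟨W, hπ, hU⟩ := (integratesTo_iff hr₂).1 h₂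
  obtain ⟨Y, hYπ, hYU⟩ := h.exists_unitary hr₁ hr₂
  have hY : ∀ ξ, ∃ η, Y (R₁.bundle.toL2 R₁.μ ξ) = R₂.bundle.toL2 R₂.μ η := fun ξ => by
    obtain ⟨η, hη⟩ := toL2_surjective (Y (R₁.bundle.toL2 R₁.μ ξ))
    exact ⟨η, hη.symm⟩
  refine (integratesTo_iff hr₁).2 ⟨Y.trans W, fun f ξ => ?_, ?_⟩
  · obtain ⟨η, h1⟩ := hY ξ
    simp only [LinearIsometryEquiv.trans_apply, h1, hYπ f ξ η h1, hπ]
  · filter_upwards [hU, hYU] with g hg hg' ξ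
    obtain ⟨η, h1⟩ := hY ξ
    simp only [LinearIsometryEquiv.trans_apply, h1, hg' ξ η h1, hg]

end Uniqueness

end GroupoidRep

/-! ### Representations with the same system of imprimitivity are equivalent -/

namespace GroupoidRep

open TransformationGroupoid HilbertBundle

section Injectivity

variable {X : Type u} {G : Type v}
    [Group G] [TopologicalSpace G] [IsTopologicalGroup G] [LocallyCompactSpace G] [T2Space G]
    [SecondCountableTopology G] [MeasurableSpace G] [BorelSpace G]
    [TopologicalSpace X] [LocallyCompactSpace X] [T2Space X] [SecondCountableTopology X]
    [MeasurableSpace X] [BorelSpace X]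
    [MulAction Gᵐᵒᵖ X] [ContinuousSMul Gᵐᵒᵖ X]

open scoped CompactlySupported

/-- A unitary operator which commutes with `C₀(X)` preserves the complex measures `⟪ξ, ξ'⟫ μ`. -/
lemma integral_C0_mul_inner {B₁ B₂ : HilbertBundle.{u, w} X} {μ₁ μ₂ : Measure X}
    (Y : B₁.L2 μ₁ ≃ₗᵢ[ℂ] B₂.L2 μ₂)
    (hY : ∀ (f : C₀(X, ℂ)) (ξ : B₁.L2Section μ₁) (η : B₂.L2Section μ₂),
      Y (B₁.toL2 μ₁ ξ) = B₂.toL2 μ₂ η → Y (B₁.toL2 μ₁ (c0Smul f ξ)) = B₂.toL2 μ₂ (c0Smul f η))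
    {ξ ξ' : B₁.L2Section μ₁} {η η' : B₂.L2Section μ₂} (h : Y (B₁.toL2 μ₁ ξ) = B₂.toL2 μ₂ η)
    (h' : Y (B₁.toL2 μ₁ ξ') = B₂.toL2 μ₂ η') (f : C₀(X, ℂ)) :
    ∫ x, f x * ⟪ξ x, ξ' x⟫_ℂ ∂μ₁ = ∫ x, f x * ⟪η x, η' x⟫_ℂ ∂μ₂ := by
  have h1 : ⟪B₁.toL2 μ₁ ξ, B₁.toL2 μ₁ (c0Smul f ξ')⟫_ℂ =
      ⟪B₂.toL2 μ₂ η, B₂.toL2 μ₂ (c0Smul f η')⟫_ℂ := by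
    rw [← h, ← hY f _ _ h', Y.inner_map_map]
  simpa only [inner_toL2, c0Smul_apply, inner_smul_right] using h1

lemma withDensity_enorm_sq_eq {B₁ B₂ : HilbertBundle.{u, w} X} {μ₁ μ₂ : Measure X}
    (Y : B₁.L2 μ₁ ≃ₗᵢ[ℂ] B₂.L2 μ₂)
    (hY : ∀ (f : C₀(X, ℂ)) (ξ : B₁.L2Section μ₁) (η : B₂.L2Section μ₂),
      Y (B₁.toL2 μ₁ ξ) = B₂.toL2 μ₂ η → Y (B₁.toL2 μ₁ (c0Smul f ξ)) = B₂.toL2 μ₂ (c0Smul f η))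
    {ξ : B₁.L2Section μ₁} {η : B₂.L2Section μ₂} (h : Y (B₁.toL2 μ₁ ξ) = B₂.toL2 μ₂ η) :
    (μ₁.withDensity fun x => ‖ξ x‖ₑ ^ 2) = μ₂.withDensity fun x => ‖η x‖ₑ ^ 2 := by
  have := isFiniteMeasure_withDensity (μ := μ₁) (lintegral_enorm_sq ξ).ne
  have := isFiniteMeasure_withDensity (μ := μ₂) (lintegral_enorm_sq η).ne
  refine Measure.ext_of_integral_eq_on_compactlySupported fun f => ?_
  rw [integral_withDensity_eq_integral_toReal_smul ((measurable_enorm ξ.2.1).pow_const 2)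
      (Filter.Eventually.of_forall fun _ => by simp),
    integral_withDensity_eq_integral_toReal_smul ((measurable_enorm η.2.1).pow_const 2)
      (Filter.Eventually.of_forall fun _ => by simp)]
  have h1 := congrArg RCLike.re (integral_C0_mul_inner Y hY h h f.toC0)
  rw [← integral_re (integrable_C0_mul _ (B₁.integrable_inner _ _ _)),
    ← integral_re (integrable_C0_mul _ (B₂.integrable_inner _ _ _))] at h1
  simpa [inner_self_eq_norm_sq_to_K, ← Complex.ofReal_pow, ← Complex.ofReal_mul, mul_comm] using h1

/-- A set which is null for `R₁` carries no square integrable sections of `R₁`, hence none of `R₂`. -/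
lemma essMeasure_absolutelyContinuous {R₁ R₂ : GroupoidRep.{u, v, w} G X}
    (Y : R₁.bundle.L2 R₁.μ ≃ₗᵢ[ℂ] R₂.bundle.L2 R₂.μ)
    (hY : ∀ (f : C₀(X, ℂ)) ξ η, Y (R₁.bundle.toL2 R₁.μ ξ) = R₂.bundle.toL2 R₂.μ η →
      Y (R₁.bundle.toL2 R₁.μ (c0Smul f ξ)) = R₂.bundle.toL2 R₂.μ (c0Smul f η)) :
    R₂.essMeasure ≪ R₁.essMeasure := by
  refine Measure.AbsolutelyContinuous.mk fun N hN h0 => ?_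
  obtain ⟨e, -, ht⟩ := exists_total_l2 R₂.bundle R₂.μ
  have h0' : ∀ᵐ x ∂(R₁.μ), x ∈ R₁.bundle.nonzeroSet → x ∉ N :=
    R₁.ae_essMeasure_iff.1 (measure_eq_zero_iff_ae_notMem.1 h0)
  have h1 : ∀ n, ∀ᵐ x ∂(R₂.μ), x ∈ N → e n x = 0 := by
    intro n
    obtain ⟨ξ, hξ⟩ := toL2_surjective (Y.symm (R₂.bundle.toL2 R₂.μ (e n)))
    have h2 := congrArg (fun ν => ν N) (withDensity_enorm_sq_eq (ξ := ξ) (η := e n) Y hY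
      (by rw [hξ, Y.apply_symm_apply]))
    simp only [withDensity_apply _ hN] at h2
    have h3 : ∫⁻ x in N, ‖ξ x‖ₑ ^ 2 ∂(R₁.μ) = 0 := by
      rw [setLIntegral_eq_zero_iff hN ((measurable_enorm ξ.2.1).pow_const 2)]
      filter_upwards [h0'] with x hx hxN
      rw [R₁.eq_of_notMem_nonzeroSet (fun h => hx h hxN) (ξ x) 0]
      simp
    rw [h3, eq_comm, setLIntegral_eq_zero_iff hN ((measurable_enorm (e n).2.1).pow_const 2)] at h2
    filter_upwards [h2] with x hx hxN
    simpa using hx hxN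
  rw [measure_eq_zero_iff_ae_notMem, ae_essMeasure_iff]
  filter_upwards [ae_all_iff.2 h1] with x hx hnz hxN
  obtain ⟨v, hv⟩ := @exists_ne _ hnz 0
  exact hv (eq_zero_of_inner_total _ (ht x) fun n => by rw [hx n hxN, inner_zero_left])

/-- Every measurable section is a square integrable one, up to a positive scalar function. -/
lemma exists_smul_l2 {B : HilbertBundle.{u, w} X} (μ : Measure X) [IsFiniteMeasure μ]
    {ξ : ∀ x, B.Fiber x} (hξ : ξ ∈ B.sections) : ∃ (c : X → ℝ) (ξ' : B.L2Section μ),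
      Measurable c ∧ ∀ x, ξ x = ((c x : ℝ) : ℂ) • ξ' x := by
  have hpos : ∀ x, 0 < 1 + ‖ξ x‖ := fun x => by positivity
  have hc : Measurable fun x => (((1 + ‖ξ x‖)⁻¹ : ℝ) : ℂ) :=
    RCLike.measurable_ofReal.comp ((B.measurable_norm hξ).const_add 1).inv
  refine ⟨fun x => 1 + ‖ξ x‖, mkL2 _ (smul_mem_sections hc hξ) ?_,
    (B.measurable_norm hξ).const_add 1, fun x => ?_⟩
  · refine (lintegral_mono (g := fun _ => 1) fun x => ?_).trans_lt (by simp)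
    refine pow_le_one₀ zero_le ?_
    rw [← ofReal_norm, ENNReal.ofReal_le_one, norm_smul, Complex.norm_real,
      Real.norm_of_nonneg (inv_nonneg.2 (hpos x).le), inv_mul_le_iff₀ (hpos x)]
    linarith
  · rw [mkL2_apply, smul_smul, ← Complex.ofReal_mul, mul_inv_cancel₀ (hpos x).ne',
      Complex.ofReal_one, one_smul]

/-- A unitary operator between `L²` spaces of sections which commutes with `C₀(X)` is given by
unitary operators between the fibres. -/
lemma exists_fiberwise {R₁ R₂ : GroupoidRep.{u, v, w} G X}
    (Y : R₁.bundle.L2 R₁.μ ≃ₗᵢ[ℂ] R₂.bundle.L2 R₂.μ)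
    (hY : ∀ (f : C₀(X, ℂ)) ξ η, Y (R₁.bundle.toL2 R₁.μ ξ) = R₂.bundle.toL2 R₂.μ η →
      Y (R₁.bundle.toL2 R₁.μ (c0Smul f ξ)) = R₂.bundle.toL2 R₂.μ (c0Smul f η))
    {d : X → ℝ} (hd : Measurable d)
    (hden : R₁.essMeasure = R₂.essMeasure.withDensity fun x => ENNReal.ofReal (d x ^ 2))
    (hdpos : ∀ᵐ x ∂(R₂.essMeasure), 0 < d x) :
    ∃ T : ∀ x, R₁.bundle.Fiber x →L[ℂ] R₂.bundle.Fiber x,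
      (∀ᵐ x ∂(R₂.essMeasure), (∀ v, ‖T x v‖ = ‖v‖) ∧ Function.Surjective (T x)) ∧
      ∀ ξ η, Y (R₁.bundle.toL2 R₁.μ ξ) = R₂.bundle.toL2 R₂.μ η →
        ∀ᵐ x ∂(R₂.essMeasure), η x = ((d x : ℝ) : ℂ) • T x (ξ x) := by
  classical
  have hd2 : Measurable fun x => ENNReal.ofReal (d x ^ 2) := (hd.pow_const 2).ennreal_ofReal
  -- The key identity: `d² ⟪ξ, ξ'⟫ = ⟪Y ξ, Y ξ'⟫` almost everywhere.
  have hinner : ∀ {ξ ξ' η η'}, Y (R₁.bundle.toL2 R₁.μ ξ) = R₂.bundle.toL2 R₂.μ η →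
      Y (R₁.bundle.toL2 R₁.μ ξ') = R₂.bundle.toL2 R₂.μ η' →
      ∀ᵐ x ∂(R₂.essMeasure), ((d x ^ 2 : ℝ) : ℂ) * ⟪ξ x, ξ' x⟫_ℂ = ⟪η x, η' x⟫_ℂ := by
    intro ξ ξ' η η' h h'
    have e1 : ∀ k : X → ℂ, ∫ x, k x ∂(R₁.essMeasure) =
        ∫ x, ((d x ^ 2 : ℝ) : ℂ) * k x ∂(R₂.essMeasure) := by
      intro k
      rw [hden, integral_withDensity_eq_integral_toReal_smul hd2
        (Filter.Eventually.of_forall fun _ => ENNReal.ofReal_lt_top)]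
      refine integral_congr_ae (Filter.Eventually.of_forall fun x => ?_)
      simp [ENNReal.toReal_ofReal, sq_nonneg]
    have e2 : ∀ (R : GroupoidRep.{u, v, w} G X) (f : C₀(X, ℂ)) (ξ ξ' : R.bundle.L2Section R.μ),
        ∫ x, f x * ⟪ξ x, ξ' x⟫_ℂ ∂(R.essMeasure) = ∫ x, f x * ⟪ξ x, ξ' x⟫_ℂ ∂(R.μ) := by
      intro R f ξ ξ'
      refine setIntegral_eq_integral_of_forall_compl_eq_zero fun x hx => ?_
      rw [R.eq_of_notMem_nonzeroSet hx (ξ x) 0, inner_zero_left, mul_zero]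
    have i1 : Integrable (fun x => ((d x ^ 2 : ℝ) : ℂ) * ⟪ξ x, ξ' x⟫_ℂ) R₂.essMeasure := by
      have h1 : Integrable (fun x => ⟪ξ x, ξ' x⟫_ℂ) R₁.essMeasure :=
        (R₁.bundle.integrable_inner _ ξ ξ').restrict
      rw [hden, integrable_withDensity_iff_integrable_smul' hd2
        (Filter.Eventually.of_forall fun _ => ENNReal.ofReal_lt_top)] at h1
      refine h1.congr (Filter.Eventually.of_forall fun x => ?_)
      simp [ENNReal.toReal_ofReal, sq_nonneg]
    have i2 : Integrable (fun x => ⟪η x, η' x⟫_ℂ) R₂.essMeasure :=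
      (R₂.bundle.integrable_inner _ η η').restrict
    have h2 := ae_eq_zero_of_forall_integral_C0 (i1.sub i2) fun f => by
      simp only [Pi.sub_apply, mul_sub]
      rw [integral_sub (integrable_C0_mul f i1) (integrable_C0_mul f i2), sub_eq_zero, e2,
        ← integral_C0_mul_inner Y hY h h' f, ← e2, e1]
      refine integral_congr_ae (Filter.Eventually.of_forall fun x => ?_)
      simp only [mul_left_comm]
    filter_upwards [h2] with x hx
    exact sub_eq_zero.1 hx
  have hex : ∀ ξ, ∃ η, Y (R₁.bundle.toL2 R₁.μ ξ) = R₂.bundle.toL2 R₂.μ η := fun ξ => by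
    obtain ⟨η, hη⟩ := toL2_surjective (Y (R₁.bundle.toL2 R₁.μ ξ))
    exact ⟨η, hη.symm⟩
  have hex' : ∀ η, ∃ ξ, Y (R₁.bundle.toL2 R₁.μ ξ) = R₂.bundle.toL2 R₂.μ η := fun η => by
    obtain ⟨ξ, hξ⟩ := toL2_surjective (Y.symm (R₂.bundle.toL2 R₂.μ η))
    exact ⟨ξ, by rw [hξ, Y.apply_symm_apply]⟩
  obtain ⟨e, -, he⟩ := exists_total_l2 R₁.bundle R₁.μ
  obtain ⟨e', -, he'⟩ := exists_total_l2 R₂.bundle R₂.μ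
  choose τ hτ using fun n => hex (e n)
  choose σ hσ using fun n => hex' (e' n)
  -- `T x` is determined by `d x T x (e n x) = (Y e n) x`.
  let P : X → Prop := fun x => ∃ T : R₁.bundle.Fiber x →ₗᵢ[ℂ] R₂.bundle.Fiber x,
    ∀ n, T (e n x) = (((d x)⁻¹ : ℝ) : ℂ) • τ n x
  have hP : ∀ᵐ x ∂(R₂.essMeasure), P x := by
    filter_upwards [hdpos, ae_all_iff.2 fun n => ae_all_iff.2 fun m => hinner (hτ n) (hτ m)]
      with x h1 h2
    refine exists_linearIsometry_of_inner_eq _ _ (he x) fun n m => ?_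
    rw [inner_smul_left, inner_smul_right, ← h2, Complex.conj_ofReal, ← mul_assoc, ← mul_assoc,
      ← Complex.ofReal_mul, ← Complex.ofReal_mul]
    rw [show (d x)⁻¹ * (d x)⁻¹ * d x ^ 2 = 1 by field_simp, Complex.ofReal_one, one_mul]
  let T : ∀ x, R₁.bundle.Fiber x →L[ℂ] R₂.bundle.Fiber x := fun x =>
    if h : P x then h.choose.toContinuousLinearMap else 0
  have hT : ∀ x, P x → ∃ T' : R₁.bundle.Fiber x →ₗᵢ[ℂ] R₂.bundle.Fiber x,
      T x = T'.toContinuousLinearMap ∧ ∀ n, T' (e n x) = (((d x)⁻¹ : ℝ) : ℂ) • τ n x :=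
    fun x hx => ⟨hx.choose, dif_pos hx, hx.choose_spec⟩
  have hpair : ∀ ξ η, Y (R₁.bundle.toL2 R₁.μ ξ) = R₂.bundle.toL2 R₂.μ η →
        ∀ᵐ x ∂(R₂.essMeasure), η x = ((d x : ℝ) : ℂ) • T x (ξ x) := by
    intro ξ η h
    filter_upwards [hdpos, hP, hinner h h, ae_all_iff.2 fun n => hinner (hτ n) h] with x h1 h2 h3 h4
    obtain ⟨T', hTT', hT'⟩ := hT x h2
    have hdne : ((d x : ℝ) : ℂ) ≠ 0 := by exact_mod_cast h1.ne'
    rw [← inv_smul_eq_iff₀ hdne, hTT']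
    -- `d⁻¹ η` has the same norm as `ξ` and is mapped to it by the adjoint of the isometry `T'`, so it
    -- is `T' ξ`.
    have key : T'.toContinuousLinearMap.adjoint ((d x : ℂ)⁻¹ • η x) = ξ x := by
      rw [← sub_eq_zero]
      refine eq_zero_of_inner_total _ (he x) fun n => ?_
      rw [inner_sub_right, ContinuousLinearMap.adjoint_inner_right]
      change ⟪T' _, _⟫_ℂ - _ = 0
      rw [hT', inner_smul_left, inner_smul_right, ← h4, Complex.conj_ofReal, Complex.ofReal_inv,
        Complex.ofReal_pow]
      field_simp
      simp
    refine T'.eq_apply_of_inner ?_ ?_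
    · change ⟪T'.toContinuousLinearMap _, _⟫_ℂ = _
      rw [← ContinuousLinearMap.adjoint_inner_right, key]
    · rw [norm_smul, norm_inv, Complex.norm_real, Real.norm_of_nonneg h1.le,
        inv_mul_eq_iff_eq_mul₀ h1.ne', ← sq_eq_sq₀ (norm_nonneg _) (by positivity), mul_pow]
      rw [inner_self_eq_norm_sq_to_K, inner_self_eq_norm_sq_to_K] at h3
      have h5 : ((d x ^ 2 * ‖ξ x‖ ^ 2 : ℝ) : ℂ) = ((‖η x‖ ^ 2 : ℝ) : ℂ) := by
        rw [Complex.ofReal_mul, Complex.ofReal_pow ‖ξ x‖, Complex.ofReal_pow ‖η x‖]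
        exact h3
      exact (Complex.ofReal_injective h5).symm
  -- The range of `T x` contains a total family because `Y` is surjective.
  refine ⟨T, ?_, hpair⟩
  filter_upwards [hP, ae_all_iff.2 fun n => hpair _ _ (hσ n)] with x h1 h2
  obtain ⟨T', hTT', hT'⟩ := hT x h1
  rw [hTT']
  refine ⟨T'.norm_map, T'.surjective_of_total (fun n => e' n x) (he' x) fun n =>
    ⟨((d x : ℝ) : ℂ) • σ n x, ?_⟩⟩
  rw [_root_.map_smul, h2 n, hTT']
  rfl

/-- Representations with the same system of imprimitivity are equivalent. The unitary operator between
their `L²` spaces is fibrewise, and the two formulas for `U` show that the operators on the fibres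
intertwine the representations. -/
theorem IntegratesTo.rep_equivalent {R₁ R₂ : GroupoidRep.{u, v, w} G X}
    {S : SystemOfImprimitivity.{u, v, w'} G X} (h₁ : R₁.IntegratesTo S) (h₂ : R₂.IntegratesTo S) :
    R₁.Equivalent R₂ := by
  obtain ⟨r₁, hr₁⟩ := R₁.quasiInvariant.exists_isSqrtDensity
  obtain ⟨r₂, hr₂⟩ := R₂.quasiInvariant.exists_isSqrtDensity
  obtain ⟨W₁, hπ₁, hU₁⟩ := (integratesTo_iff hr₁).1 h₁
  obtain ⟨W₂, hπ₂, hU₂⟩ := (integratesTo_iff hr₂).1 h₂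
  let Y : R₁.bundle.L2 R₁.μ ≃ₗᵢ[ℂ] R₂.bundle.L2 R₂.μ := W₁.trans W₂.symm
  have hYiff : ∀ ξ η, Y (R₁.bundle.toL2 R₁.μ ξ) = R₂.bundle.toL2 R₂.μ η ↔
      W₁ (R₁.bundle.toL2 R₁.μ ξ) = W₂ (R₂.bundle.toL2 R₂.μ η) := fun ξ η =>
    W₂.symm_apply_eq
  have hY : ∀ (f : C₀(X, ℂ)) ξ η, Y (R₁.bundle.toL2 R₁.μ ξ) = R₂.bundle.toL2 R₂.μ η →
      Y (R₁.bundle.toL2 R₁.μ (c0Smul f ξ)) = R₂.bundle.toL2 R₂.μ (c0Smul f η) := by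
    intro f ξ η h
    rw [hYiff] at h ⊢
    rw [← hπ₁, ← hπ₂, h]
  have h21 := essMeasure_absolutelyContinuous Y hY
  have h12 : R₁.essMeasure ≪ R₂.essMeasure :=
    essMeasure_absolutelyContinuous Y.symm fun f η ξ h => by
      rw [LinearIsometryEquiv.symm_apply_eq] at h ⊢
      exact (hY f ξ η h.symm).symm
  obtain ⟨d, hd, hd0, hden, hdpos⟩ := exists_sqrt_density h12
  replace hdpos := hdpos h21
  obtain ⟨T, hT, hpair⟩ := exists_fiberwise Y hY hd hden hdpos
  have hr₁' := R₁.isSqrtDensity_essMeasure hr₁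
  have hr₂' := R₂.isSqrtDensity_essMeasure hr₂
  have hdc : Measurable fun x => ((d x : ℝ) : ℂ) := RCLike.measurable_ofReal.comp hd
  obtain ⟨e, -, he⟩ := exists_total_l2 R₁.bundle R₁.μ
  choose τ hτ using fun n => toL2_surjective (Y (R₁.bundle.toL2 R₁.μ (e n)))
  refine ⟨h12, h21, T, h12.ae_le hT, fun ξ hξ => ?_, fun η hη => ?_, h12.prod
    Measure.AbsolutelyContinuous.rfl |>.ae_le ?_⟩
  · obtain ⟨c, ξ', hc, hξ'⟩ := exists_smul_l2 R₁.μ hξ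
    obtain ⟨η, hη⟩ := toL2_surjective (Y (R₁.bundle.toL2 R₁.μ ξ'))
    refine ⟨fun x => ((c x * (d x)⁻¹ : ℝ) : ℂ) • η x,
      smul_mem_sections (RCLike.measurable_ofReal.comp (hc.mul hd.inv)) η.2.1, h12.ae_le ?_⟩
    filter_upwards [hdpos, hpair ξ' η hη.symm] with x h1 h2
    rw [hξ', _root_.map_smul, h2, smul_smul, ← Complex.ofReal_mul, mul_assoc,
      inv_mul_cancel₀ h1.ne', mul_one]
  · obtain ⟨c, η', hc, hη'⟩ := exists_smul_l2 R₂.μ hη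
    obtain ⟨ξ, hξ⟩ := toL2_surjective (Y.symm (R₂.bundle.toL2 R₂.μ η'))
    refine ⟨fun x => ((c x * d x : ℝ) : ℂ) • ξ x,
      smul_mem_sections (RCLike.measurable_ofReal.comp (hc.mul hd)) ξ.2.1, h12.ae_le ?_⟩
    filter_upwards [hpair ξ η' (by rw [hξ, Y.apply_symm_apply])] with x h2
    rw [hη', _root_.map_smul, h2, smul_smul, ← Complex.ofReal_mul]
  -- The intertwining property, first in terms of matrix coefficients, where it is measurable.
  have hcoef : ∀ n m, ∀ᵐ t ∂(R₂.essMeasure.prod (Measure.haar : Measure G)),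
      ⟪τ m (t.1 <• t.2), R₂.L (arrow t.1 t.2) (τ n t.1)⟫_ℂ =
        ((d t.1 : ℝ) : ℂ) * ((d (t.1 <• t.2) : ℝ) : ℂ) *
          ⟪e m (t.1 <• t.2), R₁.L (arrow t.1 t.2) (e n t.1)⟫_ℂ := by
    intro n m
    have hmeas : MeasurableSet {t : X × G |
      ⟪τ m (t.1 <• t.2), R₂.L (arrow t.1 t.2) (τ n t.1)⟫_ℂ =
        ((d t.1 : ℝ) : ℂ) * ((d (t.1 <• t.2) : ℝ) : ℂ) *
          ⟪e m (t.1 <• t.2), R₁.L (arrow t.1 t.2) (e n t.1)⟫_ℂ} :=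
      measurableSet_eq_fun (R₂.measurable_coeff _ (τ n).2.1 _ (τ m).2.1)
        (((hdc.comp measurable_fst).mul (hdc.comp (measurable_rsmul G X))).mul
          (R₁.measurable_coeff _ (e n).2.1 _ (e m).2.1))
    refine (Measure.ae_prod_iff_ae_ae hmeas).2 ((Measure.ae_ae_comm hmeas).2 ?_)
    filter_upwards [hU₁, hU₂] with g h1 h2
    have h3 := hpair (R₁.translate hr₁ g (e m)) (R₂.translate hr₂ g (τ m)) (by
      rw [hYiff, ← h1, ← h2, (hYiff _ _).1 (hτ m).symm])
    filter_upwards [h3, hpair _ _ (hτ n).symm, hT,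
      IsSqrtDensity.ae_mul_eq_of_withDensity hd hd0 hden hr₂' hr₁' g] with x k1 k2 k3 k4
    have k5 : (R₂.L (arrow x g)).symm (τ m (x <• g)) =
        ((d (x <• g) : ℝ) : ℂ) • T x ((R₁.L (arrow x g)).symm (e m (x <• g))) := by
      have hne : ((r₂ (x, g) : ℝ) : ℂ) ≠ 0 := by exact_mod_cast (hr₂.pos _).ne'
      rw [translate_apply, translate_apply, _root_.map_smul, smul_smul, ← Complex.ofReal_mul, k4,
        Complex.ofReal_mul, mul_smul] at k1
      exact smul_right_injective _ hne k1
    let T' : R₁.bundle.Fiber x →ₗᵢ[ℂ] R₂.bundle.Fiber x := ⟨(T x).toLinearMap, k3.1⟩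
    rw [← (R₂.L (arrow x g)).symm.inner_map_map, LinearIsometryEquiv.symm_apply_apply, k5, k2,
      inner_smul_left, inner_smul_right, Complex.conj_ofReal,
      ← (R₁.L (arrow x g)).symm.inner_map_map, LinearIsometryEquiv.symm_apply_apply,
      ← T'.inner_map_map]
    change _ * (_ * ⟪T x _, T x _⟫_ℂ) = _ * ⟪T x _, T x _⟫_ℂ
    ring
  have hTτ : ∀ᵐ x ∂(R₂.essMeasure), (∀ n, τ n x = ((d x : ℝ) : ℂ) • T x (e n x)) ∧ 0 < d x ∧
      (∀ v, ‖T x v‖ = ‖v‖) ∧ Function.Surjective (T x) := by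
    filter_upwards [ae_all_iff.2 fun n => hpair _ _ (hτ n).symm, hdpos, hT] with x k1 k2 k3
    exact ⟨k1, k2, k3⟩
  filter_upwards [ae_all_iff.2 fun n => ae_all_iff.2 fun m => hcoef n m, R₂.ae_prod_of_ae hTτ,
    R₂.ae_target hTτ] with t k1 h2 h3
  obtain ⟨x, g⟩ := t
  obtain ⟨k2, k3, k4, -⟩ := h2
  obtain ⟨k5, k6, k7, k8⟩ := h3
  dsimp only at k1 k2 k3 k4 k5 k6 k7 k8 ⊢
  let T' : R₁.bundle.Fiber (x <• g) →ₗᵢ[ℂ] R₂.bundle.Fiber (x <• g) := ⟨(T (x <• g)).toLinearMap, k7⟩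
  have hext : (T (x <• g)).comp (R₁.L (arrow x g)).toLinearIsometry.toContinuousLinearMap =
      ((R₂.L (arrow x g)).toLinearIsometry.toContinuousLinearMap).comp (T x) := by
    refine ContinuousLinearMap.ext_on (s := Set.range fun n => e n x)
      (Submodule.dense_iff_topologicalClosure_eq_top.2 (he x)) ?_
    rintro _ ⟨n, rfl⟩
    change T (x <• g) (R₁.L (arrow x g) (e n x)) = R₂.L (arrow x g) (T x (e n x))
    obtain ⟨w, hw⟩ := k8 (R₂.L (arrow x g) (T x (e n x)))
    rw [← hw]
    congr 1
    rw [← sub_eq_zero]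
    refine eq_zero_of_inner_total _ (he (x <• g)) fun m => ?_
    have k9 := k1 n m
    have hdd : ((d x : ℝ) : ℂ) * ((d (x <• g) : ℝ) : ℂ) ≠ 0 := by
      exact_mod_cast (mul_pos k3 k6).ne'
    rw [k2, k5, _root_.map_smul, ← hw, inner_smul_left, inner_smul_right, Complex.conj_ofReal,
      ← mul_assoc, mul_comm ((d (x <• g) : ℝ) : ℂ)] at k9
    rw [inner_sub_right, ← mul_left_cancel₀ hdd k9, sub_eq_zero]
    exact T'.inner_map_map _ _
  exact fun v => DFunLike.congr_fun hext v

end Injectivity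

end GroupoidRep

/-! ### The spectral theorem for representations of `C₀(X)` -/

section Spectral

open scoped CompactlySupported ENNReal

variable {X : Type u} [TopologicalSpace X] [LocallyCompactSpace X] [T2Space X]
  {H : Type*} [NormedAddCommGroup H] [InnerProductSpace ℂ H] [CompleteSpace H]

omit [T2Space X] in
lemma ZeroAtInftyContinuousMap.exists_hasCompactSupport_norm_sub_le [R1Space X] (f : C₀(X, ℂ))
    {ε : ℝ} (hε : 0 < ε) : ∃ g : C₀(X, ℂ), HasCompactSupport g ∧ ‖f - g‖ ≤ ε := by
  have h := (zero_at_infty f).norm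
  rw [norm_zero] at h
  obtain ⟨K, hK, hKf⟩ := Filter.mem_cocompact.1 (h.eventually (gt_mem_nhds hε))
  obtain ⟨φ, h1, h2, -, h3⟩ := exists_continuousMap_one_of_isCompact_subset_isOpen hK isOpen_univ
    (Set.subset_univ _)
  have hcs : HasCompactSupport fun x => (φ x : ℂ) * f x :=
    (HasCompactSupport.comp_left (g := fun t : ℝ => (t : ℂ)) h2 (by simp)).mul_right
  refine ⟨⟨⟨fun x => (φ x : ℂ) * f x, by fun_prop⟩, hcs.is_zero_at_infty⟩, hcs, ?_⟩
  rw [← ZeroAtInftyContinuousMap.norm_toBCF_eq_norm, BoundedContinuousFunction.norm_le hε.le]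
  intro x
  change ‖f x - (φ x : ℂ) * f x‖ ≤ ε
  by_cases hx : x ∈ K
  · simp [h1 hx, hε.le]
  · have h4 : f x - (φ x : ℂ) * f x = ((1 - φ x : ℝ) : ℂ) * f x := by push_cast; ring
    rw [h4, norm_mul, Complex.norm_real, Real.norm_of_nonneg (sub_nonneg.2 (h3 x).2)]
    exact (mul_le_of_le_one_left (norm_nonneg _) (by linarith [(h3 x).1])).trans (hKf hx).le

lemma inner_map_star (π : C₀(X, ℂ) →⋆ₙₐ[ℂ] (H →L[ℂ] H)) (f : C₀(X, ℂ)) (v w : H) :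
    ⟪π (star f) v, w⟫_ℂ = ⟪v, π f w⟫_ℂ := by
  rw [map_star, ContinuousLinearMap.star_eq_adjoint, ContinuousLinearMap.adjoint_inner_left]

lemma map_mul_apply (π : C₀(X, ℂ) →⋆ₙₐ[ℂ] (H →L[ℂ] H)) (f g : C₀(X, ℂ)) (v : H) :
    π (f * g) v = π f (π g v) := by
  rw [map_mul]
  rfl

lemma norm_map_apply_le (π : C₀(X, ℂ) →⋆ₙₐ[ℂ] (H →L[ℂ] H)) (f : C₀(X, ℂ)) (v : H) :
    ‖π f v‖ ≤ ‖f‖ * ‖v‖ :=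
  (ContinuousLinearMap.le_opNorm _ _).trans
    (mul_le_mul_of_nonneg_right (NonUnitalStarAlgHom.norm_apply_le π f) (norm_nonneg v))

variable [MeasurableSpace X] [BorelSpace X]

/-- The spectral measure of a vector, from the Riesz–Markov–Kakutani theorem. -/
lemma exists_spectralMeasure [SecondCountableTopology X] (π : C₀(X, ℂ) →⋆ₙₐ[ℂ] (H →L[ℂ] H))
    (v : H) : ∃ μ : Measure X, IsFiniteMeasure μ ∧ ∀ f : C₀(X, ℂ), ∫ x, f x ∂μ = ⟪v, π f v⟫_ℂ := by
  have hadd : ∀ f g : C_c(X, ℝ), (f + g).toC0 = f.toC0 + g.toC0 := fun f g => by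
    ext x; simp
  have hsmul : ∀ (c : ℝ) (f : C_c(X, ℝ)), (c • f).toC0 = (c : ℂ) • f.toC0 := fun c f => by
    ext x; simp
  have hnorm : ∀ f : C₀(X, ℂ), ‖⟪v, π f v⟫_ℂ‖ ≤ ‖f‖ * ‖v‖ ^ 2 := fun f => by
    refine (norm_inner_le_norm _ _).trans ?_
    nlinarith [norm_map_apply_le π f v, norm_nonneg v]
  let Λ : C_c(X, ℝ) →ₚ[ℝ] ℝ := PositiveLinearMap.mk₀
    { toFun := fun f => RCLike.re ⟪v, π f.toC0 v⟫_ℂ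
      map_add' := fun f g => by rw [hadd, map_add, add_apply, inner_add_right, map_add]
      map_smul' := fun c f => by
        rw [hsmul, map_smul, smul_apply, inner_smul_right, RingHom.id_apply, smul_eq_mul]
        exact RCLike.re_ofReal_mul _ _ } fun f hf => by
      let s : C₀(X, ℂ) := ⟨⟨fun x => (√(f x) : ℂ), by fun_prop⟩,
        (f.hasCompactSupport.comp_left (g := fun t : ℝ => ((√t : ℝ) : ℂ)) (by simp)).is_zero_at_infty⟩
      have hs : f.toC0 = star s * s := by
        ext x
        change ((f x : ℝ) : ℂ) = starRingEnd ℂ ((√(f x) : ℝ) : ℂ) * ((√(f x) : ℝ) : ℂ)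
        rw [Complex.conj_ofReal, ← Complex.ofReal_mul, Real.mul_self_sqrt (hf x)]
      change 0 ≤ RCLike.re ⟪v, π f.toC0 v⟫_ℂ
      rw [hs, map_mul_apply, ← inner_map_star, star_star]
      exact inner_self_nonneg
  have hΛ : ∀ f : C_c(X, ℝ), ∫ x, (f x : ℂ) ∂(RealRMK.rieszMeasure Λ) = ⟪v, π f.toC0 v⟫_ℂ := by
    intro f
    rw [integral_complex_ofReal, RealRMK.integral_rieszMeasure]
    change ((RCLike.re ⟪v, π f.toC0 v⟫_ℂ : ℝ) : ℂ) = _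
    refine RCLike.conj_eq_iff_re.1 ?_
    rw [inner_conj_symm, ← inner_map_star]
    congr 3
    ext x
    exact (Complex.conj_ofReal _).symm
  have hcpt : ∀ K : Set X, IsCompact K → RealRMK.rieszMeasure Λ K ≤ ENNReal.ofReal (‖v‖ ^ 2) := by
    intro K hK
    obtain ⟨φ, h1, h2, -, h3⟩ := exists_continuousMap_one_of_isCompact_subset_isOpen hK isOpen_univ
      (Set.subset_univ _)
    let φ' : C_c(X, ℝ) := ⟨φ, h2⟩
    refine (RealRMK.rieszMeasure_le_of_eq_one Λ (f := φ') (fun x => (h3 x).1) hK h1).trans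
      (ENNReal.ofReal_le_ofReal ?_)
    refine (RCLike.re_le_norm _).trans ((hnorm _).trans
      (mul_le_of_le_one_left (sq_nonneg _) ?_))
    rw [← ZeroAtInftyContinuousMap.norm_toBCF_eq_norm, BoundedContinuousFunction.norm_le zero_le_one]
    intro x
    change ‖((φ x : ℝ) : ℂ)‖ ≤ 1
    rw [Complex.norm_real, Real.norm_of_nonneg (h3 x).1]
    exact (h3 x).2
  have hfin : IsFiniteMeasure (RealRMK.rieszMeasure Λ) := by
    refine ⟨lt_of_le_of_lt ?_ (ENNReal.ofReal_lt_top (r := ‖v‖ ^ 2))⟩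
    rw [← iUnion_compactCovering X,
      Monotone.measure_iUnion fun m n h => compactCovering_subset X h]
    exact iSup_le fun n => hcpt _ (isCompact_compactCovering X n)
  refine ⟨RealRMK.rieszMeasure Λ, hfin, fun f => ?_⟩
  have hc : ∀ g : C₀(X, ℂ), HasCompactSupport g →
      ∫ x, g x ∂(RealRMK.rieszMeasure Λ) = ⟪v, π g v⟫_ℂ := by
    intro g hg
    let a : C_c(X, ℝ) := ⟨⟨fun x => (g x).re, by fun_prop⟩, hg.comp_left (g := Complex.re) rfl⟩
    let b : C_c(X, ℝ) := ⟨⟨fun x => (g x).im, by fun_prop⟩, hg.comp_left (g := Complex.im) rfl⟩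
    have hab : g = a.toC0 + Complex.I • b.toC0 := by
      ext x
      change g x = ((g x).re : ℂ) + Complex.I * ((g x).im : ℂ)
      rw [mul_comm, Complex.re_add_im]
    have hi : ∀ c : C_c(X, ℝ), Integrable (fun x => (c x : ℂ)) (RealRMK.rieszMeasure Λ) :=
      fun c => (c.continuous.integrable_of_hasCompactSupport c.hasCompactSupport).ofReal
    rw [hab, map_add, map_smul, add_apply, smul_apply, inner_add_right, inner_smul_right, ← hΛ,
      ← hΛ, ← integral_const_mul, ← integral_add (hi a) ((hi b).const_mul _)]
    rfl
  have hint : ∀ g : C₀(X, ℂ), Integrable g (RealRMK.rieszMeasure Λ) := fun g =>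
    (integrable_C0_mul g (integrable_const (1 : ℂ))).congr
      (Filter.Eventually.of_forall fun x => mul_one _)
  rw [← sub_eq_zero, ← norm_le_zero_iff]
  refine le_of_forall_pos_le_add fun ε hε => ?_
  let C := (RealRMK.rieszMeasure Λ).real Set.univ + ‖v‖ ^ 2 + 1
  have hC : 0 < C := by positivity
  obtain ⟨g, hg, hfg⟩ := f.exists_hasCompactSupport_norm_sub_le (div_pos hε hC)
  have h1 : ∫ x, f x ∂(RealRMK.rieszMeasure Λ) - ⟪v, π f v⟫_ℂ =
      ∫ x, (f - g) x ∂(RealRMK.rieszMeasure Λ) - ⟪v, π (f - g) v⟫_ℂ := by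
    have h2 : ∫ x, (f - g) x ∂(RealRMK.rieszMeasure Λ) =
        ∫ x, f x ∂(RealRMK.rieszMeasure Λ) - ∫ x, g x ∂(RealRMK.rieszMeasure Λ) :=
      integral_sub (hint f) (hint g)
    rw [h2, map_sub, sub_apply, inner_sub_right, hc g hg]
    ring
  rw [h1, zero_add]
  have h3 : ‖∫ x, (f - g) x ∂(RealRMK.rieszMeasure Λ)‖ ≤
      ‖f - g‖ * (RealRMK.rieszMeasure Λ).real Set.univ :=
    norm_integral_le_of_norm_le_const (Filter.Eventually.of_forall fun x =>
      (f - g).toBCF.norm_coe_le_norm x)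
  calc _ ≤ ‖f - g‖ * (RealRMK.rieszMeasure Λ).real Set.univ + ‖f - g‖ * ‖v‖ ^ 2 :=
        (norm_sub_le _ _).trans (add_le_add h3 (hnorm _))
    _ ≤ ‖f - g‖ * C := by
        simp only [C]
        nlinarith [norm_nonneg (f - g)]
    _ ≤ ε / C * C := by gcongr
    _ = ε := div_mul_cancel₀ _ hC.ne'

/-- Multiplication by a function vanishing at infinity, as an operator on `L²`. -/
lemma exists_c0Mul_Lp (μ : Measure X) (f : C₀(X, ℂ)) :
    ∃ M : Lp Ell2.{w} 2 μ →L[ℂ] Lp Ell2.{w} 2 μ, ∀ φ, ∀ᵐ x ∂μ, M φ x = f x • φ x := by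
  have hm : ∀ φ : Lp Ell2.{w} 2 μ, MemLp (fun x => f x • φ x) 2 μ := fun φ => by
    refine (Lp.memLp φ).of_le_mul (c := ‖f‖)
      ((map_continuous f).measurable.aestronglyMeasurable.smul (Lp.aestronglyMeasurable φ))
      (Filter.Eventually.of_forall fun x => ?_)
    rw [norm_smul]
    gcongr
    exact f.toBCF.norm_coe_le_norm x
  refine ⟨LinearMap.mkContinuous
    { toFun := fun φ => (hm φ).toLp _
      map_add' := fun φ ψ => by
        rw [← MemLp.toLp_add]
        refine MemLp.toLp_congr _ _ ?_
        filter_upwards [Lp.coeFn_add φ ψ] with x hx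
        rw [hx, Pi.add_apply, Pi.add_apply, smul_add]
      map_smul' := fun c φ => by
        rw [RingHom.id_apply, ← MemLp.toLp_const_smul]
        refine MemLp.toLp_congr _ _ ?_
        filter_upwards [Lp.coeFn_smul c φ] with x hx
        rw [hx, Pi.smul_apply, Pi.smul_apply, smul_comm] } ‖f‖ fun φ => ?_, fun φ => (hm φ).coeFn_toLp⟩
  refine Lp.norm_le_mul_norm_of_ae_le_mul ?_
  filter_upwards [(hm φ).coeFn_toLp] with x hx
  change ‖(hm φ).toLp _ x‖ ≤ _
  rw [hx, norm_smul]
  gcongr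
  exact f.toBCF.norm_coe_le_norm x

omit [MeasurableSpace X] [BorelSpace X] in
/-- A separable nondegenerate representation of `C₀(X)` is an orthogonal sum of countably many
cyclic representations. -/
lemma exists_orthogonal_generators [TopologicalSpace.SeparableSpace H]
    (π : C₀(X, ℂ) →⋆ₙₐ[ℂ] (H →L[ℂ] H))
    (hπ : (Submodule.span ℂ {v : H | ∃ f : C₀(X, ℂ), ∃ w : H, π f w = v}).topologicalClosure = ⊤) :
    ∃ v : ℕ → H, (∀ n m, n ≠ m → ∀ f g, ⟪π f (v n), π g (v m)⟫_ℂ = 0) ∧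
      (Submodule.span ℂ (Set.range fun p : C₀(X, ℂ) × ℕ => π p.1 (v p.2))).topologicalClosure = ⊤ := by
  -- `Z n` is the subrepresentation generated by the first `n` vectors of a dense sequence, and `v n`
  -- is the component of `e n` orthogonal to it.
  let e : ℕ → H := TopologicalSpace.denseSeq H
  let Z : ℕ → Submodule ℂ H := fun n =>
    (Submodule.span ℂ {w | ∃ f : C₀(X, ℂ), ∃ i < n, π f (e i) = w}).topologicalClosure
  have hZle : ∀ {n} {M : Submodule ℂ H}, IsClosed (M : Set H) → (∀ f, ∀ i < n, π f (e i) ∈ M) →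
      Z n ≤ M := by
    intro n M hM h
    refine Submodule.topologicalClosure_minimal _ (Submodule.span_le.2 ?_) hM
    rintro _ ⟨f, i, hi, rfl⟩
    exact h f i hi
  have hZmem : ∀ {n i} (f : C₀(X, ℂ)), i < n → π f (e i) ∈ Z n := fun f hi =>
    Submodule.le_topologicalClosure _ (Submodule.subset_span ⟨f, _, hi, rfl⟩)
  have hZcl : ∀ n, IsClosed (Z n : Set H) := fun n => Submodule.isClosed_topologicalClosure _
  have hZinv : ∀ {n w} (f : C₀(X, ℂ)), w ∈ Z n → π f w ∈ Z n := by
    intro n w f hw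
    refine hZle (M := (Z n).comap (π f).toLinearMap) ((hZcl n).preimage (π f).continuous)
      (fun g i hi => ?_) hw
    change π f (π g (e i)) ∈ Z n
    rw [← map_mul_apply]
    exact hZmem _ hi
  let p : ℕ → H := fun n => (Z n).starProjection (e n)
  have hp : ∀ n, p n ∈ Z n := fun n => Submodule.starProjection_apply_mem _ _
  let v : ℕ → H := fun n => e n - p n
  have hv : ∀ n, ∀ w ∈ Z n, ⟪w, v n⟫_ℂ = 0 := fun n =>
    (Submodule.mem_orthogonal _ _).1 (Submodule.sub_starProjection_mem_orthogonal _)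
  have hvZ : ∀ {m n} (f : C₀(X, ℂ)), m < n → π f (v m) ∈ Z n := by
    intro m n f hmn
    rw [map_sub]
    refine (Z n).sub_mem (hZmem f hmn) ?_
    exact hZle (hZcl n) (fun g i hi => hZmem g (hi.trans hmn)) (hZinv f (hp m))
  have hlt : ∀ m n, m < n → ∀ f g, ⟪π f (v m), π g (v n)⟫_ℂ = 0 := by
    intro m n hmn f g
    rw [← inner_map_star, ← map_mul_apply]
    exact hv n _ (hvZ _ hmn)
  refine ⟨v, fun n m hnm f g => ?_, ?_⟩
  · rcases lt_or_gt_of_ne hnm with h | h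
    · exact hlt _ _ h f g
    · rw [← inner_conj_symm, hlt _ _ h, map_zero]
  · set M := (Submodule.span ℂ (Set.range fun p : C₀(X, ℂ) × ℕ => π p.1 (v p.2))).topologicalClosure
    have hMcl : IsClosed (M : Set H) := Submodule.isClosed_topologicalClosure _
    have hMv : ∀ f n, π f (v n) ∈ M := fun f n =>
      Submodule.le_topologicalClosure _ (Submodule.subset_span ⟨(f, n), rfl⟩)
    have hMe : ∀ n f, π f (e n) ∈ M := by
      intro n
      induction n using Nat.strong_induction_on with
      | _ n ih =>
        intro f
        have h1 : π f (e n) = π f (v n) + π f (p n) := by rw [← map_add, sub_add_cancel]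
        rw [h1]
        exact M.add_mem (hMv f n) (hZle hMcl (fun g i hi => ih i hi g) (hZinv f (hp n)))
    rw [eq_top_iff, ← hπ]
    refine Submodule.topologicalClosure_minimal _ (Submodule.span_le.2 ?_) hMcl
    rintro _ ⟨f, w, rfl⟩
    have hd : Dense (Set.range e) := TopologicalSpace.denseRange_denseSeq H
    exact hd.induction (P := fun w => π f w ∈ M) (by rintro _ ⟨n, rfl⟩; exact hMe n f)
      (hMcl.preimage (π f).continuous) w

/-- **Spectral theorem.** A separable nondegenerate representation of `C₀(X)` is a
subrepresentation of the representation by multiplication operators on `L²(μ, ℓ²)`, for some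
probability measure `μ` all of whose points are seen by the representation. -/
theorem exists_spectral_embedding [SecondCountableTopology X] [TopologicalSpace.SeparableSpace H]
    [Nontrivial H] (π : C₀(X, ℂ) →⋆ₙₐ[ℂ] (H →L[ℂ] H))
    (hπ : (Submodule.span ℂ {v : H | ∃ f : C₀(X, ℂ), ∃ w : H, π f w = v}).topologicalClosure = ⊤) :
    ∃ (μ : Measure X) (J : H →ₗᵢ[ℂ] Lp Ell2.{w} 2 μ), IsProbabilityMeasure μ ∧
      (∀ f v, ∀ᵐ x ∂μ, J (π f v) x = f x • J v x) ∧
      ∀ N, MeasurableSet N → (∀ v, ∀ᵐ x ∂μ, x ∈ N → J v x = 0) → μ N = 0 := by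
  classical
  obtain ⟨v, hv, ht⟩ := exists_orthogonal_generators π hπ
  choose ν hνfin hν using fun n => exists_spectralMeasure π (v n)
  let μ : Measure X := (Measure.sum ν).toFinite
  have hνμ : ∀ n, ν n ≪ μ := fun n =>
    (Measure.absolutelyContinuous_sum_right n Measure.AbsolutelyContinuous.rfl).trans
      (absolutelyContinuous_toFinite _)
  have hinner : ∀ n f g, ⟪π f (v n), π g (v n)⟫_ℂ = ∫ x, (starRingEnd ℂ) (f x) * g x ∂(ν n) := by
    intro n f g
    rw [← star_star f, inner_map_star, ← map_mul_apply, ← hν]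
    simp
  have hne : Measure.sum ν ≠ 0 := by
    intro h0
    obtain ⟨w, hw⟩ := exists_ne (0 : H)
    refine hw (eq_zero_of_inner_total _ ht fun p => ?_)
    have h1 : ν p.2 = 0 := (Measure.sum_eq_zero.1 h0) p.2
    have h2 := hinner p.2 p.1 p.1
    rw [h1, integral_zero_measure, inner_self_eq_zero] at h2
    rw [h2, inner_zero_left]
  have : NeZero (Measure.sum ν) := ⟨hne⟩
  have hprob : IsProbabilityMeasure μ := inferInstanceAs (IsProbabilityMeasure (Measure.toFinite _))
  choose d hd _ hden _ using fun n => exists_sqrt_density (hνμ n)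
  have hd2 : ∀ n, Measurable fun x => ENNReal.ofReal (d n x ^ 2) := fun n =>
    ((hd n).pow_const 2).ennreal_ofReal
  have hdi : ∀ n, Integrable (fun x => d n x ^ 2) μ := by
    intro n
    refine ⟨((hd n).pow_const 2).aestronglyMeasurable, ?_⟩
    have h1 := measure_lt_top (ν n) Set.univ
    rw [hden, withDensity_apply _ MeasurableSet.univ, setLIntegral_univ] at h1
    rw [hasFiniteIntegral_iff_ofReal (Filter.Eventually.of_forall fun x => sq_nonneg _)]
    exact h1
  have hdm : ∀ n, MemLp (d n) 2 μ := fun n =>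
    (memLp_two_iff_integrable_sq (hd n).aestronglyMeasurable).2 (hdi n)
  let δ : ℕ → Ell2.{w} := fun n => lp.single 2 ⟨n⟩ (1 : ℂ)
  have hδ : ∀ n m, ⟪δ n, δ m⟫_ℂ = if n = m then 1 else 0 := by
    intro n m
    rw [lp.inner_single_left]
    by_cases h : n = m
    · subst h; simp [δ]
    · simp [δ, h]
  -- The vector `π(f) vₙ` is mapped to the function `f dₙ δₙ`.
  have hb : ∀ p : C₀(X, ℂ) × ℕ, MemLp (fun x => (p.1 x * (d p.2 x : ℂ)) • δ p.2) 2 μ := by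
    rintro ⟨f, n⟩
    refine ((hdm n).norm.const_mul (‖f‖ * ‖δ n‖)).mono
      (((map_continuous f).measurable.mul
        (RCLike.measurable_ofReal.comp (hd n))).smul_const _).aestronglyMeasurable
      (Filter.Eventually.of_forall fun x => ?_)
    rw [norm_smul, norm_mul, Complex.norm_real, norm_mul, norm_norm, norm_mul, norm_norm, norm_norm]
    have := f.toBCF.norm_coe_le_norm x
    calc ‖f x‖ * ‖d n x‖ * ‖δ n‖ ≤ ‖f‖ * ‖d n x‖ * ‖δ n‖ := by gcongr; exact this
      _ = ‖f‖ * ‖δ n‖ * ‖d n x‖ := by ring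
  -- The `n`th cyclic summand is `L²(ν n)`; it is put into the `n`th coordinate of `ℓ²`, and `d n` is
  -- the square root of the density of `ν n`.
  obtain ⟨J, hJ⟩ := exists_linearIsometry_of_inner_eq
    (fun p : C₀(X, ℂ) × ℕ => π p.1 (v p.2)) (fun p => (hb p).toLp _) ht (by
      rintro ⟨f, n⟩ ⟨g, m⟩
      rw [L2.inner_def]
      have h1 : ∀ᵐ x ∂μ, ⟪(hb (f, n)).toLp _ x, (hb (g, m)).toLp _ x⟫_ℂ =
          if n = m then ((d n x ^ 2 : ℝ) : ℂ) * ((starRingEnd ℂ) (f x) * g x) else 0 := by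
        filter_upwards [(hb (f, n)).coeFn_toLp, (hb (g, m)).coeFn_toLp] with x h1 h2
        rw [h1, h2, inner_smul_left, inner_smul_right, hδ]
        split_ifs with h
        · subst h
          rw [map_mul, Complex.conj_ofReal]
          push_cast
          ring
        · simp
      rw [integral_congr_ae h1]
      by_cases h : n = m
      · subst h
        simp only [if_true]
        rw [hinner, hden, integral_withDensity_eq_integral_toReal_smul (hd2 n)
          (Filter.Eventually.of_forall fun _ => ENNReal.ofReal_lt_top)]
        refine integral_congr_ae (Filter.Eventually.of_forall fun x => ?_)
        simp [ENNReal.toReal_ofReal, sq_nonneg]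
      · simp only [if_neg h, integral_zero]
        exact (hv n m h f g).symm)
  have hJae : ∀ f n, ∀ᵐ x ∂μ, J (π f (v n)) x = (f x * (d n x : ℂ)) • δ n := fun f n => by
    rw [hJ (f, n)]
    exact (hb (f, n)).coeFn_toLp
  refine ⟨μ, J, hprob, fun f w => ?_, fun N hN h => ?_⟩
  · obtain ⟨M, hM⟩ := exists_c0Mul_Lp.{u, w} μ f
    have hext : J.toContinuousLinearMap.comp (π f) = M.comp J.toContinuousLinearMap := by
      refine ContinuousLinearMap.ext_on (Submodule.dense_iff_topologicalClosure_eq_top.2 ht) ?_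
      rintro _ ⟨⟨g, n⟩, rfl⟩
      change J (π f (π g (v n))) = M (J (π g (v n)))
      rw [← map_mul_apply]
      refine Lp.ext ?_
      filter_upwards [hJae (f * g) n, hJae g n, hM (J (π g (v n)))] with x h1 h2 h3
      rw [h1, h3, h2, smul_smul, ← mul_assoc]
      rfl
    have h1 : J (π f w) = M (J w) := DFunLike.congr_fun hext w
    rw [h1]
    exact hM _
  · refine toFinite_absolutelyContinuous _ ?_
    rw [Measure.sum_apply _ hN, ENNReal.tsum_eq_zero]
    intro n
    have h1 : (N.indicator fun x => (d n x : ℂ)) =ᵐ[μ] 0 := by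
      refine ae_eq_zero_of_forall_integral_C0
        (((hdm n).integrable (by norm_num)).ofReal.indicator hN) fun f => ?_
      refine integral_eq_zero_of_ae ?_
      filter_upwards [h (π f (v n)), hJae f n] with x h1 h2
      by_cases hx : x ∈ N
      · have h3 : δ n ≠ 0 := fun h0 => by simpa [h0] using hδ n n
        rw [Set.indicator_of_mem hx]
        exact (smul_eq_zero.1 (h2.symm.trans (h1 hx))).resolve_right h3
      · rw [Set.indicator_of_notMem hx, mul_zero, Pi.zero_apply]
    rw [hden, withDensity_apply _ hN, setLIntegral_eq_zero_iff hN (hd2 n)]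
    filter_upwards [h1] with x hx hxN
    rw [Set.indicator_of_mem hxN, Pi.zero_apply, Complex.ofReal_eq_zero] at hx
    simp [hx]

end Spectral

/-! ### Strict representations from coefficient fields -/

section TestFunctions

variable (G : Type v) [Group G] [TopologicalSpace G] [IsTopologicalGroup G]
  [LocallyCompactSpace G] [MeasurableSpace G] [BorelSpace G]

/-- The measurable integrable functions on a locally compact group. -/
def TestFn : Type v := {F : G → ℂ // Measurable F ∧ Integrable F (Measure.haar : Measure G)}

variable {G}

instance : CoeFun (TestFn G) fun _ => G → ℂ := ⟨fun F => F.1⟩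

/-- The left translate `g ↦ F (a g)`. -/
def TestFn.shift (a : G) (F : TestFn G) : TestFn G :=
  ⟨fun g => F (a * g), F.2.1.comp (measurable_const_mul a), F.2.2.comp_mul_left a⟩

@[simp]
lemma TestFn.shift_apply (a : G) (F : TestFn G) (g : G) : F.shift a g = F (a * g) := rfl

lemma TestFn.shift_one (F : TestFn G) : F.shift 1 = F :=
  Subtype.ext (funext fun g => congrArg F.1 (one_mul g))

lemma TestFn.shift_shift (a b : G) (F : TestFn G) : (F.shift a).shift b = F.shift (a * b) :=
  Subtype.ext (funext fun g => congrArg F.1 (mul_assoc a b g).symm)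

/-- The integrable functions form a separable space. -/
lemma TestFn.exists_dense [SecondCountableTopology G] :
    ∃ D : ℕ → TestFn G, ∀ (F : TestFn G) (ε : ℝ), 0 < ε →
      ∃ k, ∫ g, ‖F g - D k g‖ ∂(Measure.haar : Measure G) < ε := by
  have : Fact ((1 : ENNReal) ≠ ⊤) := ⟨by simp⟩
  let d : ℕ → Lp ℂ 1 (Measure.haar : Measure G) := TopologicalSpace.denseSeq _
  refine ⟨fun k => ⟨d k, (Lp.stronglyMeasurable _).measurable, L1.integrable_coeFn _⟩,
    fun F ε hε => ?_⟩
  obtain ⟨k, hk⟩ := (TopologicalSpace.denseRange_denseSeq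
    (Lp ℂ 1 (Measure.haar : Measure G))).exists_dist_lt (F.2.2.toL1 F) hε
  refine ⟨k, lt_of_eq_of_lt ?_ hk⟩
  rw [dist_eq_norm, L1.norm_eq_integral_norm]
  refine integral_congr_ae ?_
  filter_upwards [Lp.coeFn_sub (F.2.2.toL1 F) (d k), F.2.2.coeFn_toL1] with g h1 h2
  change _ = ‖(F.2.2.toL1 F - d k : Lp ℂ 1 (Measure.haar : Measure G)) g‖
  rw [h1, Pi.sub_apply, h2]

end TestFunctions

lemma measurableSet_ae_section {α β : Type*} [MeasurableSpace α] [MeasurableSpace β]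
    {ν : Measure β} [SFinite ν] {p : α → β → Prop}
    (hp : MeasurableSet {t : α × β | p t.1 t.2}) : MeasurableSet {a | ∀ᵐ b ∂ν, p a b} :=
  measurable_measure_prodMk_left hp.compl (measurableSet_singleton 0)

section CoefficientField

variable {X : Type u} {G : Type v}
    [Group G] [TopologicalSpace G] [IsTopologicalGroup G] [LocallyCompactSpace G] [T2Space G]
    [SecondCountableTopology G] [MeasurableSpace G] [BorelSpace G]
    [TopologicalSpace X] [LocallyCompactSpace X] [T2Space X] [SecondCountableTopology X]
    [MeasurableSpace X] [BorelSpace X]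
    [MulAction Gᵐᵒᵖ X] [ContinuousSMul Gᵐᵒᵖ X]

/-- The scalar products of the vectors `z n (y, g)` are given by the kernel `Q` evaluated at the
arrow from `y g` to `y h`. -/
def IsGoodPoint (z : ℕ → X × G → Ell2.{w}) (Q : ℕ → ℕ → X × G → ℂ) (y : X) : Prop :=
  (∀ n m, ∀ᵐ p ∂((Measure.haar : Measure G).prod (Measure.haar : Measure G)),
    ⟪z n (y, p.1), z m (y, p.2)⟫_ℂ = Q n m (y <• p.1, p.1⁻¹ * p.2)) ∧
  ∀ n, ∀ᵐ g ∂(Measure.haar : Measure G), ‖z n (y, g)‖ ≤ 1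

/-- A *coefficient field*: vectors `z n (x, g)`, to be thought of as the vectors
`L(x, g)⁻¹ (e n (x g))` of a total sequence of sections `e n`, whose scalar products have the
invariance that this implies, at almost every point. -/
structure IsCoefficientField (μ : Measure X) (z : ℕ → X × G → Ell2.{w})
    (Q : ℕ → ℕ → X × G → ℂ) : Prop where
  measurable_z : ∀ n, Measurable (z n)
  measurable_Q : ∀ n m, Measurable (Q n m)
  ae_good : ∀ᵐ x ∂μ, IsGoodPoint z Q x

/-- The integrated vector `∫ F(g) z n (y, g) dg`. -/
def smear (z : ℕ → X × G → Ell2.{w}) (i : TestFn G × ℕ) (y : X) : Ell2.{w} :=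
  ∫ g, i.1 g • z i.2 (y, g) ∂(Measure.haar : Measure G)

/-- The scalar product `∫∫ conj F(g) F'(h) Q(x g, g⁻¹ h) dg dh` of integrated vectors. -/
def gramKernel (Q : ℕ → ℕ → X × G → ℂ) (x : X) (i j : TestFn G × ℕ) : ℂ :=
  ∫ p : G × G, (starRingEnd ℂ) (i.1 p.1) * j.1 p.2 * Q i.2 j.2 (x <• p.1, p.1⁻¹ * p.2)
    ∂((Measure.haar : Measure G).prod (Measure.haar : Measure G))

/-- The action of `G` on the indices of integrated vectors. -/
def shiftIndex (a : G) (i : TestFn G × ℕ) : TestFn G × ℕ := (i.1.shift a, i.2)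

lemma shiftIndex_one (i : TestFn G × ℕ) : shiftIndex 1 i = i :=
  Prod.ext i.1.shift_one rfl

lemma shiftIndex_shiftIndex (a b : G) (i : TestFn G × ℕ) :
    shiftIndex b (shiftIndex a i) = shiftIndex (a * b) i :=
  Prod.ext (i.1.shift_shift a b) rfl

/-- The invariance of the kernel, by left invariance of the Haar measure. It is what makes the
representation strict. -/
lemma gramKernel_shiftIndex (Q : ℕ → ℕ → X × G → ℂ) (x : X) (a : G) (i j : TestFn G × ℕ) :
    gramKernel Q (x <• a) (shiftIndex a i) (shiftIndex a j) = gramKernel Q x i j := by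
  refine Eq.trans (integral_congr_ae (Filter.Eventually.of_forall fun p => ?_))
    (integral_mul_left_eq_self (fun p : G × G => (starRingEnd ℂ) (i.1 p.1) * j.1 p.2 *
      Q i.2 j.2 (x <• p.1, p.1⁻¹ * p.2)) ((a, a) : G × G))
  have h : (a * p.1)⁻¹ * (a * p.2) = p.1⁻¹ * p.2 := by group
  simp only [shiftIndex, TestFn.shift_apply, Prod.fst_mul, Prod.snd_mul, rsmul_rsmul, h]

lemma measurable_gramKernel {Q : ℕ → ℕ → X × G → ℂ} (hQ : ∀ n m, Measurable (Q n m))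
    (i j : TestFn G × ℕ) :
    Measurable fun t : X × G => gramKernel Q (t.1 <• t.2) i (shiftIndex t.2 j) := by
  unfold gramKernel
  refine StronglyMeasurable.measurable (StronglyMeasurable.integral_prod_right'
    (f := fun s : (X × G) × (G × G) => (starRingEnd ℂ) (i.1 s.2.1) * j.1 (s.1.2 * s.2.2) *
      Q i.2 j.2 ((s.1.1 <• s.1.2) <• s.2.1, s.2.1⁻¹ * s.2.2)) (Measurable.stronglyMeasurable ?_))
  have h1 : Measurable fun s : (X × G) × (G × G) => (s.1.1 <• s.1.2) <• s.2.1 :=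
    (measurable_rsmul G X).comp (((measurable_rsmul G X).comp measurable_fst).prodMk
      (measurable_fst.comp measurable_snd))
  refine ((RCLike.continuous_conj.measurable.comp
    (i.1.2.1.comp (measurable_fst.comp measurable_snd))).mul
    (j.1.2.1.comp ?_)).mul ((hQ _ _).comp (h1.prodMk ?_))
  all_goals fun_prop

lemma measurable_gramKernel_left {Q : ℕ → ℕ → X × G → ℂ} (hQ : ∀ n m, Measurable (Q n m))
    (i j : TestFn G × ℕ) : Measurable fun x : X => gramKernel Q x i j := by
  have h := (measurable_gramKernel hQ i j).comp (measurable_prodMk_right (y := (1 : G)))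
  simpa [shiftIndex_one, Function.comp_def] using h

variable {z : ℕ → X × G → Ell2.{w}} {Q : ℕ → ℕ → X × G → ℂ} {μ : Measure X}

lemma IsGoodPoint.integrable {y : X} (hz : ∀ n, Measurable (z n)) (hy : IsGoodPoint z Q y)
    (i : TestFn G × ℕ) :
    Integrable (fun g => i.1 g • z i.2 (y, g)) (Measure.haar : Measure G) := by
  refine i.1.2.2.mono (i.1.2.1.smul ((hz _).comp measurable_prodMk_left)).aestronglyMeasurable ?_
  filter_upwards [hy.2 i.2] with g hg
  rw [norm_smul]
  exact mul_le_of_le_one_right (norm_nonneg _) hg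

lemma IsGoodPoint.inner_smear_left {y : X} (hz : ∀ n, Measurable (z n)) (hy : IsGoodPoint z Q y)
    (i : TestFn G × ℕ) (c : Ell2.{w}) : ⟪smear z i y, c⟫_ℂ =
      ∫ g, (starRingEnd ℂ) (i.1 g) * ⟪z i.2 (y, g), c⟫_ℂ ∂(Measure.haar : Measure G) := by
  rw [← inner_conj_symm, smear, ← integral_inner (hy.integrable hz i), ← integral_conj]
  simp only [inner_conj_symm, inner_smul_left]

/-- At a good point the scalar products of the integrated vectors are given by the kernel, which makes
sense at every point. -/
lemma IsGoodPoint.inner_smear {y : X} (hz : ∀ n, Measurable (z n)) (hy : IsGoodPoint z Q y)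
    (i j : TestFn G × ℕ) : ⟪smear z i y, smear z j y⟫_ℂ = gramKernel Q y i j := by
  have hi := hy.integrable hz i
  have hj := hy.integrable hz j
  have hint : Integrable (fun p : G × G => ⟪i.1 p.1 • z i.2 (y, p.1), j.1 p.2 • z j.2 (y, p.2)⟫_ℂ)
      ((Measure.haar : Measure G).prod (Measure.haar : Measure G)) := by
    refine (hi.norm.mul_prod hj.norm).mono (hi.1.comp_fst.inner hj.1.comp_snd)
      (Filter.Eventually.of_forall fun p => ?_)
    rw [norm_mul, norm_norm, norm_norm]
    exact norm_inner_le_norm _ _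
  have h1 : ⟪smear z i y, smear z j y⟫_ℂ =
      ∫ g, ⟪i.1 g • z i.2 (y, g), smear z j y⟫_ℂ ∂(Measure.haar : Measure G) := by
    rw [hy.inner_smear_left hz]
    simp only [inner_smul_left]
  rw [h1, gramKernel]
  calc _ = ∫ g, ∫ h, ⟪i.1 g • z i.2 (y, g), j.1 h • z j.2 (y, h)⟫_ℂ ∂(Measure.haar : Measure G)
        ∂(Measure.haar : Measure G) := by
        simp only [smear, ← integral_inner hj]
    _ = _ := by
        rw [← integral_prod _ hint]
        refine integral_congr_ae ?_
        filter_upwards [hy.1 i.2 j.2] with p hp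
        rw [inner_smul_left, inner_smul_right, hp, mul_assoc]

lemma IsGoodPoint.norm_smear_sub_le {y : X} (hz : ∀ n, Measurable (z n)) (hy : IsGoodPoint z Q y)
    (F F' : TestFn G) (n : ℕ) :
    ‖smear z (F, n) y - smear z (F', n) y‖ ≤ ∫ g, ‖F g - F' g‖ ∂(Measure.haar : Measure G) := by
  rw [smear, smear, ← integral_sub (hy.integrable hz (F, n)) (hy.integrable hz (F', n))]
  refine norm_integral_le_of_norm_le (F.2.2.sub F'.2.2).norm ?_
  filter_upwards [hy.2 n] with g hg
  rw [← sub_smul, norm_smul]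
  exact mul_le_of_le_one_right (norm_nonneg _) hg

lemma measurable_smear (hz : ∀ n, Measurable (z n)) (i : TestFn G × ℕ) :
    Measurable fun x => smear z i x := by
  refine (StronglyMeasurable.integral_prod_right' (f := fun p : X × G => i.1 p.2 • z i.2 p)
    (Measurable.stronglyMeasurable ?_)).measurable
  exact (i.1.2.1.comp measurable_snd).smul (hz _)

lemma measurableSet_isGoodPoint (hz : ∀ n, Measurable (z n)) (hQ : ∀ n m, Measurable (Q n m)) :
    MeasurableSet {y | IsGoodPoint z Q y} := by
  have h1 : ∀ n m, MeasurableSet {y | ∀ᵐ p ∂((Measure.haar : Measure G).prod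
      (Measure.haar : Measure G)),
      ⟪z n (y, p.1), z m (y, p.2)⟫_ℂ = Q n m (y <• p.1, p.1⁻¹ * p.2)} := by
    intro n m
    refine measurableSet_ae_section (measurableSet_eq_fun (Measurable.inner ?_ ?_)
      ((hQ n m).comp (Measurable.prodMk ?_ ?_)))
    · exact (hz n).comp (by fun_prop)
    · exact (hz m).comp (by fun_prop)
    · exact (measurable_rsmul G X).comp (measurable_fst.prodMk (measurable_fst.comp measurable_snd))
    · fun_prop
  have h2 : ∀ n, MeasurableSet {y | ∀ᵐ g ∂(Measure.haar : Measure G), ‖z n (y, g)‖ ≤ 1} := fun n =>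
    measurableSet_ae_section (measurableSet_le (hz n).norm measurable_const)
  exact (MeasurableSet.iInter fun n => MeasurableSet.iInter fun m => h1 n m).inter
    (MeasurableSet.iInter fun n => h2 n) |>.congr (by ext y; simp [IsGoodPoint])

variable (z Q) in
/-- The invariant set of the points almost all of whose translates are good. -/
def coreSet : Set X := {x | ∀ᵐ k ∂(Measure.haar : Measure G), IsGoodPoint z Q (x <• k)}

lemma rsmul_mem_coreSet (x : X) (a : G) : x <• a ∈ coreSet z Q ↔ x ∈ coreSet z Q := by
  have h1 : ∀ (x : X) (a : G), x ∈ coreSet z Q → x <• a ∈ coreSet z Q := fun x a hx => by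
    have := ae_mul_left (p := fun k => IsGoodPoint z Q (x <• k)) hx a
    simpa only [coreSet, Set.mem_ofPred_eq, rsmul_rsmul] using this
  refine ⟨fun h => ?_, h1 x a⟩
  simpa using h1 _ a⁻¹ h

lemma measurableSet_coreSet (hz : ∀ n, Measurable (z n)) (hQ : ∀ n m, Measurable (Q n m)) :
    MeasurableSet (coreSet z Q) :=
  measurableSet_ae_section ((measurable_rsmul G X) (measurableSet_isGoodPoint hz hQ))

/-- By Fubini's theorem and quasi-invariance, almost every point lies in the core. -/
lemma ae_mem_coreSet [SFinite μ] (hμ : QuasiInvariant G μ) (h : IsCoefficientField μ z Q) :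
    ∀ᵐ x ∂μ, x ∈ coreSet z Q := by
  have hm : MeasurableSet {t : X × G | IsGoodPoint z Q (t.1 <• t.2)} :=
    (measurable_rsmul G X) (measurableSet_isGoodPoint h.measurable_z h.measurable_Q)
  refine (Measure.ae_ae_comm (p := fun (x : X) (k : G) => IsGoodPoint z Q (x <• k)) hm).2
    (Filter.Eventually.of_forall fun k => ?_)
  exact (⟨measurable_rsmul_const k, hμ k⟩ : Measure.QuasiMeasurePreserving _ μ μ).ae h.ae_good

open scoped Classical in
variable (z Q) in
/-- A group element which moves a point of the core to a good point; it is `1` at good points. -/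
def toGood (x : X) : G :=
  if h : (∃ k, IsGoodPoint z Q (x <• k)) ∧ ¬ IsGoodPoint z Q x then h.1.choose else 1

lemma toGood_eq_one {x : X} (hx : IsGoodPoint z Q x) : toGood z Q x = (1 : G) :=
  dif_neg fun h => h.2 hx

lemma isGoodPoint_toGood {x : X} (hx : x ∈ coreSet z Q) :
    IsGoodPoint z Q (x <• (toGood z Q x : G)) := by
  by_cases h : IsGoodPoint z Q x
  · rw [toGood_eq_one h]
    simpa using h
  · have h1 : (∃ k : G, IsGoodPoint z Q (x <• k)) ∧ ¬ IsGoodPoint z Q x :=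
      ⟨Filter.Eventually.exists (f := ae (Measure.haar : Measure G)) hx, h⟩
    rw [toGood, dif_pos h1]
    exact h1.1.choose_spec

open scoped Classical in
variable (z Q) in
/-- The integrated vectors at a point of the core, computed at a good point of its orbit. -/
def coreVec (x : X) (i : TestFn G × ℕ) : Ell2.{w} :=
  if x ∈ coreSet z Q then smear z (shiftIndex (toGood z Q x) i) (x <• (toGood z Q x : G)) else 0

lemma coreVec_eq_smear {x : X} (hx : x ∈ coreSet z Q) (hx' : IsGoodPoint z Q x)
    (i : TestFn G × ℕ) : coreVec z Q x i = smear z i x := by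
  rw [coreVec, if_pos hx, toGood_eq_one hx', shiftIndex_one]
  simp

lemma inner_coreVec (hz : ∀ n, Measurable (z n)) {x : X} (hx : x ∈ coreSet z Q)
    (i j : TestFn G × ℕ) : ⟪coreVec z Q x i, coreVec z Q x j⟫_ℂ = gramKernel Q x i j := by
  rw [coreVec, coreVec, if_pos hx, if_pos hx, (isGoodPoint_toGood hx).inner_smear hz,
    gramKernel_shiftIndex]

lemma coreVec_of_notMem {x : X} (hx : x ∉ coreSet z Q) (i : TestFn G × ℕ) :
    coreVec z Q x i = 0 := if_neg hx

variable (z Q) in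
/-- The fibre at `x`: the closed span of the integrated vectors. -/
def coreFiber (x : X) : Submodule ℂ Ell2.{w} :=
  (Submodule.span ℂ (Set.range (coreVec z Q x))).topologicalClosure

variable (z Q) in
/-- The integrated vectors as elements of the fibre. -/
def fiberVec (x : X) (i : TestFn G × ℕ) : coreFiber z Q x :=
  ⟨coreVec z Q x i, Submodule.le_topologicalClosure _ (Submodule.subset_span ⟨i, rfl⟩)⟩

instance (x : X) : CompleteSpace (coreFiber z Q x) := by unfold coreFiber; infer_instance

lemma fiberVec_total (x : X) :
    (Submodule.span ℂ (Set.range (fiberVec z Q x))).topologicalClosure = ⊤ := by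
  refine total_of_forall_eq_zero _ fun v hv => ?_
  have h1 : coreFiber z Q x ≤ (Submodule.span ℂ {(v : Ell2.{w})})ᗮ := by
    refine Submodule.topologicalClosure_minimal _ (Submodule.span_le.2 ?_)
      (Submodule.isClosed_orthogonal _)
    rintro _ ⟨i, rfl⟩
    rw [SetLike.mem_coe, Submodule.mem_orthogonal_singleton_iff_inner_left]
    exact hv i
  have h2 := Submodule.mem_orthogonal_singleton_iff_inner_left.1 (h1 v.2)
  exact Subtype.ext (inner_self_eq_zero.1 h2)

lemma inner_fiberVec (hz : ∀ n, Measurable (z n)) {x : X} (hx : x ∈ coreSet z Q)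
    (i j : TestFn G × ℕ) : ⟪fiberVec z Q x i, fiberVec z Q x j⟫_ℂ = gramKernel Q x i j :=
  inner_coreVec hz hx i j

lemma fiberVec_of_notMem {x : X} (hx : x ∉ coreSet z Q) (i : TestFn G × ℕ) :
    fiberVec z Q x i = 0 := Subtype.ext (coreVec_of_notMem hx i)

open TransformationGroupoid in
/-- The operator of an arrow, which exists because the kernel is invariant. -/
lemma exists_transport (hz : ∀ n, Measurable (z n)) {x y : X} (a : Hom G x y) :
    ∃ T : coreFiber z Q x ≃ₗᵢ[ℂ] coreFiber z Q y,
      ∀ i, T (fiberVec z Q x i) = fiberVec z Q y (shiftIndex a.elt i) := by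
  obtain ⟨a, rfl⟩ := a
  refine exists_linearIsometryEquiv_of_inner_eq _ _ (fiberVec_total x) ?_ fun i j => ?_
  · have hs : Function.Surjective (shiftIndex a) := fun i =>
      ⟨shiftIndex a⁻¹ i, by rw [shiftIndex_shiftIndex, inv_mul_cancel, shiftIndex_one]⟩
    have := hs.range_comp (fiberVec z Q (x <• a))
    rw [Function.comp_def] at this
    rw [this]
    exact fiberVec_total _
  · by_cases hx : x ∈ coreSet z Q
    · rw [inner_fiberVec hz hx, inner_fiberVec hz ((rsmul_mem_coreSet x a).2 hx),
        gramKernel_shiftIndex]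
    · rw [fiberVec_of_notMem hx, fiberVec_of_notMem (fun h => hx ((rsmul_mem_coreSet x a).1 h)),
        inner_zero_left, inner_zero_left]

/-- Countably many test functions suffice to exhaust the fibres. -/
lemma exists_fiberVec_total (hz : ∀ n, Measurable (z n)) : ∃ D : ℕ → TestFn G × ℕ, ∀ x,
    (Submodule.span ℂ (Set.range fun k => fiberVec z Q x (D k))).topologicalClosure = ⊤ := by
  obtain ⟨D, hD⟩ := TestFn.exists_dense (G := G)
  refine ⟨fun k => (D k.unpair.1, k.unpair.2), fun x => total_of_forall_eq_zero _ fun v hv =>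
    eq_zero_of_inner_total _ (fiberVec_total x) ?_⟩
  rintro ⟨F, n⟩
  by_cases hx : x ∈ coreSet z Q
  swap
  · rw [fiberVec_of_notMem hx, inner_zero_left]
  rw [← norm_le_zero_iff]
  refine le_of_forall_pos_le_add fun ε hε => ?_
  obtain ⟨k, hk⟩ := hD F (ε / (‖v‖ + 1)) (by positivity)
  have h1 := hv (Nat.pair k n)
  simp only [Nat.unpair_pair] at h1
  have h2 : ‖fiberVec z Q x (F, n) - fiberVec z Q x (D k, n)‖ ≤
      ∫ g, ‖F g - D k g‖ ∂(Measure.haar : Measure G) := by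
    have h3 := (isGoodPoint_toGood hx).norm_smear_sub_le hz (F.shift (toGood z Q x))
      ((D k).shift (toGood z Q x)) n
    simp only [TestFn.shift_apply] at h3
    rw [integral_mul_left_eq_self (fun g => ‖F g - D k g‖)] at h3
    refine le_trans (le_of_eq ?_) h3
    change ‖coreVec z Q x (F, n) - coreVec z Q x (D k, n)‖ = _
    rw [coreVec, coreVec, if_pos hx, if_pos hx]
    rfl
  calc ‖⟪fiberVec z Q x (F, n), v⟫_ℂ‖
      = ‖⟪fiberVec z Q x (F, n) - fiberVec z Q x (D k, n), v⟫_ℂ‖ := by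
        rw [inner_sub_left, h1, sub_zero]
    _ ≤ ε / (‖v‖ + 1) * ‖v‖ := (norm_inner_le_norm _ _).trans (mul_le_mul_of_nonneg_right
        (h2.trans hk.le) (norm_nonneg _))
    _ ≤ 0 + ε := by
        rw [zero_add, div_mul_eq_mul_div, div_le_iff₀ (by positivity)]
        nlinarith [norm_nonneg v]

end CoefficientField

section StrictRep

open TransformationGroupoid

variable {X : Type u} {G : Type v}
    [Group G] [TopologicalSpace G] [IsTopologicalGroup G] [LocallyCompactSpace G] [T2Space G]
    [SecondCountableTopology G] [MeasurableSpace G] [BorelSpace G]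
    [TopologicalSpace X] [LocallyCompactSpace X] [T2Space X] [SecondCountableTopology X]
    [MeasurableSpace X] [BorelSpace X]
    [MulAction Gᵐᵒᵖ X] [ContinuousSMul Gᵐᵒᵖ X]
    {z : ℕ → X × G → Ell2.{w}} {Q : ℕ → ℕ → X × G → ℂ} {μ : Measure X}

lemma LinearIsometryEquiv.ext_of_total {I E F : Type*} [NormedAddCommGroup E]
    [InnerProductSpace ℂ E] [NormedAddCommGroup F] [InnerProductSpace ℂ F] {a : I → E}
    (ha : (Submodule.span ℂ (Set.range a)).topologicalClosure = ⊤) {T T' : E ≃ₗᵢ[ℂ] F}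
    (h : ∀ i, T (a i) = T' (a i)) : T = T' := by
  have h1 : T.toLinearIsometry.toContinuousLinearMap = T'.toLinearIsometry.toContinuousLinearMap := by
    refine ContinuousLinearMap.ext_on (Submodule.dense_iff_topologicalClosure_eq_top.2 ha) ?_
    rintro _ ⟨i, rfl⟩
    exact h i
  ext v
  exact DFunLike.congr_fun h1 v

/-- A family of unitary operators is measurable if its matrix coefficients with respect to total
sequences are. -/
lemma measurable_inner_of_total {Y : Type*} [MeasurableSpace Y] {E E' : Y → Type w}
    [∀ y, NormedAddCommGroup (E y)] [∀ y, InnerProductSpace ℂ (E y)] [∀ y, CompleteSpace (E y)]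
    [∀ y, NormedAddCommGroup (E' y)] [∀ y, InnerProductSpace ℂ (E' y)]
    [∀ y, CompleteSpace (E' y)] (e : ℕ → ∀ y, E y) (e' : ℕ → ∀ y, E' y)
    (he : ∀ y, (Submodule.span ℂ (Set.range fun n => e n y)).topologicalClosure = ⊤)
    (he' : ∀ y, (Submodule.span ℂ (Set.range fun n => e' n y)).topologicalClosure = ⊤)
    (hm : ∀ n m, Measurable fun y => ⟪e n y, e m y⟫_ℂ)
    (hm' : ∀ n m, Measurable fun y => ⟪e' n y, e' m y⟫_ℂ) (U : ∀ y, E y ≃ₗᵢ[ℂ] E' y)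
    (hU : ∀ n m, Measurable fun y => ⟪e' m y, U y (e n y)⟫_ℂ) (ξ : ∀ y, E y) (η : ∀ y, E' y)
    (hξ : ∀ n, Measurable fun y => ⟪e n y, ξ y⟫_ℂ) (hη : ∀ n, Measurable fun y => ⟪e' n y, η y⟫_ℂ) :
    Measurable fun y => ⟪η y, U y (ξ y)⟫_ℂ := by
  let B := HilbertBundle.ofTotal E e he hm
  let B' := HilbertBundle.ofTotal E' e' he' hm'
  have h1 : (fun y => (U y).symm (η y)) ∈ B.sections := fun n => by
    have h2 := B'.measurable_inner (fun y => U y (e n y)) (hU n) η hη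
    have h3 : (fun y => ⟪e n y, (U y).symm (η y)⟫_ℂ) = fun y => ⟪U y (e n y), η y⟫_ℂ := by
      funext y
      rw [← (U y).inner_map_map, LinearIsometryEquiv.apply_symm_apply]
    rw [h3]
    exact h2
  have h2 := B.measurable_inner _ h1 ξ hξ
  have h3 : (fun y => ⟪η y, U y (ξ y)⟫_ℂ) = fun y => ⟪(U y).symm (η y), ξ y⟫_ℂ := by
    funext y
    rw [← (U y).inner_map_map ((U y).symm (η y)), LinearIsometryEquiv.apply_symm_apply]
  rw [h3]
  exact h2

lemma measurable_inner_fiberVec_rsmul (h : IsCoefficientField μ z Q) (i j : TestFn G × ℕ) :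
    Measurable fun t : X × G =>
      ⟪fiberVec z Q (t.1 <• t.2) i, fiberVec z Q (t.1 <• t.2) (shiftIndex t.2 j)⟫_ℂ := by
  classical
  have h1 : (fun t : X × G =>
      ⟪fiberVec z Q (t.1 <• t.2) i, fiberVec z Q (t.1 <• t.2) (shiftIndex t.2 j)⟫_ℂ) =
      (Prod.fst ⁻¹' coreSet z Q).indicator
        fun t : X × G => gramKernel Q (t.1 <• t.2) i (shiftIndex t.2 j) := by
    funext t
    by_cases ht : t.1 ∈ coreSet z Q
    · rw [Set.indicator_of_mem (by exact ht), inner_fiberVec h.measurable_z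
        ((rsmul_mem_coreSet _ _).2 ht)]
    · rw [Set.indicator_of_notMem (by exact ht), fiberVec_of_notMem
        (fun h => ht ((rsmul_mem_coreSet _ _).1 h)), inner_zero_left]
  rw [h1]
  exact (measurable_gramKernel h.measurable_Q i j).indicator
    (measurable_fst (measurableSet_coreSet h.measurable_z h.measurable_Q))

lemma measurable_inner_fiberVec (h : IsCoefficientField μ z Q) (i j : TestFn G × ℕ) :
    Measurable fun x : X => ⟪fiberVec z Q x i, fiberVec z Q x j⟫_ℂ := by
  classical
  have h1 : (fun x : X => ⟪fiberVec z Q x i, fiberVec z Q x j⟫_ℂ) =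
      (coreSet z Q).indicator fun x : X => gramKernel Q x i j := by
    funext x
    by_cases hx : x ∈ coreSet z Q
    · rw [Set.indicator_of_mem hx, inner_fiberVec h.measurable_z hx]
    · rw [Set.indicator_of_notMem hx, fiberVec_of_notMem hx, inner_zero_left]
  rw [h1]
  exact (measurable_gramKernel_left h.measurable_Q i j).indicator
    (measurableSet_coreSet h.measurable_z h.measurable_Q)

open scoped Classical in
variable (z Q) in
/-- The inclusion of the fibre into `ℓ²`, at the good points of the core. -/
def fiberIncl (x : X) : coreFiber z Q x →L[ℂ] Ell2.{w} :=
  if IsGoodPoint z Q x ∧ x ∈ coreSet z Q then (coreFiber z Q x).subtypeL else 0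

lemma fiberIncl_apply {x : X} (hx : IsGoodPoint z Q x ∧ x ∈ coreSet z Q) (v : coreFiber z Q x) :
    fiberIncl z Q x v = v := by
  rw [fiberIncl, if_pos hx]
  rfl

lemma fiberIncl_of_not {x : X} (hx : ¬ (IsGoodPoint z Q x ∧ x ∈ coreSet z Q))
    (v : coreFiber z Q x) : fiberIncl z Q x v = 0 := by
  rw [fiberIncl, if_neg hx]
  rfl

lemma norm_fiberIncl_le (x : X) (v : coreFiber z Q x) : ‖fiberIncl z Q x v‖ ≤ ‖v‖ := by
  by_cases hx : IsGoodPoint z Q x ∧ x ∈ coreSet z Q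
  · rw [fiberIncl_apply hx]
    rfl
  · rw [fiberIncl_of_not hx, norm_zero]
    exact norm_nonneg v

lemma measurable_fiberIncl (h : IsCoefficientField μ z Q) (i : TestFn G × ℕ) :
    Measurable fun x => fiberIncl z Q x (fiberVec z Q x i) := by
  have h1 : (fun x => fiberIncl z Q x (fiberVec z Q x i)) =
      ({x | IsGoodPoint z Q x} ∩ coreSet z Q).indicator fun x => smear z i x := by
    funext x
    by_cases hx : IsGoodPoint z Q x ∧ x ∈ coreSet z Q
    · rw [fiberIncl_apply hx, Set.indicator_of_mem (by exact hx)]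
      exact coreVec_eq_smear hx.2 hx.1 i
    · rw [fiberIncl_of_not hx, Set.indicator_of_notMem (by exact hx)]
  rw [h1]
  exact (measurable_smear h.measurable_z i).indicator
      ((measurableSet_isGoodPoint h.measurable_z h.measurable_Q).inter
        (measurableSet_coreSet h.measurable_z h.measurable_Q))

/-- **Strict representations from coefficient fields.** The fibres are spanned by vectors
`j x (F, n)`, which the groupoid permutes, and embedded in `ℓ²` by `κ x` so that `j x (F, n)` becomes
the integrated vector `∫ F(g) z n (x, g) dg`, at almost every point. -/
theorem IsCoefficientField.exists_strict [IsProbabilityMeasure μ] (hμ : QuasiInvariant G μ)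
    (h : IsCoefficientField μ z Q) :
    ∃ (R : GroupoidRep.{u, v, w} G X) (j : ∀ x, TestFn G × ℕ → R.bundle.Fiber x)
      (κ : ∀ x, R.bundle.Fiber x →L[ℂ] Ell2.{w}), R.μ = μ ∧ R.IsStrict ∧
      (∀ x, (Submodule.span ℂ (Set.range (j x))).topologicalClosure = ⊤) ∧
      (∀ {x y : X} (a : Hom G x y) i, R.L a (j x i) = j y (shiftIndex a.elt i)) ∧
      (∀ ξ : ∀ x, R.bundle.Fiber x, (∀ i, Measurable fun x => ⟪j x i, ξ x⟫_ℂ) →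
        ξ ∈ R.bundle.sections) ∧
      (∀ i, Measurable fun x => κ x (j x i)) ∧ (∀ x v, ‖κ x v‖ ≤ ‖v‖) ∧
      ∀ᵐ x ∂μ, (∀ v, ‖κ x v‖ = ‖v‖) ∧ ∀ i, κ x (j x i) = smear z i x := by
  classical
  obtain ⟨D, hD⟩ := exists_fiberVec_total (Q := Q) h.measurable_z
  let B : HilbertBundle.{u, w} X := HilbertBundle.ofTotal (fun x => coreFiber z Q x)
    (fun k x => fiberVec z Q x (D k)) hD fun n m => measurable_inner_fiberVec h _ _
  let L : ∀ {x y : X}, Hom G x y → (coreFiber z Q x ≃ₗᵢ[ℂ] coreFiber z Q y) :=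
    fun a => (exists_transport h.measurable_z a).choose
  have hL : ∀ {x y : X} (a : Hom G x y) i,
      L a (fiberVec z Q x i) = fiberVec z Q y (shiftIndex a.elt i) := fun a =>
    (exists_transport h.measurable_z a).choose_spec
  have hmul : ∀ {x y z' : X} (b : Hom G y z') (a : Hom G x y), L (mul b a) = (L a).trans (L b) := by
    intro x y z' b a
    refine LinearIsometryEquiv.ext_of_total (fiberVec_total x) fun i => ?_
    rw [LinearIsometryEquiv.trans_apply, hL, hL, hL, shiftIndex_shiftIndex]
    rfl
  have hunit : ∀ x, L (unit x : Hom G x x) = LinearIsometryEquiv.refl ℂ _ := by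
    intro x
    refine LinearIsometryEquiv.ext_of_total (fiberVec_total x) fun i => ?_
    rw [hL]
    change fiberVec z Q x (shiftIndex 1 i) = _
    rw [shiftIndex_one]
    rfl
  have hinv : ∀ {x y : X} (a : Hom G x y), L (inv a) = (L a).symm := by
    intro x y a
    refine LinearIsometryEquiv.ext_of_total (fiberVec_total y) fun i => ?_
    rw [LinearIsometryEquiv.eq_symm_apply, hL, hL, shiftIndex_shiftIndex]
    change fiberVec z Q y (shiftIndex (a.elt⁻¹ * a.elt) i) = _
    rw [inv_mul_cancel, shiftIndex_one]
  let R : GroupoidRep.{u, v, w} G X :=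
    { bundle := B
      μ := μ
      quasiInvariant := hμ
      L := L
      map_unit := hunit
      map_mul := Filter.Eventually.of_forall fun t => hmul _ _
      map_inv := Filter.Eventually.of_forall fun t => hinv _
      measurable_coeff := fun ξ hξ η hη => by
        have hB : ∀ ξ ∈ B.sections, ∀ k, Measurable fun x => ⟪fiberVec z Q x (D k), ξ x⟫_ℂ :=
          fun ξ hξ => hξ
        refine measurable_inner_of_total (E := fun t : X × G => coreFiber z Q t.1)
          (E' := fun t : X × G => coreFiber z Q (t.1 <• t.2))
          (fun k t => fiberVec z Q t.1 (D k)) (fun k t => fiberVec z Q (t.1 <• t.2) (D k))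
          (fun t => hD _) (fun t => hD _)
          (fun n m => (measurable_inner_fiberVec h _ _).comp measurable_fst)
          (fun n m => (measurable_inner_fiberVec h _ _).comp (measurable_rsmul G X))
          (fun t => L (arrow t.1 t.2)) (fun n m => ?_) (fun t => ξ t.1) (fun t => η (t.1 <• t.2))
          (fun n => (hB ξ hξ n).comp measurable_fst)
          (fun n => (hB η hη n).comp (measurable_rsmul G X))
        simp only [hL]
        exact measurable_inner_fiberVec_rsmul h (D m) (D n) }
  refine ⟨R, fun x => fiberVec z Q x, fun x => fiberIncl z Q x, rfl, ⟨hmul, hinv⟩, fiberVec_total,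
    hL, fun ξ hξ k => hξ (D k), measurable_fiberIncl h, norm_fiberIncl_le, ?_⟩
  filter_upwards [h.ae_good, ae_mem_coreSet hμ h] with x h1 h2
  exact ⟨fun v => congrArg norm (fiberIncl_apply ⟨h1, h2⟩ v), fun i =>
    (fiberIncl_apply ⟨h1, h2⟩ _).trans (coreVec_eq_smear h2 h1 i)⟩

end StrictRep

/-! ### The coefficient field of a system of imprimitivity -/

section QuasiInvariantMeasure

variable {X : Type u} {G : Type v}
    [Group G] [TopologicalSpace G] [IsTopologicalGroup G] [LocallyCompactSpace G] [T2Space G]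
    [SecondCountableTopology G] [MeasurableSpace G] [BorelSpace G]
    [TopologicalSpace X] [MeasurableSpace X] [BorelSpace X]
    [MulAction Gᵐᵒᵖ X] [ContinuousSMul Gᵐᵒᵖ X]

variable (G X) in
/-- The image of the Haar measure class under an orbit map is quasi-invariant. -/
lemma exists_quasiInvariant_probabilityMeasure [Nonempty X] :
    ∃ μ : Measure X, IsProbabilityMeasure μ ∧ QuasiInvariant G μ := by
  obtain ⟨x₀⟩ := ‹Nonempty X›
  have hm : Measurable fun g : G => x₀ <• g :=
    (MulOpposite.continuous_op.smul continuous_const).measurable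
  have hmg : ∀ g : G, Measurable fun x : X => x <• g := fun g =>
    (continuous_const_smul (MulOpposite.op g)).measurable
  refine ⟨(Measure.haar : Measure G).toFinite.map fun g => x₀ <• g,
    Measure.isProbabilityMeasure_map hm.aemeasurable, fun g => ?_⟩
  rw [Measure.map_map (hmg g) hm]
  have h1 : (fun x : X => x <• g) ∘ (fun h : G => x₀ <• h) = (fun h => x₀ <• h) ∘ fun h => h * g := by
    funext h
    change (x₀ <• h) <• g = x₀ <• (h * g)
    rw [MulOpposite.op_mul, mul_smul]
  rw [h1, ← Measure.map_map hm (measurable_mul_const g)]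
  refine Measure.AbsolutelyContinuous.map ?_ hm
  refine ((toFinite_absolutelyContinuous _).map (measurable_mul_const g)).trans ?_
  exact (quasiMeasurePreserving_mul_right Measure.haar g).absolutelyContinuous.trans
    (absolutelyContinuous_toFinite _)

end QuasiInvariantMeasure

namespace SystemOfImprimitivity

open HilbertBundle

section Disintegration

variable {X : Type u} {G : Type v}
    [Group G] [TopologicalSpace G] [IsTopologicalGroup G] [LocallyCompactSpace G] [T2Space G]
    [SecondCountableTopology G] [MeasurableSpace G] [BorelSpace G]
    [TopologicalSpace X] [LocallyCompactSpace X] [T2Space X] [SecondCountableTopology X]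
    [MeasurableSpace X] [BorelSpace X]
    [MulAction Gᵐᵒᵖ X] [ContinuousSMul Gᵐᵒᵖ X]
    (S : SystemOfImprimitivity.{u, v, w'} G X)

lemma inner_U (g : G) (v w : S.H) :
    ⟪(S.U g : S.H →L[ℂ] S.H) v, (S.U g : S.H →L[ℂ] S.H) w⟫_ℂ = ⟪v, w⟫_ℂ :=
  ContinuousLinearMap.inner_map_map_of_mem_unitary (S.U g).2 v w

lemma U_inv_U (g : G) (v : S.H) :
    (S.U g⁻¹ : S.H →L[ℂ] S.H) ((S.U g : S.H →L[ℂ] S.H) v) = v := by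
  rw [← S.U_mul_apply, inv_mul_cancel, map_one]
  rfl

lemma π_U (g : G) (f : C₀(X, ℂ)) (v : S.H) :
    S.π f ((S.U g : S.H →L[ℂ] S.H) v) =
      (S.U g : S.H →L[ℂ] S.H) (S.π (rightTranslate g⁻¹ f) v) := by
  have h1 : rightTranslate g (rightTranslate g⁻¹ f) = f := by
    ext x
    change f ((x <• g) <• g⁻¹) = f x
    rw [rsmul_rsmul_inv]
  have h2 := DFunLike.congr_fun (S.covariant g (rightTranslate g⁻¹ f)) ((S.U g : S.H →L[ℂ] S.H) v)
  rw [h1] at h2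
  rw [← h2]
  change (S.U g : S.H →L[ℂ] S.H) (S.π _ ((S.U g⁻¹ : S.H →L[ℂ] S.H)
    ((S.U g : S.H →L[ℂ] S.H) v))) = _
  rw [S.U_inv_U]

variable {S} {μ : Measure X} {J : S.H →ₗᵢ[ℂ] Lp Ell2.{w} 2 μ}

/-- The translation of scalar products, in integrated form. -/
lemma integral_inner_translate (hJ : ∀ f v, ∀ᵐ x ∂μ, J (S.π f v) x = f x • J v x) (g : G)
    (v w : S.H) (f : C₀(X, ℂ)) :
    ∫ x, f x * ⟪J ((S.U g : S.H →L[ℂ] S.H) v) x, J ((S.U g : S.H →L[ℂ] S.H) w) x⟫_ℂ ∂μ =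
      ∫ x, f (x <• g⁻¹) * ⟪J v x, J w x⟫_ℂ ∂μ := by
  have key : ∀ (f : C₀(X, ℂ)) (v w : S.H), ∫ x, f x * ⟪J v x, J w x⟫_ℂ ∂μ = ⟪v, S.π f w⟫_ℂ := by
    intro f v w
    rw [← J.inner_map_map, L2.inner_def]
    refine integral_congr_ae ?_
    filter_upwards [hJ f w] with x hx
    rw [hx, inner_smul_right]
  rw [key, π_U, inner_U, ← key]
  rfl

lemma measurable_inner_J (v w : S.H) : Measurable fun x => ⟪J v x, J w x⟫_ℂ :=
  (Lp.stronglyMeasurable (J v)).measurable.inner (Lp.stronglyMeasurable (J w)).measurable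

lemma integrable_inner_J (v w : S.H) : Integrable (fun x => ⟪J v x, J w x⟫_ℂ) μ :=
  L2.integrable_inner (𝕜 := ℂ) (J v) (J w)

open scoped CompactlySupported in
/-- The measures `‖J v x‖² dμ(x)` have the same null sets as `μ`, taken together, and they are permuted
by `G`. -/
lemma quasiInvariant_of_spectral (hJ : ∀ f v, ∀ᵐ x ∂μ, J (S.π f v) x = f x • J v x)
    (hfull : ∀ N, MeasurableSet N → (∀ v, ∀ᵐ x ∂μ, x ∈ N → J v x = 0) → μ N = 0) :
    QuasiInvariant G μ := by
  have hJm : ∀ v, Measurable fun x => ‖J v x‖ₑ ^ 2 := fun v =>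
    (Lp.stronglyMeasurable (J v)).measurable.enorm.pow_const 2
  have hfin : ∀ v, IsFiniteMeasure (μ.withDensity fun x => ‖J v x‖ₑ ^ 2) := fun v => by
    refine isFiniteMeasure_withDensity ?_
    have := (Lp.memLp (J v)).2
    rw [eLpNorm_lt_top_iff_lintegral_rpow_enorm_lt_top (by simp) (by simp)] at this
    simpa using this.ne
  have hint : ∀ (v : S.H) (f : X → ℝ), ((∫ x, f x ∂(μ.withDensity fun x => ‖J v x‖ₑ ^ 2) : ℝ) : ℂ) =
      ∫ x, (f x : ℂ) * ⟪J v x, J v x⟫_ℂ ∂μ := by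
    intro v f
    rw [integral_withDensity_eq_integral_toReal_smul (hJm v)
      (Filter.Eventually.of_forall fun _ => by simp), ← integral_complex_ofReal]
    refine integral_congr_ae (Filter.Eventually.of_forall fun x => ?_)
    simp [inner_self_eq_norm_sq_to_K, mul_comm]
  have key : ∀ (g : G) (v : S.H),
      (μ.withDensity fun x => ‖J ((S.U g : S.H →L[ℂ] S.H) v) x‖ₑ ^ 2) =
        (μ.withDensity fun x => ‖J v x‖ₑ ^ 2).map fun x => x <• g⁻¹ := by
    intro g v
    have := hfin v
    have := hfin ((S.U g : S.H →L[ℂ] S.H) v)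
    refine Measure.ext_of_integral_eq_on_compactlySupported fun f => ?_
    rw [integral_map (measurable_rsmul_const _).aemeasurable
      (map_continuous f).aestronglyMeasurable]
    refine Complex.ofReal_injective ?_
    rw [hint, hint]
    exact integral_inner_translate hJ g v v f.toC0
  intro g
  refine Measure.AbsolutelyContinuous.mk fun N hN h0 => ?_
  rw [Measure.map_apply (measurable_rsmul_const g) hN]
  refine hfull _ (measurable_rsmul_const g hN) fun v => ?_
  have h1 := congrArg (fun ν => ν N) (key g⁻¹ v)
  simp only [inv_inv] at h1
  rw [withDensity_absolutelyContinuous _ _ h0, Measure.map_apply (measurable_rsmul_const g) hN,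
    withDensity_apply _ (measurable_rsmul_const g hN), eq_comm,
    setLIntegral_eq_zero_iff (measurable_rsmul_const g hN) (hJm v)] at h1
  filter_upwards [h1] with x hx hxN
  simpa using hx hxN

variable (S) in
/-- A system of imprimitivity embeds into `L²(μ, ℓ²)` for a quasi-invariant probability measure `μ`. On
the zero space the spectral theorem provides no measure; any quasi-invariant one will do. -/
lemma exists_spectral [Nonempty X] : ∃ (μ : Measure X) (J : S.H →ₗᵢ[ℂ] Lp Ell2.{w} 2 μ),
    IsProbabilityMeasure μ ∧ QuasiInvariant G μ ∧ ∀ f v, ∀ᵐ x ∂μ, J (S.π f v) x = f x • J v x := by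
  rcases subsingleton_or_nontrivial S.H with hS | hS
  · obtain ⟨μ, hμ, hq⟩ := exists_quasiInvariant_probabilityMeasure X G
    refine ⟨μ, ⟨0, fun v => by simp [Subsingleton.elim v 0]⟩, hμ, hq, fun f v => ?_⟩
    filter_upwards [Lp.coeFn_zero Ell2.{w} 2 μ] with x hx
    change (0 : Lp Ell2.{w} 2 μ) x = f x • (0 : Lp Ell2.{w} 2 μ) x
    rw [hx, Pi.zero_apply, smul_zero]
  · obtain ⟨μ, J, hμ, hJ, hfull⟩ := exists_spectral_embedding.{u, w} S.π S.nondegenerate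
    exact ⟨μ, J, hμ, quasiInvariant_of_spectral hJ hfull, hJ⟩

variable [IsFiniteMeasure μ] {r : X × G → ℝ}

/-- The translation of scalar products, pointwise almost everywhere. -/
lemma inner_translate (hr : IsSqrtDensity μ r)
    (hJ : ∀ f v, ∀ᵐ x ∂μ, J (S.π f v) x = f x • J v x) (g : G) (v w : S.H) :
    ∀ᵐ x ∂μ, ⟪J ((S.U g : S.H →L[ℂ] S.H) v) x, J ((S.U g : S.H →L[ℂ] S.H) w) x⟫_ℂ =
      ((r (x, g) ^ 2 : ℝ) : ℂ) * ⟪J v (x <• g), J w (x <• g)⟫_ℂ := by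
  have i1 := integrable_inner_J (J := J) ((S.U g : S.H →L[ℂ] S.H) v) ((S.U g : S.H →L[ℂ] S.H) w)
  have i2 := hr.integrable g (measurable_inner_J (J := J) v w) (integrable_inner_J v w)
  have h := ae_eq_zero_of_forall_integral_C0 (i1.sub i2) fun f => by
    simp only [Pi.sub_apply, mul_sub]
    rw [integral_sub (integrable_C0_mul f i1) (integrable_C0_mul f i2), sub_eq_zero,
      integral_inner_translate hJ, ← hr.integral_eq g (F := fun x => f (x <• g⁻¹) * ⟪J v x, J w x⟫_ℂ)
        (((map_continuous f).measurable.comp (measurable_rsmul_const _)).mul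
          (measurable_inner_J v w))]
    refine integral_congr_ae (Filter.Eventually.of_forall fun x => ?_)
    simp only [rsmul_rsmul_inv]
    ring
  filter_upwards [h] with x hx
  exact sub_eq_zero.1 hx

/-- The normalizing factor which makes the vectors of a coefficient field bounded by one. -/
def coeffWeight (ζ : ℕ → X × G → Ell2.{w}) (n : ℕ) (y : X) : ℝ := (1 + ‖ζ n (y, 1)‖)⁻¹

/-- The vectors `ρ_g(x)^{-1/2} (J U(g) e n)(x)`, normalized, where `ζ n (x, g)` is a jointly
measurable representative of `J U(g) e n`. -/
def coeffVec (r : X × G → ℝ) (ζ : ℕ → X × G → Ell2.{w}) (n : ℕ) (p : X × G) : Ell2.{w} :=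
  (((r p)⁻¹ * coeffWeight ζ n (p.1 <• p.2) : ℝ) : ℂ) • ζ n p

/-- The kernel of the coefficient field `coeffVec r ζ`. -/
def coeffKernel (r : X × G → ℝ) (ζ : ℕ → X × G → Ell2.{w}) (n m : ℕ) (p : X × G) : ℂ :=
  ⟪((coeffWeight ζ n p.1 : ℝ) : ℂ) • ζ n (p.1, 1), coeffVec r ζ m p⟫_ℂ

variable {ζ : ℕ → X × G → Ell2.{w}} {e : ℕ → S.H}

lemma coeffWeight_pos (n : ℕ) (y : X) : 0 < coeffWeight ζ n y := by
  unfold coeffWeight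
  positivity

lemma measurable_coeffWeight (hζ : ∀ n, Measurable (ζ n)) (n : ℕ) : Measurable (coeffWeight ζ n) :=
  (((hζ n).comp measurable_prodMk_right).norm.const_add 1).inv

lemma measurable_coeffVec (hr : IsSqrtDensity μ r) (hζ : ∀ n, Measurable (ζ n)) (n : ℕ) :
    Measurable (coeffVec r ζ n) := by
  have h : Measurable fun p : X × G => (((r p)⁻¹ * coeffWeight ζ n (p.1 <• p.2) : ℝ) : ℂ) :=
    Complex.measurable_ofReal.comp (hr.measurable.inv.mul
      ((measurable_coeffWeight hζ n).comp (measurable_rsmul G X)))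
  exact h.smul (hζ n)

lemma measurable_coeffKernel (hr : IsSqrtDensity μ r) (hζ : ∀ n, Measurable (ζ n)) (n m : ℕ) :
    Measurable (coeffKernel r ζ n m) := by
  have h : Measurable fun p : X × G => ((coeffWeight ζ n p.1 : ℝ) : ℂ) :=
    Complex.measurable_ofReal.comp ((measurable_coeffWeight hζ n).comp measurable_fst)
  have h' : Measurable fun p : X × G => ζ n (p.1, 1) :=
    (hζ n).comp (measurable_fst.prodMk measurable_const)
  exact (h.smul h').inner (measurable_coeffVec hr hζ m)

/-- The action of `U` on `J H`, tested against the coefficient field. -/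
lemma inner_coeffVec (hr : IsSqrtDensity μ r)
    (hJ : ∀ f v, ∀ᵐ x ∂μ, J (S.π f v) x = f x • J v x)
    (hζ : ∀ n g, ∀ᵐ x ∂μ, ζ n (x, g) = J ((S.U g : S.H →L[ℂ] S.H) (e n)) x)
    (n : ℕ) (g h : G) (v : S.H) :
    ∀ᵐ x ∂μ, ⟪coeffVec r ζ n (x, h), J ((S.U g : S.H →L[ℂ] S.H) v) x⟫_ℂ =
      ((r (x, g) : ℝ) : ℂ) * ⟪coeffVec r ζ n (x <• g, g⁻¹ * h), J v (x <• g)⟫_ℂ := by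
  filter_upwards [hζ n h, hr.ae_rsmul g (hζ n (g⁻¹ * h)), hr.ae_mul_eq g (g⁻¹ * h),
    inner_translate hr hJ g ((S.U (g⁻¹ * h) : S.H →L[ℂ] S.H) (e n)) v] with x h1 h2 h3 h4
  rw [← S.U_mul_apply, mul_inv_cancel_left] at h4
  rw [mul_inv_cancel_left] at h3
  rw [coeffVec, coeffVec, inner_smul_left, inner_smul_left, h1, h2, h4, Complex.conj_ofReal,
    Complex.conj_ofReal, rsmul_rsmul, mul_inv_cancel_left, h3]
  have hp : r (x, g) ≠ 0 := (hr.pos _).ne'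
  rw [← mul_assoc, ← mul_assoc, ← Complex.ofReal_mul, ← Complex.ofReal_mul]
  congr 2
  field_simp

/-- The vectors of a dense sequence, translated by `G`, form a coefficient field. -/
theorem isCoefficientField (hr : IsSqrtDensity μ r)
    (hJ : ∀ f v, ∀ᵐ x ∂μ, J (S.π f v) x = f x • J v x) (hζm : ∀ n, Measurable (ζ n))
    (hζ : ∀ n g, ∀ᵐ x ∂μ, ζ n (x, g) = J ((S.U g : S.H →L[ℂ] S.H) (e n)) x) :
    IsCoefficientField μ (coeffVec r ζ) (coeffKernel r ζ) := by
  have hz := measurable_coeffVec hr hζm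
  have hQ := measurable_coeffKernel hr hζm
  refine ⟨hz, hQ, ?_⟩
  have h1 : ∀ n m, ∀ᵐ x ∂μ, ∀ᵐ p ∂((Measure.haar : Measure G).prod (Measure.haar : Measure G)),
      ⟪coeffVec r ζ n (x, p.1), coeffVec r ζ m (x, p.2)⟫_ℂ =
        coeffKernel r ζ n m (x <• p.1, p.1⁻¹ * p.2) := by
    intro n m
    have hms : MeasurableSet {t : X × (G × G) |
        ⟪coeffVec r ζ n (t.1, t.2.1), coeffVec r ζ m (t.1, t.2.2)⟫_ℂ =
          coeffKernel r ζ n m (t.1 <• t.2.1, t.2.1⁻¹ * t.2.2)} := by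
      refine measurableSet_eq_fun (Measurable.inner ?_ ?_) ((hQ n m).comp (Measurable.prodMk ?_ ?_))
      · exact (hz n).comp (by fun_prop)
      · exact (hz m).comp (by fun_prop)
      · exact (measurable_rsmul G X).comp
          (measurable_fst.prodMk (measurable_fst.comp measurable_snd))
      · fun_prop
    refine (Measure.ae_ae_comm (p := fun (x : X) (p : G × G) =>
      ⟪coeffVec r ζ n (x, p.1), coeffVec r ζ m (x, p.2)⟫_ℂ =
        coeffKernel r ζ n m (x <• p.1, p.1⁻¹ * p.2)) hms).2
      (Filter.Eventually.of_forall fun p => ?_)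
    have hζ1 : ∀ᵐ x ∂μ, ζ n (x, 1) = J (e n) x := by
      filter_upwards [hζ n 1] with x hx
      rw [hx, map_one]
      rfl
    filter_upwards [inner_coeffVec hr hJ hζ m p.1 p.2 (e n), hζ n p.1, hr.ae_rsmul p.1 hζ1]
      with x h1 h2 h3
    have h4 := congrArg (starRingEnd ℂ) h1
    rw [map_mul, inner_conj_symm, inner_conj_symm, Complex.conj_ofReal] at h4
    rw [coeffVec, coeffKernel, inner_smul_left, inner_smul_left, h2, h4, h3, Complex.conj_ofReal,
      Complex.conj_ofReal, ← mul_assoc, ← Complex.ofReal_mul]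
    congr 2
    have hp : r (x, p.1) ≠ 0 := (hr.pos _).ne'
    field_simp
  have h2 : ∀ n, ∀ᵐ x ∂μ, ∀ᵐ g ∂(Measure.haar : Measure G), ‖coeffVec r ζ n (x, g)‖ ≤ 1 := by
    intro n
    have hms : MeasurableSet {t : X × G | ‖coeffVec r ζ n (t.1, t.2)‖ ≤ 1} :=
      measurableSet_le (hz n).norm measurable_const
    refine (Measure.ae_ae_comm (p := fun (x : X) (g : G) => ‖coeffVec r ζ n (x, g)‖ ≤ 1) hms).2
      (Filter.Eventually.of_forall fun g => ?_)
    have hζ1 : ∀ᵐ x ∂μ, ζ n (x, 1) = J (e n) x := by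
      filter_upwards [hζ n 1] with x hx
      rw [hx, map_one]
      rfl
    filter_upwards [inner_translate hr hJ g (e n) (e n), hζ n g, hr.ae_rsmul g hζ1] with x h1 h2 h3
    rw [← h2, ← h3, inner_self_eq_norm_sq_to_K, inner_self_eq_norm_sq_to_K] at h1
    have h4 : ‖ζ n (x, g)‖ = r (x, g) * ‖ζ n (x <• g, 1)‖ := by
      rw [← sq_eq_sq₀ (norm_nonneg _) (mul_nonneg (hr.pos _).le (norm_nonneg _)), mul_pow]
      refine Complex.ofReal_injective ?_
      rw [Complex.ofReal_mul, Complex.ofReal_pow ‖ζ n (x, g)‖, Complex.ofReal_pow ‖ζ n (x <• g, 1)‖]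
      exact h1
    have hp : 0 < r (x, g) := hr.pos _
    rw [coeffVec, norm_smul, Complex.norm_real, Real.norm_of_nonneg
      (mul_nonneg (inv_nonneg.2 hp.le) (coeffWeight_pos _ _).le), h4, coeffWeight]
    have h5 : (r (x, g))⁻¹ * (1 + ‖ζ n (x <• g, 1)‖)⁻¹ * (r (x, g) * ‖ζ n (x <• g, 1)‖) =
        ‖ζ n (x <• g, 1)‖ / (1 + ‖ζ n (x <• g, 1)‖) := by
      field_simp
    rw [h5, div_le_one (by positivity)]
    linarith
  filter_upwards [ae_all_iff.2 fun n => ae_all_iff.2 (h1 n), ae_all_iff.2 h2] with x k1 k2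
  exact ⟨k1, k2⟩

end Disintegration

end SystemOfImprimitivity

/-! ### Disintegration of a system of imprimitivity -/

section Smear

variable {X : Type u} {G : Type v}
    [Group G] [TopologicalSpace G] [IsTopologicalGroup G] [LocallyCompactSpace G] [T2Space G]
    [SecondCountableTopology G] [MeasurableSpace G] [BorelSpace G]
    [TopologicalSpace X] [LocallyCompactSpace X] [T2Space X] [SecondCountableTopology X]
    [MeasurableSpace X] [BorelSpace X]
    [MulAction Gᵐᵒᵖ X] [ContinuousSMul Gᵐᵒᵖ X]
    {z : ℕ → X × G → Ell2.{w}} {Q : ℕ → ℕ → X × G → ℂ}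

/-- A subspace which contains the integrated vectors contains almost all vectors of the coefficient
field. The subspace is given by the projection `P` onto it. -/
lemma IsGoodPoint.ae_apply_eq {y : X} (hz : ∀ n, Measurable (z n)) (hy : IsGoodPoint z Q y)
    (P : Ell2.{w} →L[ℂ] Ell2.{w}) (hP : ∀ i : TestFn G × ℕ, P (smear z i y) = smear z i y) (n : ℕ) :
    ∀ᵐ g ∂(Measure.haar : Measure G), P (z n (y, g)) = z n (y, g) := by
  have hF : ∀ s : Set G, MeasurableSet s → (Measure.haar : Measure G) s < ⊤ →
      ∃ F : TestFn G, ∀ f : G → Ell2.{w}, ∫ g, F g • f g ∂(Measure.haar : Measure G) =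
        ∫ g in s, f g ∂(Measure.haar : Measure G) := by
    intro s hs hfin
    refine ⟨⟨s.indicator fun _ => 1, measurable_const.indicator hs,
      (integrable_indicator_iff hs).2 (integrableOn_const hfin.ne)⟩, fun f => ?_⟩
    rw [← integral_indicator hs]
    refine integral_congr_ae (Filter.Eventually.of_forall fun g => ?_)
    change s.indicator (fun _ => (1 : ℂ)) g • f g = s.indicator f g
    by_cases hg : g ∈ s <;> simp [hg]
  have hzi : ∀ s, MeasurableSet s → (Measure.haar : Measure G) s < ⊤ →
      IntegrableOn (fun g => z n (y, g)) s (Measure.haar : Measure G) := by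
    intro s hs hfin
    have : IsFiniteMeasure ((Measure.haar : Measure G).restrict s) := ⟨by simpa using hfin⟩
    exact Integrable.of_bound ((hz n).comp measurable_prodMk_left).aestronglyMeasurable 1
      (ae_restrict_of_ae (hy.2 n))
  have h := ae_eq_zero_of_forall_setIntegral_eq_of_sigmaFinite
    (f := fun g => P (z n (y, g)) - z n (y, g)) (μ := (Measure.haar : Measure G))
    (fun s hs hfin => (P.integrable_comp (hzi s hs hfin)).sub (hzi s hs hfin))
    (fun s hs hfin => by
      rw [integral_sub (P.integrable_comp (hzi s hs hfin)) (hzi s hs hfin),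
        P.integral_comp_comm (hzi s hs hfin), sub_eq_zero]
      obtain ⟨F, hF⟩ := hF s hs hfin
      have := hP (F, n)
      simpa only [smear, hF] using this)
  filter_upwards [h] with g hg
  exact sub_eq_zero.1 hg

end Smear

namespace SystemOfImprimitivity

open HilbertBundle TransformationGroupoid GroupoidRep

section Disintegration

variable {X : Type u} {G : Type v}
    [Group G] [TopologicalSpace G] [IsTopologicalGroup G] [LocallyCompactSpace G] [T2Space G]
    [SecondCountableTopology G] [MeasurableSpace G] [BorelSpace G]
    [TopologicalSpace X] [LocallyCompactSpace X] [T2Space X] [SecondCountableTopology X]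
    [MeasurableSpace X] [BorelSpace X]
    [MulAction Gᵐᵒᵖ X] [ContinuousSMul Gᵐᵒᵖ X]

lemma adjoint_mem_sections {B : HilbertBundle.{u, w} X} {I : Type*} {j : ∀ x, I → B.Fiber x}
    {κ : ∀ x, B.Fiber x →L[ℂ] Ell2.{w}}
    (hj : ∀ ξ : ∀ x, B.Fiber x, (∀ i, Measurable fun x => ⟪j x i, ξ x⟫_ℂ) → ξ ∈ B.sections)
    (hκ : ∀ i, Measurable fun x => κ x (j x i)) {φ : X → Ell2.{w}} (hφ : Measurable φ) :
    (fun x => (κ x).adjoint (φ x)) ∈ B.sections := by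
  refine hj _ fun i => ?_
  simp only [ContinuousLinearMap.adjoint_inner_right]
  exact (hκ i).inner hφ

/-- If the adjoints of embeddings of the fibres turn measurable functions into measurable sections, then
the embeddings turn measurable sections into measurable functions. -/
lemma measurable_apply_section {B : HilbertBundle.{u, w} X} {κ : ∀ x, B.Fiber x →L[ℂ] Ell2.{w}}
    (hκ : ∀ φ : X → Ell2.{w}, Measurable φ → (fun x => (κ x).adjoint (φ x)) ∈ B.sections)
    {ξ : ∀ x, B.Fiber x} (hξ : ξ ∈ B.sections) : Measurable fun x => κ x (ξ x) := by
  classical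
  refine measurable_ell2 fun n => ?_
  have h1 : ∀ x, κ x (ξ x) n = ⟪(κ x).adjoint (lp.single 2 n (1 : ℂ)), ξ x⟫_ℂ := by
    intro x
    rw [ContinuousLinearMap.adjoint_inner_left, lp.inner_single_left]
    simp
  simp only [h1]
  exact B.measurable_inner _ (hκ _ measurable_const) _ hξ

/-- Every system of imprimitivity comes from a strict representation of the groupoid. -/
theorem exists_strict_integratesTo [Nonempty X] (S : SystemOfImprimitivity.{u, v, w'} G X) :
    ∃ R : GroupoidRep.{u, v, w} G X, R.IsStrict ∧ R.IntegratesTo S := by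
  obtain ⟨μ, J, hμ, hq, hJ⟩ := S.exists_spectral.{u, v, w, w'}
  obtain ⟨r, hr⟩ := hq.exists_isSqrtDensity
  let e : ℕ → S.H := TopologicalSpace.denseSeq S.H
  have hζex : ∀ n, ∃ ζ : X × G → Ell2.{w}, Measurable ζ ∧
      ∀ g, ∀ᵐ x ∂μ, ζ (x, g) = J ((S.U g : S.H →L[ℂ] S.H) (e n)) x := fun n =>
    exists_measurable_representative (J.continuous.comp (S.continuous_U (e n)))
  choose ζ hζm hζ using hζex
  have hcf := isCoefficientField hr hJ hζm hζ
  have hzm := hcf.measurable_z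
  obtain ⟨R, j, κ, rfl, hstrict, htot, hL, hsec, hκm, hκle, hκ⟩ := hcf.exists_strict hq
  have hadj : ∀ φ : X → Ell2.{w}, Measurable φ →
      (fun x => (κ x).adjoint (φ x)) ∈ R.bundle.sections := fun φ =>
    adjoint_mem_sections hsec hκm
  have hadjle : ∀ x c, ‖(κ x).adjoint c‖ ≤ ‖c‖ := fun x c => by
    refine ((κ x).adjoint.le_opNorm c).trans ?_
    rw [LinearIsometryEquiv.norm_map]
    exact mul_le_of_le_one_left (norm_nonneg _)
      ((κ x).opNorm_le_bound zero_le_one fun v => by simpa using hκle x v)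
  have hJm : ∀ v, Measurable (J v) := fun v => (Lp.stronglyMeasurable (J v)).measurable
  have hJfin : ∀ v, ∫⁻ x, ‖J v x‖ₑ ^ 2 ∂(R.μ) < ⊤ := fun v => by
    have := (Lp.memLp (J v)).2
    rw [eLpNorm_lt_top_iff_lintegral_rpow_enorm_lt_top (by simp) (by simp)] at this
    simpa using this
  -- The projection of `J v` to the fibres.
  let P : S.H → R.bundle.L2Section R.μ := fun v =>
    mkL2 (fun x => (κ x).adjoint (J v x)) (hadj _ (hJm v))
      ((lintegral_mono fun x => by
        gcongr
        rw [← ofReal_norm, ← ofReal_norm]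
        exact ENNReal.ofReal_le_ofReal (hadjle _ _)).trans_lt (hJfin v))
  have hP : ∀ v x, P v x = (κ x).adjoint (J v x) := fun v x => rfl
  have hJnorm : ∀ v, ‖v‖ ^ 2 = (∫⁻ x, ‖J v x‖ₑ ^ 2 ∂(R.μ)).toReal := fun v => by
    rw [← J.norm_map, Lp.norm_def, ← ENNReal.toReal_pow]
    congr 1
    rw [eLpNorm_eq_lintegral_rpow_enorm_toReal (by simp) (by simp)]
    simp only [ENNReal.toReal_ofNat, one_div]
    rw [← ENNReal.rpow_natCast, ← ENNReal.rpow_mul]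
    simp
  let Ψ₀ : S.H →ₗ[ℂ] R.bundle.L2 R.μ :=
    { toFun := fun v => R.bundle.toL2 R.μ (P v)
      map_add' := fun v v' => by
        refine (toL2_eq_iff (η := P v + P v')).2 ?_
        filter_upwards [Lp.coeFn_add (J v) (J v')] with x hx
        rw [hP, L2Section.add_apply, hP, hP, ← map_add, map_add J, hx, Pi.add_apply]
      map_smul' := fun c v => by
        refine (toL2_eq_iff (η := c • P v)).2 ?_
        filter_upwards [Lp.coeFn_smul c (J v)] with x hx
        rw [hP, L2Section.smul_apply, hP, ← map_smul, map_smul J, hx, Pi.smul_apply] }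
  have hΨle : ∀ v, ‖Ψ₀ v‖ ≤ 1 * ‖v‖ := fun v => by
    rw [one_mul, ← sq_le_sq₀ (norm_nonneg _) (norm_nonneg _), hJnorm]
    change ‖R.bundle.toL2 R.μ (P v)‖ ^ 2 ≤ _
    rw [norm_toL2_sq]
    refine ENNReal.toReal_mono (hJfin v).ne (lintegral_mono fun x => ?_)
    rw [← ofReal_norm, ← ofReal_norm]
    gcongr
    exact hadjle _ _
  let Ψ₁ : S.H →L[ℂ] R.bundle.L2 R.μ := Ψ₀.mkContinuous 1 hΨle
  have hΨ₁ : ∀ v, Ψ₁ v = R.bundle.toL2 R.μ (P v) := fun v => rfl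
  have hκinner : ∀ x, (∀ v, ‖κ x v‖ = ‖v‖) → ∀ a b, ⟪κ x a, κ x b⟫_ℂ = ⟪a, b⟫_ℂ := fun x hx =>
    LinearIsometry.inner_map_map ⟨(κ x).toLinearMap, hx⟩
  -- For almost every `g`, the vectors `J U(g) e n` lie in the fibres almost everywhere. One such `g`
  -- makes the projection isometric, as the vectors `U(g) e n` are dense.
  have hmem : ∃ g : G, ∀ n, ∀ᵐ x ∂(R.μ), ‖(κ x).adjoint (ζ n (x, g))‖ = ‖ζ n (x, g)‖ := by
    have hPm : Measurable (Function.uncurry fun (c : Ell2.{w}) x => κ x ((κ x).adjoint c)) :=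
      measurable_uncurry_of_continuous_of_measurable
        (fun x => (κ x).continuous.comp (κ x).adjoint.continuous)
        fun c => measurable_apply_section hadj (hadj _ measurable_const)
    have h1 : ∀ n, ∀ᵐ x ∂(R.μ), ∀ᵐ g ∂(Measure.haar : Measure G),
        κ x ((κ x).adjoint (coeffVec r ζ n (x, g))) = coeffVec r ζ n (x, g) := by
      intro n
      filter_upwards [hκ, hcf.ae_good] with x hx hy
      refine hy.ae_apply_eq hzm ((κ x).comp (κ x).adjoint) (fun i => ?_) n
      have h := (ContinuousLinearMap.norm_map_iff_adjoint_comp_self (κ x)).1 hx.1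
      rw [← hx.2, ContinuousLinearMap.comp_apply]
      exact congrArg (κ x) (DFunLike.congr_fun h (j x i))
    have h2 : ∀ n, ∀ᵐ g ∂(Measure.haar : Measure G), ∀ᵐ x ∂(R.μ),
        κ x ((κ x).adjoint (coeffVec r ζ n (x, g))) = coeffVec r ζ n (x, g) := fun n =>
      (Measure.ae_ae_comm (p := fun (x : X) (g : G) =>
        κ x ((κ x).adjoint (coeffVec r ζ n (x, g))) = coeffVec r ζ n (x, g))
        (measurableSet_eq_fun (hPm.comp ((hzm n).prodMk measurable_fst)) (hzm n))).1 (h1 n)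
    obtain ⟨g, hg⟩ := (ae_all_iff.2 h2).exists
    refine ⟨g, fun n => ?_⟩
    filter_upwards [hg n, hκ] with x hx hx'
    have h3 : ‖(κ x).adjoint (coeffVec r ζ n (x, g))‖ = ‖coeffVec r ζ n (x, g)‖ := by
      rw [← hx'.1, hx]
    rw [coeffVec, map_smul, norm_smul, norm_smul] at h3
    refine mul_left_cancel₀ (norm_ne_zero_iff.2 (Complex.ofReal_ne_zero.2 ?_)) h3
    exact (mul_pos (inv_pos.2 (hr.pos _)) (coeffWeight_pos _ _)).ne'
  have hnorm : ∀ v, ‖Ψ₁ v‖ = ‖v‖ := by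
    obtain ⟨g, hg⟩ := hmem
    have hs : Function.Surjective (S.U g : S.H →L[ℂ] S.H) := fun v =>
      ⟨(S.U g⁻¹ : S.H →L[ℂ] S.H) v, by simpa using S.U_inv_U g⁻¹ v⟩
    have hd : DenseRange fun n => (S.U g : S.H →L[ℂ] S.H) (e n) :=
      hs.denseRange.comp (TopologicalSpace.denseRange_denseSeq S.H)
        (S.U g : S.H →L[ℂ] S.H).continuous
    refine fun v => hd.induction_on (p := fun v => ‖Ψ₁ v‖ = ‖v‖) v
      (isClosed_eq Ψ₁.continuous.norm continuous_norm) fun n => ?_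
    rw [← sq_eq_sq₀ (norm_nonneg _) (norm_nonneg _), hJnorm, hΨ₁, norm_toL2_sq]
    congr 1
    refine lintegral_congr_ae ?_
    filter_upwards [hζ n g, hg n] with x h1 h2
    rw [hP, ← h1, ← ofReal_norm, h2, ofReal_norm]
  let Ψ₂ : S.H →ₗᵢ[ℂ] R.bundle.L2 R.μ := ⟨Ψ₁.toLinearMap, hnorm⟩
  have hΨπ : ∀ f v, Ψ₂ (S.π f v) = R.bundle.toL2 R.μ (c0Smul f (P v)) := by
    intro f v
    refine (toL2_eq_iff (ξ := P (S.π f v))).2 ?_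
    filter_upwards [hJ f v] with x hx
    rw [hP, c0Smul_apply, hP, hx, map_smul]
  -- A section orthogonal to all `P v` is orthogonal to the integrated vectors, which span the fibres.
  have hsurj : Function.Surjective Ψ₂ := by
    refine Ψ₂.surjective_of_total (fun v => Ψ₂ v) (total_of_forall_eq_zero _ fun u hu => ?_)
      fun v => ⟨v, rfl⟩
    obtain ⟨η, rfl⟩ := toL2_surjective u
    have h1 : ∀ v, ∀ᵐ x ∂(R.μ), ⟪P v x, η x⟫_ℂ = 0 := fun v => ae_inner_eq_zero fun f => by
      rw [← hΨπ]
      exact hu _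
    have h2 : ∀ n, ∀ᵐ x ∂(R.μ), ∀ᵐ g ∂(Measure.haar : Measure G),
        ⟪coeffVec r ζ n (x, g), κ x (η x)⟫_ℂ = 0 := by
      intro n
      refine (Measure.ae_ae_comm (p := fun (x : X) (g : G) =>
        ⟪coeffVec r ζ n (x, g), κ x (η x)⟫_ℂ = 0) (measurableSet_eq_fun ((hzm n).inner
          ((measurable_apply_section hadj η.2.1).comp measurable_fst)) measurable_const)).2
        (Filter.Eventually.of_forall fun g => ?_)
      filter_upwards [h1 ((S.U g : S.H →L[ℂ] S.H) (e n)), hζ n g] with x k1 k2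
      rw [coeffVec, inner_smul_left, k2, ← ContinuousLinearMap.adjoint_inner_left, ← hP, k1,
        mul_zero]
    refine (toL2_eq_iff (η := 0)).2 ?_
    filter_upwards [hκ, hcf.ae_good, ae_all_iff.2 h2] with x hx hy h
    refine eq_zero_of_inner_total _ (htot x) fun i => ?_
    rw [← hκinner x hx.1, hx.2, hy.inner_smear_left hzm]
    refine integral_eq_zero_of_ae ?_
    filter_upwards [h i.2] with g hg
    rw [hg, mul_zero, Pi.zero_apply]
  have hΨU : ∀ g v, Ψ₂ ((S.U g : S.H →L[ℂ] S.H) v) = R.bundle.toL2 R.μ (R.translate hr g (P v)) := by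
    intro g v
    refine toL2_eq_iff.2 ?_
    have h1 : ∀ n, ∀ᵐ x ∂(R.μ), ∀ᵐ h ∂(Measure.haar : Measure G),
        ⟪coeffVec r ζ n (x, h), J ((S.U g : S.H →L[ℂ] S.H) v) x⟫_ℂ =
          ((r (x, g) : ℝ) : ℂ) * ⟪coeffVec r ζ n (x <• g, g⁻¹ * h), J v (x <• g)⟫_ℂ := by
      intro n
      refine (Measure.ae_ae_comm (p := fun (x : X) (h : G) =>
        ⟪coeffVec r ζ n (x, h), J ((S.U g : S.H →L[ℂ] S.H) v) x⟫_ℂ =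
          ((r (x, g) : ℝ) : ℂ) * ⟪coeffVec r ζ n (x <• g, g⁻¹ * h), J v (x <• g)⟫_ℂ)
        (measurableSet_eq_fun ?_ ?_)).2
        (Filter.Eventually.of_forall fun h => inner_coeffVec hr hJ hζ n g h v)
      · exact (hzm n).inner ((hJm _).comp measurable_fst)
      · have k1 : Measurable fun t : X × G => t.1 <• g :=
          (measurable_rsmul_const g).comp measurable_fst
        have k2 : Measurable fun t : X × G => ((r (t.1, g) : ℝ) : ℂ) :=
          Complex.measurable_ofReal.comp ((hr.measurable_right g).comp measurable_fst)
        exact k2.mul (((hzm n).comp (k1.prodMk (measurable_snd.const_mul _))).inner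
          ((hJm v).comp k1))
    filter_upwards [hκ, hcf.ae_good, hr.ae_rsmul g hκ, hr.ae_rsmul g hcf.ae_good,
      ae_all_iff.2 h1] with x hx hy hx' hy' h
    rw [← sub_eq_zero]
    refine eq_zero_of_inner_total _ (htot x) fun i => ?_
    -- Both sides are tested against `j x i`, which `L (x, g)` moves to `j (x g) (shiftIndex g i)`.
    rw [inner_sub_right, sub_eq_zero, hP, ContinuousLinearMap.adjoint_inner_right, hx.2,
      hy.inner_smear_left hzm, GroupoidRep.translate_apply, inner_smul_right,
      ← (R.L (arrow x g)).inner_map_map, LinearIsometryEquiv.apply_symm_apply, hL, hP,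
      ContinuousLinearMap.adjoint_inner_right, hx'.2, hy'.inner_smear_left hzm,
      ← integral_const_mul]
    refine Eq.trans (integral_congr_ae ?_) (integral_mul_left_eq_self (μ := Measure.haar) (fun h : G =>
      ((r (x, g) : ℝ) : ℂ) * ((starRingEnd ℂ) ((shiftIndex (arrow x g).elt i).1 h) *
        ⟪coeffVec r ζ i.2 (x <• g, h), J v (x <• g)⟫_ℂ)) g⁻¹)
    filter_upwards [h i.2] with k hk
    change _ = ((r (x, g) : ℝ) : ℂ) * ((starRingEnd ℂ) (i.1 (g * (g⁻¹ * k))) * _)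
    rw [hk, mul_inv_cancel_left]
    ring
  let Ψ : S.H ≃ₗᵢ[ℂ] R.bundle.L2 R.μ := LinearIsometryEquiv.ofSurjective Ψ₂ hsurj
  refine ⟨R, hstrict, (integratesTo_iff hr).2 ⟨Ψ.symm, fun f ξ => ?_,
    Filter.Eventually.of_forall fun g ξ => ?_⟩⟩
  · rw [← Ψ.symm_apply_apply (S.π f _)]
    refine congrArg Ψ.symm ((hΨπ f _).trans (toL2_eq_iff.2 ?_))
    have h1 : R.bundle.toL2 R.μ (P (Ψ.symm (R.bundle.toL2 R.μ ξ))) = R.bundle.toL2 R.μ ξ :=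
      Ψ.apply_symm_apply _
    filter_upwards [toL2_eq_iff.1 h1] with x hx
    rw [c0Smul_apply, c0Smul_apply, hx]
  · rw [← Ψ.symm_apply_apply ((S.U g : S.H →L[ℂ] S.H) _)]
    refine congrArg Ψ.symm ((hΨU g _).trans (toL2_eq_iff.2 ?_))
    have h1 : R.bundle.toL2 R.μ (P (Ψ.symm (R.bundle.toL2 R.μ ξ))) = R.bundle.toL2 R.μ ξ :=
      Ψ.apply_symm_apply _
    filter_upwards [hr.ae_rsmul g (toL2_eq_iff.1 h1)] with x hx
    rw [GroupoidRep.translate_apply, GroupoidRep.translate_apply, hx]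

end Disintegration

end SystemOfImprimitivity

end

theorem mainTheorem1 {X : Type u} {G : Type v}
    [Group G] [TopologicalSpace G] [IsTopologicalGroup G] [LocallyCompactSpace G] [T2Space G]
    [SecondCountableTopology G] [MeasurableSpace G] [BorelSpace G]
    [TopologicalSpace X] [LocallyCompactSpace X] [T2Space X] [SecondCountableTopology X]
    [Nonempty X] [MeasurableSpace X] [BorelSpace X]
    [MulAction Gᵐᵒᵖ X] [ContinuousSMul Gᵐᵒᵖ X] :
    (∃ Φ : Quotient (GroupoidRep.setoid.{u, v, w} G X) ≃ Quotient (SystemOfImprimitivity.setoid.{u, v, w'} G X),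
      ∀ (R : GroupoidRep.{u, v, w} G X) (S : SystemOfImprimitivity.{u, v, w'} G X),
        Φ (Quotient.mk _ R) = Quotient.mk _ S ↔ R.IntegratesTo S) ∧
    ∀ R : GroupoidRep.{u, v, w} G X, ∃ R' : GroupoidRep.{u, v, w} G X, R'.IsStrict ∧ R.Equivalent R' := by
  refine ⟨?_, fun R => ?_⟩
  · choose I hI using fun R : GroupoidRep.{u, v, w} G X =>
      GroupoidRep.exists_integratesTo.{u, v, w, w'} R
    let F : Quotient (GroupoidRep.setoid.{u, v, w} G X) →
        Quotient (SystemOfImprimitivity.setoid.{u, v, w'} G X) :=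
      Quotient.map I fun R₁ R₂ h => (hI R₁).equivalent (.of_rep_equivalent h (hI R₂))
    have hF : ∀ (R : GroupoidRep.{u, v, w} G X) (S : SystemOfImprimitivity.{u, v, w'} G X),
        F (Quotient.mk _ R) = Quotient.mk _ S ↔ R.IntegratesTo S := fun R S =>
      ⟨fun h => (hI R).of_equivalent (Quotient.exact h), fun h => Quotient.sound ((hI R).equivalent h)⟩
    refine ⟨Equiv.ofBijective F ⟨?_, ?_⟩, hF⟩
    · rintro ⟨R₁⟩ ⟨R₂⟩ h
      exact Quotient.sound (((hF R₁ (I R₂)).1 h).rep_equivalent (hI R₂))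
    · rintro ⟨S⟩
      obtain ⟨R, -, h⟩ := S.exists_strict_integratesTo
      exact ⟨Quotient.mk _ R, (hF R S).2 h⟩
  · obtain ⟨S, hS⟩ := GroupoidRep.exists_integratesTo.{u, v, w, w'} R
    obtain ⟨R', hs, h⟩ := S.exists_strict_integratesTo
    exact ⟨R', hs, hS.rep_equivalent h⟩
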